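/- Let $m,k,N,r$ be positive integers and let $p$ be a prime with $p\nmid 2N$. Let $\mathbb H_m$ be the Siegel upper half space of complex symmetric $m\times m$ matrices $Z=X+iY$ with $Y$ positive definite, and let $\Gamma_{2m}(N)=\{\gamma\in \mathrm{Sp}_{2m}(\mathbb Z):\gamma\equiv 1 \bmod N\}$. For $\gamma=\begin{pmatrix}A&B\\C&D\end{pmatrix}\in\mathrm{Sp}_{2m}(\mathbb Z)$ put $(F|_k\gamma)(Z)=\det(CZ+D)^{-k}F\big((AZ+B)(CZ+D)^{-1}\big)$. Let $\mathcal O_p$ be the ring of all $x$ in the algebraic closure $\overline{\mathbb Q}$ of $\mathbb Q$ in $\mathbb C$ whose $\lambda$-adic valuation is non-negative for every prime $\lambda$ of $\overline{\mathbb Q}$ above $p$. Let $M_k(\Gamma_{2m}(N))$ be the space of holomorphic Siegel modular forms of degree $m$ and weight $k$ for $\Gamma_{2m}(N)$, i.e. holomorphic $F:\mathbb H_m\to\mathbb C$ with $F|_k\gamma=F$ for all $\gamma\in\Gamma_{2m}(N)$ and, if $m=1$, such that for every $\gamma\in\mathrm{Sp}_2(\mathbb Z)$ the function $F|_k\gamma$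 has a Fourier expansion $\sum_{S\ge 0}a(S)e^{2\pi i\,\mathrm{tr}(SZ)}$ over rational $S\geq 0$. Let $N_k(\Gamma_{2m}(N))$ be the space of nearly holomorphic forms, defined in the same way except that $F$ is only required to be a polynomial in the entries of $Y^{-1}$ over the ring of holomorphic functions on $\mathbb H_m$, and that, if $m=1$, the expansions of the $F|_k\gamma$ are allowed to have the form $$\sum_{S\ge 0}P\big((2\pi Y)^{-1};S\big)\,e^{2\pi i\,\mathrm{tr}(SZ)},\qquad(*)$$ where $S$ runs over the positive semidefinite matrices in $M_m^{\mathrm{sym}}(\mathbb Q)$ and each $P(\,\cdot\,;S)$ is a complex polynomial in the independent entries of a symmetric $m\times m$ matrix. For a subring $R\subset\mathbb C$, let $N_k(\Gamma_{2m}(N),R)$ be the set of $F\in N_k(\Gamma_{2m}(N))$ that have an expansion $(*)$ in which all coefficients of all the polynomials $P(\,\cdot\,;S)$ lie in $R$, and let $M_k(\Gamma_{2m}(N),R)=N_k(\Gamma_{2m}(N),R)\cap M_k(\Gamma_{2m}(N))$. Let $\partial_{ij}=\frac{\partial}{\partial Z_{ij}}$ if $i=j$ and $\partial_{ij}=\frac12\frac{\partial}{\partial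 Z_{ij}}$ if $i\ne j$, let $\Delta=\det(\partial_{ij})$ and $\kappa=\frac{m+1}2$, and define the Maass operator on smooth functions $f:\mathbb H_m\to\mathbb C$ by $$(\Delta_kf)(Z)=\det(Z-\bar Z)^{\kappa-k-1}\,\Delta\Big(\det(Z-\bar Z)^{k-\kappa+1}f(Z)\Big).$$ Put $\Delta_k^r=\Delta_{k+2(r-1)}\circ\cdots\circ\Delta_{k+2}\circ\Delta_k$. Then for every $F\in M_k(\Gamma_{2m}(N),\mathcal O_p)$, $$\pi^{-mr}\Delta_k^rF\in N_{k+2r}(\Gamma_{2m}(N),\mathcal O_p).$$ -/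

import Mathlib

/-!
Complex-valued functions on the Siegel upper half space are represented by functions on all complex
`m × m` matrices; every notion below looks only at their values on the Siegel upper half space.
-/

noncomputable section

namespace Siegel

/-- The Siegel upper half space of degree `m`: complex symmetric matrices `X + iY` with `Y` positive
definite. -/
def upperHalfSpace (m : ℕ) : Set (Matrix (Fin m) (Fin m) ℂ) :=
  {Z | Z.IsSymm ∧ (Z.map Complex.im).PosDef}

/-- The principal congruence subgroup of level `N` of `Sp_{2m}(ℤ)`, the kernel of reduction
modulo `N`. -/
def principalCongruenceSubgroup (m N : ℕ) : Subgroup (Matrix.symplecticGroup (Fin m) ℤ) :=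
  (((Int.castRingHom (ZMod N)).mapMatrix :
      Matrix (Fin m ⊕ Fin m) (Fin m ⊕ Fin m) ℤ →+* Matrix (Fin m ⊕ Fin m) (Fin m ⊕ Fin m) (ZMod N)
    ).toMonoidHom.comp (Matrix.symplecticGroup (Fin m) ℤ).subtype).ker

/-- For `γ = (A B; C D)`, the matrix `A Z + B`. -/
def num {m : ℕ} (γ : Matrix.symplecticGroup (Fin m) ℤ) (Z : Matrix (Fin m) (Fin m) ℂ) :
    Matrix (Fin m) (Fin m) ℂ :=
  γ.1.toBlocks₁₁.map (Int.cast : ℤ → ℂ) * Z + γ.1.toBlocks₁₂.map (Int.cast : ℤ → ℂ)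

/-- For `γ = (A B; C D)`, the matrix `C Z + D`. -/
def denom {m : ℕ} (γ : Matrix.symplecticGroup (Fin m) ℤ) (Z : Matrix (Fin m) (Fin m) ℂ) :
    Matrix (Fin m) (Fin m) ℂ :=
  γ.1.toBlocks₂₁.map (Int.cast : ℤ → ℂ) * Z + γ.1.toBlocks₂₂.map (Int.cast : ℤ → ℂ)

/-- The weight `k` action
`(F|_k γ)(Z) = det(CZ + D)^{-k} F((AZ + B)(CZ + D)⁻¹)`. -/
def slash {m : ℕ} (k : ℕ) (F : Matrix (Fin m) (Fin m) ℂ → ℂ)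
    (γ : Matrix.symplecticGroup (Fin m) ℤ) : Matrix (Fin m) (Fin m) ℂ → ℂ :=
  fun Z => ((denom γ Z).det ^ k)⁻¹ * F (num γ Z * (denom γ Z)⁻¹)

/-- Index set for the independent entries of a symmetric `m × m` matrix. -/
abbrev SymIndex (m : ℕ) : Type := {ij : Fin m × Fin m // ij.1 ≤ ij.2}

/-- The entries, on and above the diagonal, of a real matrix, as complex numbers. -/
def symEntries {m : ℕ} (M : Matrix (Fin m) (Fin m) ℝ) : SymIndex m → ℂ :=
  fun ij => (M ij.1.1 ij.1.2 : ℂ)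

/-- `F` is a polynomial in the entries of `Im(Z)⁻¹` over the ring of holomorphic functions on the
Siegel upper half space. (That space is open in the symmetric matrices, so complex
differentiability within it is holomorphy in the entries `Z_{ij}`, `i ≤ j`.) -/
def IsNearlyHolomorphic {m : ℕ} (F : Matrix (Fin m) (Fin m) ℂ → ℂ) : Prop :=
  ∃ P : MvPolynomial (SymIndex m) (Matrix (Fin m) (Fin m) ℂ → ℂ),
    (∀ d, DifferentiableOn ℂ (P.coeff d) (upperHalfSpace m)) ∧
    ∀ Z ∈ upperHalfSpace m,
      F Z = MvPolynomial.eval (symEntries (Z.map Complex.im)⁻¹)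
        (MvPolynomial.map (Pi.evalRingHom (fun _ : Matrix (Fin m) (Fin m) ℂ => ℂ) Z) P)

/-- Rational symmetric positive semidefinite matrices. -/
abbrev FourierIndex (m : ℕ) : Type :=
  {S : Matrix (Fin m) (Fin m) ℚ // S.IsSymm ∧ (S.map (Rat.cast : ℚ → ℝ)).PosSemidef}

/-- `F(Z) = ∑_{S ≥ 0} P_S((2πY)⁻¹) e^{2πi tr(SZ)}` on the Siegel upper half space, where
`Y = Im Z`. -/
def HasFourierExpansion {m : ℕ} (F : Matrix (Fin m) (Fin m) ℂ → ℂ)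
    (P : FourierIndex m → MvPolynomial (SymIndex m) ℂ) : Prop :=
  ∀ Z ∈ upperHalfSpace m,
    HasSum (fun S : FourierIndex m =>
      MvPolynomial.eval (symEntries ((2 * Real.pi) • Z.map Complex.im)⁻¹) (P S) *
        Complex.exp (2 * Real.pi * Complex.I *
          (S.1.map (Rat.cast : ℚ → ℂ) * Z).trace)) (F Z)

/-- `M_k(Γ)`: holomorphic Siegel modular forms of degree `m` and weight `k` for `Γ`. In degree one,
holomorphy at all cusps is required. -/
def modularForms {m : ℕ} (k : ℕ) (Γ : Subgroup (Matrix.symplecticGroup (Fin m) ℤ)) :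
    Set (Matrix (Fin m) (Fin m) ℂ → ℂ) :=
  {F | DifferentiableOn ℂ F (upperHalfSpace m) ∧
    (∀ γ ∈ Γ, Set.EqOn (slash k F γ) F (upperHalfSpace m)) ∧
    (m = 1 → ∀ γ : Matrix.symplecticGroup (Fin m) ℤ, ∃ a : FourierIndex m → ℂ,
      HasFourierExpansion (slash k F γ) (fun S => MvPolynomial.C (a S)))}

/-- `N_k(Γ)`: nearly holomorphic Siegel modular forms of degree `m` and weight `k` for `Γ`. In
degree one, the condition at all cusps is required. -/
def nearlyHolomorphicForms {m : ℕ} (k : ℕ) (Γ : Subgroup (Matrix.symplecticGroup (Fin m) ℤ)) :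
    Set (Matrix (Fin m) (Fin m) ℂ → ℂ) :=
  {F | IsNearlyHolomorphic F ∧
    (∀ γ ∈ Γ, Set.EqOn (slash k F γ) F (upperHalfSpace m)) ∧
    (m = 1 → ∀ γ : Matrix.symplecticGroup (Fin m) ℤ,
      ∃ P : FourierIndex m → MvPolynomial (SymIndex m) ℂ, HasFourierExpansion (slash k F γ) P)}

/-- `N_k(Γ, R)`: the elements of `N_k(Γ)` whose polynomial Fourier coefficients have all their
coefficients in `R`. -/
def nearlyHolomorphicFormsOver {m : ℕ} (k : ℕ) (Γ : Subgroup (Matrix.symplecticGroup (Fin m) ℤ))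
    (R : Subring ℂ) : Set (Matrix (Fin m) (Fin m) ℂ → ℂ) :=
  {F | F ∈ nearlyHolomorphicForms k Γ ∧
    ∃ P : FourierIndex m → MvPolynomial (SymIndex m) ℂ,
      HasFourierExpansion F P ∧ ∀ S d, (P S).coeff d ∈ R}

/-- `M_k(Γ, R) = N_k(Γ, R) ∩ M_k(Γ)`. -/
def modularFormsOver {m : ℕ} (k : ℕ) (Γ : Subgroup (Matrix.symplecticGroup (Fin m) ℤ))
    (R : Subring ℂ) : Set (Matrix (Fin m) (Fin m) ℂ → ℂ) :=
  nearlyHolomorphicFormsOver k Γ R ∩ modularForms k Γ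

/-- The ring `O_p` of `p`-integral algebraic numbers: the elements of the algebraic closure of `ℚ`
in `ℂ` that lie in the valuation ring of every prime above `p`, that is, in every valuation ring of
that field whose maximal ideal contains `p`. -/
def pIntegers (p : ℕ) : Subring ℂ :=
  (⨅ (A : ValuationSubring (algebraicClosure ℚ ℂ))
      (_ : (p : algebraicClosure ℚ ℂ) ∈ A.nonunits), A.toSubring).map
    (algebraMap (algebraicClosure ℚ ℂ) ℂ)

/-- The direction in the space of symmetric matrices that belongs to the coordinate `Z_{ij}`. -/
def symUnit {m : ℕ} (i j : Fin m) : Matrix (Fin m) (Fin m) ℂ :=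
  if i = j then Matrix.single i i 1 else Matrix.single i j 1 + Matrix.single j i 1

/-- The operator `∂/∂Z_{ij} = (∂/∂X_{ij} - i ∂/∂Y_{ij}) / 2` on smooth functions of the symmetric
matrix `Z = X + iY`. -/
def wirtinger {m : ℕ} (i j : Fin m) (f : Matrix (Fin m) (Fin m) ℂ → ℂ) :
    Matrix (Fin m) (Fin m) ℂ → ℂ :=
  fun Z => (1 / 2) * (lineDeriv ℝ f Z (symUnit i j) -
    Complex.I * lineDeriv ℝ f Z (Complex.I • symUnit i j))

/-- The operator `∂_{ij}`: `∂/∂Z_{ii}` on the diagonal, `(1/2) ∂/∂Z_{ij}` off the diagonal. -/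
def partialZ {m : ℕ} (i j : Fin m) (f : Matrix (Fin m) (Fin m) ℂ → ℂ) :
    Matrix (Fin m) (Fin m) ℂ → ℂ :=
  fun Z => (if i = j then 1 else 1 / 2) * wirtinger i j f Z

/-- The operator `Δ = det(∂_{ij}) = ∑_σ sgn(σ) ∏_i ∂_{σ(i) i}`, products being compositions (their
order does not matter on smooth functions). -/
def detPartial {m : ℕ} (f : Matrix (Fin m) (Fin m) ℂ → ℂ) : Matrix (Fin m) (Fin m) ℂ → ℂ :=
  fun Z => ∑ σ : Equiv.Perm (Fin m), ((Equiv.Perm.sign σ : ℤ) : ℂ) *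
    (List.finRange m).foldr (fun i g => partialZ (σ i) i g) f Z

/-- `det(Z - Z̄)`. On the Siegel upper half space it lies on the fixed ray `(2i)^m ℝ_{>0}`, where
the complex powers below are smooth, and where the choice of a branch does not affect
`maassOperator`. -/
def detSubConj {m : ℕ} (Z : Matrix (Fin m) (Fin m) ℂ) : ℂ :=
  (Z - Z.map (starRingEnd ℂ)).det

/-- The Maass operator
`(Δ_k f)(Z) = det(Z - Z̄)^{κ-k-1} Δ(det(Z - Z̄)^{k-κ+1} f(Z))`, with `κ = (m+1)/2`. -/
def maassOperator {m : ℕ} (k : ℕ) (f : Matrix (Fin m) (Fin m) ℂ → ℂ) :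
    Matrix (Fin m) (Fin m) ℂ → ℂ :=
  fun Z => detSubConj Z ^ (((m : ℂ) + 1) / 2 - k - 1) *
    detPartial (fun W => detSubConj W ^ ((k : ℂ) - ((m : ℂ) + 1) / 2 + 1) * f W) Z

/-- `Δ_k^r = Δ_{k+2(r-1)} ∘ ⋯ ∘ Δ_{k+2} ∘ Δ_k`. -/
def iteratedMaass {m : ℕ} (k : ℕ) : ℕ → (Matrix (Fin m) (Fin m) ℂ → ℂ) →
    Matrix (Fin m) (Fin m) ℂ → ℂ
  | 0, f => f
  | r + 1, f => maassOperator (k + 2 * r) (iteratedMaass k r f)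

end Siegel

end

/-!
The assertion has two halves: the Maass operators respect modularity, and after division by the
appropriate power of `π` they respect expansions `∑ P_S((2πY)⁻¹) e^{2πi tr(SZ)}` with coefficients
in a ring that contains `i`, `1/2` and the entries of all frequencies `S` that occur.

*Modularity.* `Δ_k` carries the weight `k` action of `Sp_{2m}(ℝ)` into the weight `k + 2` action
(`maassEquivariant`). Since `det(Z - Z̄)` is multiplied by `|det(CZ + D)|⁻²` under a symplectic
substitution, conjugation by `det(Z - Z̄)^σ` shifts weights, and the claim is the case of one
weight: `Δ` itself intertwines weights `(m-1)/2` and `(m+3)/2` (`DetOpEquivariant`). This needs to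
be known on generators only. For block upper triangular matrices the substitution is affine
(`detOp_linear`). The inversion `Z ↦ -Z⁻¹` is a product of partial inversions in one coordinate
`o`, under which a derivative `∂_{ij}` is affected only if `i = o` or `j = o`; expanding the
determinant `Δ` along row and column `o` leaves an explicit computation with second order
operators (`detOp_partialInversion`), where the weight `(m-1)/2` is what makes the lower order
terms cancel. To do this algebraically, smooth functions on the half space are treated as a
commutative algebra `smoothAlg` with commuting derivations `∂_{ij}`, which generate a commutative
ring of operators.

*Coefficients.* `π⁻¹ ∂_{ij}` maps an entry of `(2πY)⁻¹` to `i/2` times a quadratic form in such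
entries (`pd_imInv`) and multiplies `e^{2πi tr(SZ)}` by `2i S_{ij}`. Conjugation by `det(Z -
Z̄)^σ` adds `-iσ` times an entry of `(2πY)⁻¹`. So `π⁻ᵐ Δ_k` is a signed sum of compositions of `m`
operators of this kind (`pi_inv_pow_smul_maass`), each of which preserves the group
`nearlyFourier` of functions with expansions over a ring as above (`maassIter_mem_nearlyFourier`).

*The form `F`.* What is given for `F` is an expansion with polynomial coefficients and arbitrary
rational frequencies. Because `F` is holomorphic and invariant under `Z ↦ Z + NB`, the mean values
that isolate the coefficient of one `S` along lines `Z + wV`, for a positive definite `V` whose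
traces `tr(SV)` separate all `S`, do not depend on `Im w`, while `Y⁻¹` tends to `0` as `Im w`
grows. Hence the polynomials can be replaced by their constant terms, and the frequencies lie in
`(2N)⁻¹ ℤ` (`fourier_of_periodic`). As `p ∤ 2N`, the numbers `i`, `1/2` and `(2N)⁻¹` are
`p`-integral. The condition at the cusps for `m = 1` follows from the same argument for `F|_k γ`
over the ring `ℂ`, by equivariance.
-/

noncomputable section

namespace Siegel

open Matrix
open scoped ContDiff Topology

variable {m : ℕ}

section

/-! ### Coordinates on the symmetric matrices -/

/-- The symmetric matrix with the given entries on and above the diagonal. -/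
def ofEntries {m : ℕ} (u : SymIndex m → ℂ) : Matrix (Fin m) (Fin m) ℂ :=
  Matrix.of fun i j => u ⟨(min i j, max i j), min_le_max⟩

/-- The entries of a matrix on and above the diagonal. -/
def entries {m : ℕ} (Z : Matrix (Fin m) (Fin m) ℂ) : SymIndex m → ℂ :=
  fun ij => Z ij.1.1 ij.1.2


theorem ofEntries_apply (u : SymIndex m → ℂ) (i j : Fin m) :
    ofEntries u i j = u ⟨(min i j, max i j), min_le_max⟩ := rfl

theorem ofEntries_isSymm (u : SymIndex m → ℂ) : (ofEntries u).IsSymm := by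
  ext i j
  simp [ofEntries, min_comm, max_comm]

theorem ofEntries_entries {Z : Matrix (Fin m) (Fin m) ℂ} (hZ : Z.IsSymm) :
    ofEntries (entries Z) = Z := by
  ext i j
  rcases le_total i j with h | h
  · simp [ofEntries, entries, h]
  · simp [ofEntries, entries, h, hZ.apply i j]

theorem entries_ofEntries (u : SymIndex m → ℂ) : entries (ofEntries u) = u := by
  funext ij
  rcases ij with ⟨⟨i, j⟩, h⟩
  have h' : i ≤ j := h
  simp [ofEntries, entries, h']

theorem ofEntries_add (u v : SymIndex m → ℂ) : ofEntries (u + v) = ofEntries u + ofEntries v := rfl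

theorem ofEntries_smul {R : Type*} [SMul R ℂ] (c : R) (u : SymIndex m → ℂ) :
    ofEntries (c • u) = c • ofEntries u := rfl

/-- The Siegel upper half space in the coordinates `Z_{ij}`, `i ≤ j`. -/
def coordDomain (m : ℕ) : Set (SymIndex m → ℂ) := {u | ofEntries u ∈ upperHalfSpace m}

theorem entries_mem_coordDomain {Z : Matrix (Fin m) (Fin m) ℂ} (hZ : Z ∈ upperHalfSpace m) :
    entries Z ∈ coordDomain m := by
  rw [coordDomain, Set.mem_ofPred_eq, ofEntries_entries hZ.1]; exact hZ

theorem isSymm_of_posDef {Y : Matrix (Fin m) (Fin m) ℝ} (hY : Y.PosDef) : Y.IsSymm := by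
  have := hY.isHermitian
  rwa [Matrix.IsHermitian, Matrix.conjTranspose_eq_transpose_of_trivial] at this

theorem isHermitian_of_isSymm {Y : Matrix (Fin m) (Fin m) ℝ} (hY : Y.IsSymm) : Y.IsHermitian := by
  rwa [Matrix.IsHermitian, Matrix.conjTranspose_eq_transpose_of_trivial]

/-- A positive definite real form is bounded below by a positive multiple of the standard one, by
compactness of the unit sphere. -/
theorem exists_pos_le_of_posDef {Y : Matrix (Fin m) (Fin m) ℝ} (hY : Y.PosDef) :
    ∃ ε > 0, ∀ x : Fin m → ℝ, ε * (x ⬝ᵥ x) ≤ x ⬝ᵥ (Y *ᵥ x) := by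
  have hcont : Continuous fun x : Fin m → ℝ => x ⬝ᵥ (Y *ᵥ x) := by fun_prop
  have hcont' : Continuous fun x : Fin m → ℝ => x ⬝ᵥ x := by fun_prop
  have hpos : ∀ x : Fin m → ℝ, x ≠ 0 → 0 < x ⬝ᵥ (Y *ᵥ x) := fun x hx => by
    simpa using hY.dotProduct_mulVec_pos hx
  have hS : IsCompact {x : Fin m → ℝ | x ⬝ᵥ x = 1} := by
    refine Metric.isCompact_of_isClosed_isBounded (isClosed_eq hcont' continuous_const) ?_
    refine (Metric.isBounded_iff_subset_closedBall 0).2 ⟨1, fun x hx => ?_⟩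
    rw [mem_closedBall_zero_iff, pi_norm_le_iff_of_nonneg zero_le_one]
    intro i
    have h1 : x i * x i ≤ x ⬝ᵥ x :=
      Finset.single_le_sum (f := fun i => x i * x i) (fun j _ => mul_self_nonneg _)
        (Finset.mem_univ i)
    have h2 : x ⬝ᵥ x = 1 := hx
    rw [Real.norm_eq_abs, abs_le_one_iff_mul_self_le_one]
    linarith
  rcases Set.eq_empty_or_nonempty {x : Fin m → ℝ | x ⬝ᵥ x = 1} with hne | hne
  · refine ⟨1, one_pos, fun x => ?_⟩
    by_cases hx : x = 0
    · simp [hx]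
    · exfalso
      have h0 : 0 < x ⬝ᵥ x := by
        simpa using (Matrix.dotProduct_star_self_pos_iff (v := x)).2 hx
      have : (Real.sqrt (x ⬝ᵥ x))⁻¹ • x ∈ {x : Fin m → ℝ | x ⬝ᵥ x = 1} := by
        have h3 := Real.mul_self_sqrt h0.le
        have h4 := (Real.sqrt_pos.2 h0).ne'
        simp only [Set.mem_ofPred_eq, smul_dotProduct, dotProduct_smul, smul_eq_mul]
        field_simp
        nlinarith
      rw [hne] at this
      exact this
  · obtain ⟨x₀, hx₀, hmin⟩ := hS.exists_isMinOn hne hcont.continuousOn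
    have hx₀' : x₀ ≠ 0 := by
      rintro rfl
      simp at hx₀
    refine ⟨_, hpos x₀ hx₀', fun x => ?_⟩
    by_cases hx : x = 0
    · simp [hx]
    have h0 : 0 < x ⬝ᵥ x := by
      simpa using (Matrix.dotProduct_star_self_pos_iff (v := x)).2 hx
    have h3 := Real.mul_self_sqrt h0.le
    have h4 := (Real.sqrt_pos.2 h0)
    have hmem : (Real.sqrt (x ⬝ᵥ x))⁻¹ • x ∈ {x : Fin m → ℝ | x ⬝ᵥ x = 1} := by
      simp only [Set.mem_ofPred_eq, smul_dotProduct, dotProduct_smul, smul_eq_mul]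
      field_simp
      nlinarith
    have h5 := hmin hmem
    simp only [Set.mem_ofPred_eq, mulVec_smul, smul_dotProduct, dotProduct_smul, smul_eq_mul] at h5
    set q := x ⬝ᵥ (Y *ᵥ x)
    set c := x₀ ⬝ᵥ (Y *ᵥ x₀)
    rw [← h3]
    have h6 : c * (Real.sqrt (x ⬝ᵥ x) * Real.sqrt (x ⬝ᵥ x)) ≤
        ((Real.sqrt (x ⬝ᵥ x))⁻¹ * ((Real.sqrt (x ⬝ᵥ x))⁻¹ * q)) *
        (Real.sqrt (x ⬝ᵥ x) * Real.sqrt (x ⬝ᵥ x)) :=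
      mul_le_mul_of_nonneg_right h5 (by positivity)
    refine h6.trans_eq ?_
    field_simp

/-- Positive definiteness is an open condition, uniformly: near a positive definite `Y` all
symmetric matrices are bounded below by a fixed positive multiple of the identity. -/
theorem exists_pos_sub_posDef {Y : Matrix (Fin m) (Fin m) ℝ} (hY : Y.PosDef) :
    ∃ δ > 0, ∀ W : Matrix (Fin m) (Fin m) ℝ, W.IsSymm → (∀ i j, |W i j - Y i j| ≤ δ) →
      (W - δ • (1 : Matrix (Fin m) (Fin m) ℝ)).PosDef := by
  obtain ⟨ε, hε, hle⟩ := exists_pos_le_of_posDef hY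
  refine ⟨ε / (m + 2), by positivity, fun W hW hWY => ?_⟩
  set δ := ε / (m + 2) with hδ
  have hδ0 : 0 < δ := by positivity
  refine Matrix.PosDef.of_dotProduct_mulVec_pos ?_ fun x hx => ?_
  · refine (isHermitian_of_isSymm hW).sub ?_
    apply isHermitian_of_isSymm
    simp [Matrix.IsSymm]
  · have h0 : 0 < x ⬝ᵥ x := by
      simpa using (Matrix.dotProduct_star_self_pos_iff (v := x)).2 hx
    have h1 : |x ⬝ᵥ ((W - Y) *ᵥ x)| ≤ δ * (m * (x ⬝ᵥ x)) := by
      calc |x ⬝ᵥ ((W - Y) *ᵥ x)| = |∑ i, ∑ j, x i * ((W i j - Y i j) * x j)| := by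
            simp [dotProduct, mulVec, Finset.mul_sum]
        _ ≤ ∑ i, ∑ j, |x i * ((W i j - Y i j) * x j)| :=
            (Finset.abs_sum_le_sum_abs _ _).trans
              (Finset.sum_le_sum fun i _ => Finset.abs_sum_le_sum_abs _ _)
        _ ≤ ∑ i, ∑ j, δ * (|x i| * |x j|) := by
            refine Finset.sum_le_sum fun i _ => Finset.sum_le_sum fun j _ => ?_
            rw [abs_mul, abs_mul]
            have := mul_le_mul_of_nonneg_right (hWY i j)
              (mul_nonneg (abs_nonneg (x i)) (abs_nonneg (x j)))
            linarith
        _ = δ * (∑ i, |x i|) ^ 2 := by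
            rw [sq, Finset.sum_mul_sum, Finset.mul_sum]
            simp_rw [Finset.mul_sum]
        _ ≤ δ * (m * (x ⬝ᵥ x)) := by
            gcongr
            have := sq_sum_le_card_mul_sum_sq (s := Finset.univ) (f := fun i => |x i|)
            simpa [dotProduct, sq] using this
    have h2 : x ⬝ᵥ (W *ᵥ x) = x ⬝ᵥ (Y *ᵥ x) + x ⬝ᵥ ((W - Y) *ᵥ x) := by
      rw [sub_mulVec, dotProduct_sub]; ring
    have h3 : ε = δ * (m + 2) := by rw [hδ]; field_simp
    have h4 := hle x
    have h5 := neg_abs_le (x ⬝ᵥ ((W - Y) *ᵥ x))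
    simp only [star_trivial, sub_mulVec, dotProduct_sub, smul_mulVec, one_mulVec, dotProduct_smul,
      smul_eq_mul]
    rw [sub_pos, h2]
    rw [h3] at h4
    nlinarith

theorem posDef_of_sub_smul_one {W : Matrix (Fin m) (Fin m) ℝ} {δ : ℝ} (hδ : 0 ≤ δ)
    (h : (W - δ • (1 : Matrix (Fin m) (Fin m) ℝ)).PosDef) : W.PosDef := by
  have := h.add_posSemidef (Matrix.PosSemidef.one.smul hδ)
  simpa using this

theorem ofEntries_im (u : SymIndex m → ℂ) (i j : Fin m) :
    ((ofEntries u).map Complex.im) i j = (u ⟨(min i j, max i j), min_le_max⟩).im := rfl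

theorem map_im_isSymm {Z : Matrix (Fin m) (Fin m) ℂ} (hZ : Z.IsSymm) :
    (Z.map Complex.im).IsSymm := hZ.map _

theorem isOpen_coordDomain : IsOpen (coordDomain m) := by
  rw [Metric.isOpen_iff]
  intro u hu
  obtain ⟨δ, hδ, h⟩ := exists_pos_sub_posDef hu.2
  refine ⟨δ, hδ, fun v hv => ⟨ofEntries_isSymm v, ?_⟩⟩
  refine posDef_of_sub_smul_one hδ.le (h _ (map_im_isSymm (ofEntries_isSymm v)) fun i j => ?_)
  rw [ofEntries_im, ofEntries_im, ← Complex.sub_im]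
  refine (Complex.abs_im_le_norm _).trans ?_
  have := (dist_le_pi_dist v u ⟨(min i j, max i j), min_le_max⟩).trans (Metric.mem_ball.1 hv).le
  rwa [dist_eq_norm] at this

/-! ### Smooth functions on the Siegel upper half space -/

open Classical in
/-- A function on the Siegel upper half space, in the coordinates `Z_{ij}`, `i ≤ j`, and extended
by `0` to the other symmetric matrices. -/
def extend (f : upperHalfSpace m → ℂ) : (SymIndex m → ℂ) → ℂ :=
  fun u => if h : ofEntries u ∈ upperHalfSpace m then f ⟨ofEntries u, h⟩ else 0

theorem extend_of_mem (f : upperHalfSpace m → ℂ) {u : SymIndex m → ℂ} (hu : u ∈ coordDomain m) :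
    extend f u = f ⟨ofEntries u, hu⟩ := dif_pos hu

theorem extend_entries (f : upperHalfSpace m → ℂ) (z : upperHalfSpace m) :
    extend f (entries z.1) = f z := by
  rw [extend_of_mem f (entries_mem_coordDomain z.2)]
  congr 1
  exact Subtype.ext (ofEntries_entries z.2.1)

variable (m) in
/-- The algebra of smooth complex-valued functions on the Siegel upper half space. -/
def smoothAlg : Subalgebra ℂ (upperHalfSpace m → ℂ) where
  carrier := {f | ContDiffOn ℝ ∞ (extend f) (coordDomain m)}
  mul_mem' {f g} hf hg := by
    refine (ContDiffOn.mul hf hg).congr fun u hu => ?_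
    simp [extend_of_mem _ hu]
  add_mem' {f g} hf hg := by
    refine (ContDiffOn.add hf hg).congr fun u hu => ?_
    simp [extend_of_mem _ hu]
  algebraMap_mem' c := by
    refine (contDiffOn_const (c := c)).congr fun u hu => ?_
    simp [extend_of_mem _ hu]

theorem mem_smoothAlg {f : upperHalfSpace m → ℂ} {g : (SymIndex m → ℂ) → ℂ}
    (hg : ContDiffOn ℝ ∞ g (coordDomain m)) (h : ∀ u (hu : u ∈ coordDomain m), f ⟨_, hu⟩ = g u) :
    f ∈ smoothAlg m :=
  hg.congr fun u hu => by rw [extend_of_mem f hu, h u hu]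

/-- The Wirtinger derivative `(∂_V - i ∂_{iV}) / 2`, a complex linear function of the direction
`V`. -/
def wirtDeriv (g : (SymIndex m → ℂ) → ℂ) (V u : SymIndex m → ℂ) : ℂ :=
  (1 / 2) * (fderiv ℝ g u V - Complex.I * fderiv ℝ g u (Complex.I • V))

theorem wirtDeriv_congr {g h : (SymIndex m → ℂ) → ℂ} {u : SymIndex m → ℂ} (hgh : g =ᶠ[nhds u] h)
    (V : SymIndex m → ℂ) : wirtDeriv g V u = wirtDeriv h V u := by
  rw [wirtDeriv, wirtDeriv, hgh.fderiv_eq]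

theorem wirtDeriv_add_dir (g : (SymIndex m → ℂ) → ℂ) (V W u : SymIndex m → ℂ) :
    wirtDeriv g (V + W) u = wirtDeriv g V u + wirtDeriv g W u := by
  simp only [wirtDeriv, map_add, smul_add]; ring

theorem fderiv_complex_smul (g : (SymIndex m → ℂ) → ℂ) (u V : SymIndex m → ℂ) (c : ℂ) :
    fderiv ℝ g u (c • V) = c.re * fderiv ℝ g u V + c.im * fderiv ℝ g u (Complex.I • V) := by
  have : c • V = c.re • V + c.im • (Complex.I • V) := by
    conv_lhs => rw [← Complex.re_add_im c]
    rw [add_smul, mul_smul]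
    rfl
  rw [this, map_add, map_smul, map_smul]
  simp

theorem wirtDeriv_smul_dir (g : (SymIndex m → ℂ) → ℂ) (c : ℂ) (V u : SymIndex m → ℂ) :
    wirtDeriv g (c • V) u = c * wirtDeriv g V u := by
  have h1 := fderiv_complex_smul g u V c
  have h2 := fderiv_complex_smul g u (Complex.I • V) c
  have h3 := fderiv_complex_smul g u V (-1)
  have hI : Complex.I • Complex.I • V = (-1 : ℂ) • V := by rw [smul_smul, Complex.I_mul_I]
  rw [hI] at h2
  rw [wirtDeriv, wirtDeriv, smul_comm, h1, h2, h3]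
  simp only [Complex.neg_re, Complex.one_re, Complex.neg_im, Complex.one_im]
  nth_rewrite 5 [← Complex.re_add_im c]
  push_cast
  linear_combination ((1 / 2) * (c.im : ℂ) * fderiv ℝ g u (Complex.I • V)) * Complex.I_sq

theorem wirtDeriv_sum_dir {ι : Type*} (s : Finset ι) (g : (SymIndex m → ℂ) → ℂ)
    (V : ι → SymIndex m → ℂ) (u : SymIndex m → ℂ) :
    wirtDeriv g (∑ i ∈ s, V i) u = ∑ i ∈ s, wirtDeriv g (V i) u := by
  classical
  induction s using Finset.induction_on with
  | empty => simp [wirtDeriv]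
  | insert a s ha ih => rw [Finset.sum_insert ha, Finset.sum_insert ha, wirtDeriv_add_dir, ih]

theorem wirtDeriv_of_differentiableAt {g : (SymIndex m → ℂ) → ℂ} {u : SymIndex m → ℂ}
    (hg : DifferentiableAt ℂ g u) (V : SymIndex m → ℂ) : wirtDeriv g V u = fderiv ℂ g u V := by
  rw [wirtDeriv, hg.fderiv_restrictScalars ℝ]
  simp only [ContinuousLinearMap.coe_restrictScalars', map_smul, smul_eq_mul]
  linear_combination (- (1 / 2) * fderiv ℂ g u V) * Complex.I_sq

theorem wirtDeriv_conj {g : (SymIndex m → ℂ) → ℂ} {u : SymIndex m → ℂ}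
    (hg : DifferentiableAt ℂ g u) (V : SymIndex m → ℂ) :
    wirtDeriv (fun u => (starRingEnd ℂ) (g u)) V u = 0 := by
  have h : HasFDerivAt (fun u => (starRingEnd ℂ) (g u))
      ((Complex.conjCLE : ℂ →L[ℝ] ℂ).comp ((fderiv ℂ g u).restrictScalars ℝ)) u :=
    (Complex.conjCLE : ℂ →L[ℝ] ℂ).hasFDerivAt.comp u (hg.hasFDerivAt.restrictScalars ℝ)
  rw [wirtDeriv, h.fderiv]
  simp only [ContinuousLinearMap.comp_apply, ContinuousLinearMap.coe_restrictScalars', map_smul,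
    smul_eq_mul, ContinuousLinearEquiv.coe_coe, Complex.conjCLE_apply, map_mul, Complex.conj_I]
  linear_combination ((1 / 2) * (starRingEnd ℂ) (fderiv ℂ g u V)) * Complex.I_sq

theorem contDiffOn_extend (f : smoothAlg m) : ContDiffOn ℝ ∞ (extend f.1) (coordDomain m) := f.2

theorem contDiffAt_extend (f : smoothAlg m) {u : SymIndex m → ℂ} (hu : u ∈ coordDomain m) :
    ContDiffAt ℝ ∞ (extend f.1) u :=
  (contDiffOn_extend f).contDiffAt (isOpen_coordDomain.mem_nhds hu)

theorem differentiableAt_extend (f : smoothAlg m) {u : SymIndex m → ℂ} (hu : u ∈ coordDomain m) :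
    DifferentiableAt ℝ (extend f.1) u :=
  (contDiffAt_extend f hu).differentiableAt (by simp)

theorem contDiffOn_fderiv_apply (f : smoothAlg m) (V : SymIndex m → ℂ) :
    ContDiffOn ℝ ∞ (fun u => fderiv ℝ (extend f.1) u V) (coordDomain m) :=
  ((contDiffOn_extend f).fderiv_of_isOpen isOpen_coordDomain (m := ∞) (by simp)).clm_apply
    contDiffOn_const

theorem contDiffOn_wirtDeriv (f : smoothAlg m) (V : SymIndex m → ℂ) :
    ContDiffOn ℝ ∞ (wirtDeriv (extend f.1) V) (coordDomain m) :=
  contDiffOn_const.mul ((contDiffOn_fderiv_apply f V).sub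
    (contDiffOn_const.mul (contDiffOn_fderiv_apply f _)))

theorem extend_eventuallyEq {f : upperHalfSpace m → ℂ} {g : (SymIndex m → ℂ) → ℂ}
    (h : ∀ u (hu : u ∈ coordDomain m), f ⟨_, hu⟩ = g u) {u : SymIndex m → ℂ}
    (hu : u ∈ coordDomain m) : extend f =ᶠ[nhds u] g := by
  filter_upwards [isOpen_coordDomain.mem_nhds hu] with v hv
  rw [extend_of_mem f hv, h v hv]

/-- The Wirtinger derivative in a direction `V`, as a derivation of the algebra of smooth
functions. -/
def derivDir (V : SymIndex m → ℂ) : Derivation ℂ (smoothAlg m) (smoothAlg m) where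
  toFun f := ⟨fun z => wirtDeriv (extend f.1) V (entries z.1),
    mem_smoothAlg (contDiffOn_wirtDeriv f V) fun u hu => by simp only [entries_ofEntries]⟩
  map_add' f g := by
    refine Subtype.ext (funext fun z => ?_)
    have hz := entries_mem_coordDomain z.2
    have h : extend (f + g).1 =ᶠ[nhds (entries z.1)] extend f.1 + extend g.1 :=
      extend_eventuallyEq (fun u hu => by simp [extend_of_mem _ hu]) hz
    simp only [Subalgebra.coe_add, Pi.add_apply]
    rw [← Subalgebra.coe_add, wirtDeriv_congr h, wirtDeriv,
      fderiv_add (differentiableAt_extend f hz) (differentiableAt_extend g hz)]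
    simp only [wirtDeriv, _root_.add_apply]
    ring
  map_smul' c f := by
    refine Subtype.ext (funext fun z => ?_)
    have hz := entries_mem_coordDomain z.2
    have h : extend (c • f).1 =ᶠ[nhds (entries z.1)] c • extend f.1 :=
      extend_eventuallyEq (fun u hu => by simp [extend_of_mem _ hu]) hz
    simp only [RingHom.id_apply, SetLike.val_smul, Pi.smul_apply, smul_eq_mul]
    rw [← SetLike.val_smul, wirtDeriv_congr h, wirtDeriv, fderiv_const_smul
      (differentiableAt_extend f hz)]
    simp only [wirtDeriv, _root_.smul_apply, smul_eq_mul]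
    ring
  map_one_eq_zero' := by
    refine Subtype.ext (funext fun z => ?_)
    have hz := entries_mem_coordDomain z.2
    have h : extend (1 : smoothAlg m).1 =ᶠ[nhds (entries z.1)] fun _ => 1 :=
      extend_eventuallyEq (fun u hu => by simp) hz
    change wirtDeriv (extend (1 : smoothAlg m).1) V (entries z.1) = 0
    rw [wirtDeriv_congr h, wirtDeriv]
    simp
  leibniz' f g := by
    refine Subtype.ext (funext fun z => ?_)
    have hz := entries_mem_coordDomain z.2
    have h : extend (f * g).1 =ᶠ[nhds (entries z.1)] extend f.1 * extend g.1 :=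
      extend_eventuallyEq (fun u hu => by simp [extend_of_mem _ hu]) hz
    change wirtDeriv (extend (f * g).1) V (entries z.1) = f.1 z * wirtDeriv (extend g.1) V _ +
      g.1 z * wirtDeriv (extend f.1) V _
    rw [wirtDeriv_congr h, wirtDeriv,
      fderiv_mul (differentiableAt_extend f hz) (differentiableAt_extend g hz)]
    simp only [wirtDeriv, _root_.add_apply, _root_.smul_apply,
      extend_entries, smul_eq_mul]
    ring

theorem derivDir_apply (V : SymIndex m → ℂ) (f : smoothAlg m) (z : upperHalfSpace m) :
    (derivDir V f).1 z = wirtDeriv (extend f.1) V (entries z.1) := rfl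

theorem derivDir_apply_of_eq {V : SymIndex m → ℂ} {f : smoothAlg m} {g : (SymIndex m → ℂ) → ℂ}
    (h : ∀ u (hu : u ∈ coordDomain m), f.1 ⟨_, hu⟩ = g u) (z : upperHalfSpace m) :
    (derivDir V f).1 z = wirtDeriv g V (entries z.1) := by
  rw [derivDir_apply]
  exact wirtDeriv_congr (extend_eventuallyEq h (entries_mem_coordDomain z.2)) V

theorem fderiv_fderiv_apply (f : smoothAlg m) {u : SymIndex m → ℂ} (hu : u ∈ coordDomain m)
    (V W : SymIndex m → ℂ) :
    fderiv ℝ (fun v => fderiv ℝ (extend f.1) v V) u W =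
      fderiv ℝ (fderiv ℝ (extend f.1)) u W V := by
  have h : DifferentiableAt ℝ (fderiv ℝ (extend f.1)) u :=
    (((contDiffOn_extend f).fderiv_of_isOpen isOpen_coordDomain (m := ∞) (by simp)).contDiffAt
      (isOpen_coordDomain.mem_nhds hu)).differentiableAt (by simp)
  rw [fderiv_clm_apply h (differentiableAt_const V)]
  simp

theorem derivDir_comm (V W : SymIndex m → ℂ) (f : smoothAlg m) :
    derivDir V (derivDir W f) = derivDir W (derivDir V f) := by
  refine Subtype.ext (funext fun z => ?_)
  have hz := entries_mem_coordDomain z.2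
  have key : ∀ V W : SymIndex m → ℂ, (derivDir V (derivDir W f)).1 z = (1 / 4) *
      ((fderiv ℝ (fderiv ℝ (extend f.1)) (entries z.1) V W -
        Complex.I * fderiv ℝ (fderiv ℝ (extend f.1)) (entries z.1) V (Complex.I • W)) -
      Complex.I * (fderiv ℝ (fderiv ℝ (extend f.1)) (entries z.1) (Complex.I • V) W -
        Complex.I * fderiv ℝ (fderiv ℝ (extend f.1)) (entries z.1) (Complex.I • V)
          (Complex.I • W))) := by
    intro V W
    rw [derivDir_apply_of_eq (g := wirtDeriv (extend f.1) W) fun u hu => by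
      rw [derivDir_apply, entries_ofEntries]]
    have hd : ∀ X, DifferentiableAt ℝ (fun v => fderiv ℝ (extend f.1) v X) (entries z.1) :=
      fun X => ((contDiffOn_fderiv_apply f X).contDiffAt
        (isOpen_coordDomain.mem_nhds hz)).differentiableAt (by simp)
    have h1 : fderiv ℝ (wirtDeriv (extend f.1) W) (entries z.1) =
        (1 / 2 : ℂ) • (fderiv ℝ (fun v => fderiv ℝ (extend f.1) v W) (entries z.1) -
          Complex.I • fderiv ℝ (fun v => fderiv ℝ (extend f.1) v (Complex.I • W))
            (entries z.1)) := by
      have h2 := ((hd W).hasFDerivAt.sub ((hd (Complex.I • W)).hasFDerivAt.const_smul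
        Complex.I)).const_smul (1 / 2 : ℂ)
      exact h2.fderiv
    rw [wirtDeriv, h1]
    simp only [_root_.smul_apply, _root_.sub_apply, smul_eq_mul,
      fderiv_fderiv_apply f hz]
    ring
  have hs : IsSymmSndFDerivAt ℝ (extend f.1) (entries z.1) :=
    (contDiffAt_extend f hz).isSymmSndFDerivAt (by simpa using WithTop.coe_le_coe.2 (le_top : (2 : ℕ∞) ≤ ⊤))
  rw [key, key, hs.eq V W, hs.eq V (Complex.I • W), hs.eq (Complex.I • V) W,
    hs.eq (Complex.I • V) (Complex.I • W)]
  ring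

end

section

open scoped ComplexOrder

/-! ### The action of the real symplectic group on the Siegel upper half space -/

theorem ofReal_dotProduct_mulVec (Y : Matrix (Fin m) (Fin m) ℝ) (x y : Fin m → ℝ) :
    (fun i => (x i : ℂ)) ⬝ᵥ (Y.map Complex.ofReal *ᵥ fun i => (y i : ℂ)) =
      ((x ⬝ᵥ (Y *ᵥ y) : ℝ) : ℂ) := by
  simp [dotProduct, mulVec]

theorem posDef_map_ofReal {Y : Matrix (Fin m) (Fin m) ℝ} (hY : Y.PosDef) :
    (Y.map Complex.ofReal).PosDef := by
  refine Matrix.PosDef.of_dotProduct_mulVec_pos ?_ fun v hv => ?_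
  · have := isSymm_of_posDef hY
    ext i j
    simp [this.apply i j]
  · set a : Fin m → ℝ := fun i => (v i).re
    set b : Fin m → ℝ := fun i => (v i).im
    have hv1 : v = (fun i => (a i : ℂ)) + Complex.I • fun i => (b i : ℂ) := by
      funext i
      simp [a, b, mul_comm Complex.I, Complex.re_add_im]
    have hv2 : star v = (fun i => (a i : ℂ)) - Complex.I • fun i => (b i : ℂ) := by
      funext i
      apply Complex.ext <;> simp [a, b]
    have hab : b ⬝ᵥ (Y *ᵥ a) = a ⬝ᵥ (Y *ᵥ b) := by
      have := isSymm_of_posDef hY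
      rw [Matrix.dotProduct_mulVec, ← Matrix.mulVec_transpose, this.eq, dotProduct_comm]
    have key : star v ⬝ᵥ (Y.map Complex.ofReal *ᵥ v) =
        ((a ⬝ᵥ (Y *ᵥ a) + b ⬝ᵥ (Y *ᵥ b) : ℝ) : ℂ) := by
      rw [hv2]
      rw [show Y.map Complex.ofReal *ᵥ v = Y.map Complex.ofReal *ᵥ _ from congrArg _ hv1]
      simp only [mulVec_add, mulVec_smul, dotProduct_add, sub_dotProduct, smul_dotProduct,
        dotProduct_smul, ofReal_dotProduct_mulVec, smul_eq_mul, hab]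
      push_cast
      linear_combination (- ((b ⬝ᵥ (Y *ᵥ b) : ℝ) : ℂ)) * Complex.I_sq
    rw [key]
    have h0 : ∀ x : Fin m → ℝ, 0 ≤ x ⬝ᵥ (Y *ᵥ x) := fun x => by
      simpa using hY.posSemidef.dotProduct_mulVec_nonneg x
    have h1 : ∀ x : Fin m → ℝ, x ≠ 0 → 0 < x ⬝ᵥ (Y *ᵥ x) := fun x hx => by
      simpa using hY.dotProduct_mulVec_pos hx
    have : 0 < a ⬝ᵥ (Y *ᵥ a) + b ⬝ᵥ (Y *ᵥ b) := by
      by_cases ha : a = 0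
      · have hb : b ≠ 0 := by
          rintro hb
          apply hv
          rw [hv1, ha, hb]
          ext i
          simp
        exact add_pos_of_nonneg_of_pos (h0 a) (h1 b hb)
      · exact add_pos_of_pos_of_nonneg (h1 a ha) (h0 b)
    exact_mod_cast this

theorem posDef_of_map_ofReal {Y : Matrix (Fin m) (Fin m) ℝ}
    (hY : (Y.map Complex.ofReal).PosDef) : Y.PosDef := by
  refine Matrix.PosDef.of_dotProduct_mulVec_pos ?_ fun x hx => ?_
  · apply isHermitian_of_isSymm
    ext i j
    have := congr_fun (congr_fun hY.isHermitian i) j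
    simp only [conjTranspose_apply, map_apply, RCLike.star_def, Complex.conj_ofReal] at this
    exact_mod_cast this
  · have h1 : (fun i => (x i : ℂ)) ≠ 0 := by
      contrapose! hx
      ext i
      have := congr_fun hx i
      simpa using this
    have := hY.dotProduct_mulVec_pos h1
    have hs : star (fun i => (x i : ℂ)) = fun i => (x i : ℂ) := by
      ext i
      simp
    rw [hs, ofReal_dotProduct_mulVec] at this
    simpa using mod_cast this

/-- `Z - Z̄` is `2i` times the imaginary part, as a complex matrix. -/
theorem sub_conj_eq (Z : Matrix (Fin m) (Fin m) ℂ) :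
    Z - Z.map (starRingEnd ℂ) = (2 * Complex.I) • (Z.map Complex.im).map Complex.ofReal := by
  ext i j
  apply Complex.ext
  · simp
  · simp; ring

/-- For a real matrix `g = (A B; C D)`, the matrix `A Z + B`. -/
def numR (g : Matrix (Fin m ⊕ Fin m) (Fin m ⊕ Fin m) ℝ) (Z : Matrix (Fin m) (Fin m) ℂ) :
    Matrix (Fin m) (Fin m) ℂ :=
  g.toBlocks₁₁.map Complex.ofReal * Z + g.toBlocks₁₂.map Complex.ofReal

/-- For a real matrix `g = (A B; C D)`, the matrix `C Z + D`. -/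
def denomR (g : Matrix (Fin m ⊕ Fin m) (Fin m ⊕ Fin m) ℝ) (Z : Matrix (Fin m) (Fin m) ℂ) :
    Matrix (Fin m) (Fin m) ℂ :=
  g.toBlocks₂₁.map Complex.ofReal * Z + g.toBlocks₂₂.map Complex.ofReal

theorem map_ofReal_mul (A B : Matrix (Fin m) (Fin m) ℝ) :
    (A * B).map Complex.ofReal = A.map Complex.ofReal * B.map Complex.ofReal :=
  Matrix.map_mul (f := Complex.ofRealHom)

theorem map_ofReal_add (A B : Matrix (Fin m) (Fin m) ℝ) :
    (A + B).map Complex.ofReal = A.map Complex.ofReal + B.map Complex.ofReal := by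
  ext i j; simp

theorem map_ofReal_one :
    (1 : Matrix (Fin m) (Fin m) ℝ).map Complex.ofReal = 1 :=
  Matrix.map_one Complex.ofRealHom (map_zero _) (map_one _)

theorem blocks_rel {g : Matrix (Fin m ⊕ Fin m) (Fin m ⊕ Fin m) ℝ}
    (hg : g ∈ symplecticGroup (Fin m) ℝ) :
    g.toBlocks₁₁ᵀ * g.toBlocks₂₁ = g.toBlocks₂₁ᵀ * g.toBlocks₁₁ ∧
      g.toBlocks₁₂ᵀ * g.toBlocks₂₂ = g.toBlocks₂₂ᵀ * g.toBlocks₁₂ ∧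
      g.toBlocks₁₁ᵀ * g.toBlocks₂₂ - g.toBlocks₂₁ᵀ * g.toBlocks₁₂ = 1 := by
  rw [← SymplecticGroup.fromBlocks_mem_iff, fromBlocks_toBlocks]
  exact hg

/-- The polarized form of the symplectic relations. -/
theorem num_transpose_mul_denom_sub {g : Matrix (Fin m ⊕ Fin m) (Fin m ⊕ Fin m) ℝ}
    (hg : g ∈ symplecticGroup (Fin m) ℝ) {W : Matrix (Fin m) (Fin m) ℂ} (hW : W.IsSymm)
    (Z : Matrix (Fin m) (Fin m) ℂ) :
    (numR g W)ᵀ * denomR g Z - (denomR g W)ᵀ * numR g Z = W - Z := by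
  obtain ⟨h1, h2, h3⟩ := blocks_rel hg
  have h1' := congrArg (fun M => M.map Complex.ofReal) h1
  have h2' := congrArg (fun M => M.map Complex.ofReal) h2
  have h3' := congrArg (fun M => M.map Complex.ofReal) (sub_eq_iff_eq_add.1 h3)
  have h4' := congrArg (fun M => Mᵀ) h3'
  simp only [map_ofReal_mul, map_ofReal_add, map_ofReal_one, transpose_map, transpose_mul,
    transpose_add, transpose_one, transpose_transpose] at h1' h2' h3' h4'
  simp only [numR, denomR, transpose_add, transpose_mul, hW.eq]
  set A := g.toBlocks₁₁.map Complex.ofReal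
  set B := g.toBlocks₁₂.map Complex.ofReal
  set C := g.toBlocks₂₁.map Complex.ofReal
  set D := g.toBlocks₂₂.map Complex.ofReal
  have e1 : (W * Aᵀ + Bᵀ) * (C * Z + D) = W * (Aᵀ * C) * Z + W * (Aᵀ * D) + Bᵀ * C * Z +
      Bᵀ * D := by noncomm_ring
  have e2 : (W * Cᵀ + Dᵀ) * (A * Z + B) = W * (Cᵀ * A) * Z + W * (Cᵀ * B) + Dᵀ * A * Z +
      Dᵀ * B := by noncomm_ring
  rw [e1, e2, h1', h2', h3', h4']
  noncomm_ring

theorem map_conj_mul (A B : Matrix (Fin m) (Fin m) ℂ) :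
    (A * B).map (starRingEnd ℂ) = A.map (starRingEnd ℂ) * B.map (starRingEnd ℂ) :=
  Matrix.map_mul (f := starRingEnd ℂ)

theorem map_ofReal_conj (A : Matrix (Fin m) (Fin m) ℝ) :
    (A.map Complex.ofReal).map (starRingEnd ℂ) = A.map Complex.ofReal := by
  ext i j; simp

theorem numR_conj (g : Matrix (Fin m ⊕ Fin m) (Fin m ⊕ Fin m) ℝ) (Z : Matrix (Fin m) (Fin m) ℂ) :
    numR g (Z.map (starRingEnd ℂ)) = (numR g Z).map (starRingEnd ℂ) := by
  rw [numR, numR, Matrix.map_add _ (map_add _), map_conj_mul, map_ofReal_conj,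
    map_ofReal_conj]

theorem denomR_conj (g : Matrix (Fin m ⊕ Fin m) (Fin m ⊕ Fin m) ℝ)
    (Z : Matrix (Fin m) (Fin m) ℂ) :
    denomR g (Z.map (starRingEnd ℂ)) = (denomR g Z).map (starRingEnd ℂ) := by
  rw [denomR, denomR, Matrix.map_add _ (map_add _), map_conj_mul, map_ofReal_conj,
    map_ofReal_conj]

theorem conj_isSymm {Z : Matrix (Fin m) (Fin m) ℂ} (hZ : Z.IsSymm) :
    (Z.map (starRingEnd ℂ)).IsSymm := hZ.map _

theorem isUnit_det_denomR {g : Matrix (Fin m ⊕ Fin m) (Fin m ⊕ Fin m) ℝ}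
    (hg : g ∈ symplecticGroup (Fin m) ℝ) {Z : Matrix (Fin m) (Fin m) ℂ}
    (hZ : Z ∈ upperHalfSpace m) : IsUnit (denomR g Z).det := by
  rw [isUnit_iff_ne_zero]
  intro hdet
  obtain ⟨v, hv, hv0⟩ := Matrix.exists_mulVec_eq_zero_iff.2 hdet
  have h := num_transpose_mul_denom_sub hg (conj_isSymm hZ.1) Z
  rw [denomR_conj, ← neg_sub Z, sub_conj_eq] at h
  have h1 := congrArg (fun M => star v ⬝ᵥ (M *ᵥ v)) h
  have h2 : star v ᵥ* ((denomR g Z).map (starRingEnd ℂ))ᵀ = 0 := by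
    have : ((denomR g Z).map (starRingEnd ℂ))ᵀ = (denomR g Z)ᴴ := rfl
    rw [this, ← Matrix.star_mulVec, hv0, star_zero]
  simp only [sub_mulVec, ← mulVec_mulVec, hv0, mulVec_zero, zero_sub, neg_mulVec, dotProduct_neg,
    smul_mulVec, dotProduct_smul, neg_inj] at h1
  rw [dotProduct_mulVec, h2, zero_dotProduct] at h1
  have h3 := (posDef_map_ofReal hZ.2).dotProduct_mulVec_pos hv
  simp at h1
  exact h3.ne' h1

/-- The fractional linear action `(A Z + B) (C Z + D)⁻¹`. -/
def moebius (g : Matrix (Fin m ⊕ Fin m) (Fin m ⊕ Fin m) ℝ) (Z : Matrix (Fin m) (Fin m) ℂ) :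
    Matrix (Fin m) (Fin m) ℂ :=
  numR g Z * (denomR g Z)⁻¹

theorem moebius_mul_denomR {g : Matrix (Fin m ⊕ Fin m) (Fin m ⊕ Fin m) ℝ}
    (hg : g ∈ symplecticGroup (Fin m) ℝ) {Z : Matrix (Fin m) (Fin m) ℂ}
    (hZ : Z ∈ upperHalfSpace m) : moebius g Z * denomR g Z = numR g Z :=
  Matrix.nonsing_inv_mul_cancel_right _ _ (isUnit_det_denomR hg hZ)

theorem moebius_isSymm {g : Matrix (Fin m ⊕ Fin m) (Fin m ⊕ Fin m) ℝ}
    (hg : g ∈ symplecticGroup (Fin m) ℝ) {Z : Matrix (Fin m) (Fin m) ℂ}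
    (hZ : Z ∈ upperHalfSpace m) : (moebius g Z).IsSymm := by
  have hu := isUnit_det_denomR hg hZ
  have hu' : IsUnit (denomR g Z)ᵀ.det := by rwa [det_transpose]
  have h := num_transpose_mul_denom_sub hg hZ.1 Z
  rw [sub_self, sub_eq_zero] at h
  rw [Matrix.IsSymm, moebius, transpose_mul, transpose_nonsing_inv]
  calc _ = (denomR g Z)ᵀ⁻¹ * ((numR g Z)ᵀ * denomR g Z) * (denomR g Z)⁻¹ := by
        rw [mul_assoc, Matrix.mul_nonsing_inv_cancel_right _ _ hu]
    _ = _ := by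
        rw [h, ← mul_assoc, Matrix.nonsing_inv_mul _ hu', one_mul]

/-- `Im Z = (C Z + D)ᴴ Im(γ Z) (C Z + D)`, up to the factor `2 i`. -/
theorem denomR_conjTranspose_mul {g : Matrix (Fin m ⊕ Fin m) (Fin m ⊕ Fin m) ℝ}
    (hg : g ∈ symplecticGroup (Fin m) ℝ) {Z : Matrix (Fin m) (Fin m) ℂ}
    (hZ : Z ∈ upperHalfSpace m) :
    (denomR g Z)ᴴ * (moebius g Z - (moebius g Z).map (starRingEnd ℂ)) * denomR g Z =
      Z - Z.map (starRingEnd ℂ) := by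
  have h := num_transpose_mul_denom_sub hg (conj_isSymm hZ.1) Z
  rw [denomR_conj, numR_conj, ← moebius_mul_denomR hg hZ, map_conj_mul, transpose_mul,
    ((conj_isSymm (moebius_isSymm hg hZ)).eq)] at h
  have h1 : ((denomR g Z).map (starRingEnd ℂ))ᵀ = (denomR g Z)ᴴ := rfl
  rw [h1] at h
  rw [← neg_sub (Z.map _), ← h]
  noncomm_ring

theorem moebius_mem {g : Matrix (Fin m ⊕ Fin m) (Fin m ⊕ Fin m) ℝ}
    (hg : g ∈ symplecticGroup (Fin m) ℝ) {Z : Matrix (Fin m) (Fin m) ℂ}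
    (hZ : Z ∈ upperHalfSpace m) : moebius g Z ∈ upperHalfSpace m := by
  refine ⟨moebius_isSymm hg hZ, posDef_of_map_ofReal ?_⟩
  have hu := isUnit_det_denomR hg hZ
  have h := denomR_conjTranspose_mul hg hZ
  rw [sub_conj_eq, sub_conj_eq, Matrix.mul_smul, Matrix.smul_mul] at h
  have h2 := smul_right_injective _ (show 2 * Complex.I ≠ 0 by simp) h
  have h3 := (Matrix.IsUnit.posDef_star_left_conjugate_iff ((Matrix.isUnit_iff_isUnit_det _).2 hu)
    (x := ((moebius g Z).map Complex.im).map Complex.ofReal)).1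
  apply h3
  rw [star_eq_conjTranspose, h2]
  exact posDef_map_ofReal hZ.2

theorem detSubConj_moebius {g : Matrix (Fin m ⊕ Fin m) (Fin m ⊕ Fin m) ℝ}
    (hg : g ∈ symplecticGroup (Fin m) ℝ) {Z : Matrix (Fin m) (Fin m) ℂ}
    (hZ : Z ∈ upperHalfSpace m) :
    detSubConj Z = ((Complex.normSq (denomR g Z).det : ℝ) : ℂ) * detSubConj (moebius g Z) := by
  rw [detSubConj, ← denomR_conjTranspose_mul hg hZ, det_mul, det_mul, det_conjTranspose,
    ← Complex.mul_conj, detSubConj]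
  simp only [RCLike.star_def]
  ring

theorem toBlocks_mul (g h : Matrix (Fin m ⊕ Fin m) (Fin m ⊕ Fin m) ℝ) :
    (g * h).toBlocks₁₁ = g.toBlocks₁₁ * h.toBlocks₁₁ + g.toBlocks₁₂ * h.toBlocks₂₁ ∧
    (g * h).toBlocks₁₂ = g.toBlocks₁₁ * h.toBlocks₁₂ + g.toBlocks₁₂ * h.toBlocks₂₂ ∧
    (g * h).toBlocks₂₁ = g.toBlocks₂₁ * h.toBlocks₁₁ + g.toBlocks₂₂ * h.toBlocks₂₁ ∧
    (g * h).toBlocks₂₂ = g.toBlocks₂₁ * h.toBlocks₁₂ + g.toBlocks₂₂ * h.toBlocks₂₂ := by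
  have : g * h = fromBlocks g.toBlocks₁₁ g.toBlocks₁₂ g.toBlocks₂₁ g.toBlocks₂₂ *
      fromBlocks h.toBlocks₁₁ h.toBlocks₁₂ h.toBlocks₂₁ h.toBlocks₂₂ := by
    rw [fromBlocks_toBlocks, fromBlocks_toBlocks]
  rw [this, fromBlocks_multiply]
  exact ⟨toBlocks_fromBlocks₁₁ .., toBlocks_fromBlocks₁₂ .., toBlocks_fromBlocks₂₁ ..,
    toBlocks_fromBlocks₂₂ ..⟩

theorem denomR_mul (g : Matrix (Fin m ⊕ Fin m) (Fin m ⊕ Fin m) ℝ)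
    {h : Matrix (Fin m ⊕ Fin m) (Fin m ⊕ Fin m) ℝ} (hh : h ∈ symplecticGroup (Fin m) ℝ)
    {Z : Matrix (Fin m) (Fin m) ℂ} (hZ : Z ∈ upperHalfSpace m) :
    denomR (g * h) Z = denomR g (moebius h Z) * denomR h Z := by
  obtain ⟨-, -, h3, h4⟩ := toBlocks_mul g h
  rw [denomR, denomR.eq_1 g, add_mul, mul_assoc, moebius_mul_denomR hh hZ, h3, h4, numR, denomR]
  simp only [map_ofReal_mul, map_ofReal_add]
  noncomm_ring

theorem numR_mul (g : Matrix (Fin m ⊕ Fin m) (Fin m ⊕ Fin m) ℝ)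
    {h : Matrix (Fin m ⊕ Fin m) (Fin m ⊕ Fin m) ℝ} (hh : h ∈ symplecticGroup (Fin m) ℝ)
    {Z : Matrix (Fin m) (Fin m) ℂ} (hZ : Z ∈ upperHalfSpace m) :
    numR (g * h) Z = numR g (moebius h Z) * denomR h Z := by
  obtain ⟨h1, h2, -, -⟩ := toBlocks_mul g h
  rw [numR, numR.eq_1 g, add_mul, mul_assoc, moebius_mul_denomR hh hZ, h1, h2, numR, denomR]
  simp only [map_ofReal_mul, map_ofReal_add]
  noncomm_ring

theorem moebius_mul {g h : Matrix (Fin m ⊕ Fin m) (Fin m ⊕ Fin m) ℝ}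
    (hh : h ∈ symplecticGroup (Fin m) ℝ)
    {Z : Matrix (Fin m) (Fin m) ℂ} (hZ : Z ∈ upperHalfSpace m) :
    moebius (g * h) Z = moebius g (moebius h Z) := by
  rw [moebius, numR_mul g hh hZ, denomR_mul g hh hZ, Matrix.mul_inv_rev, ← mul_assoc,
    Matrix.mul_nonsing_inv_cancel_right _ _ (isUnit_det_denomR hh hZ), moebius.eq_1 g]

/-- An integral symplectic matrix, as a real one. -/
def toReal (γ : symplecticGroup (Fin m) ℤ) : Matrix (Fin m ⊕ Fin m) (Fin m ⊕ Fin m) ℝ :=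
  γ.1.map (Int.castRingHom ℝ)

theorem toReal_mem (γ : symplecticGroup (Fin m) ℤ) : toReal γ ∈ symplecticGroup (Fin m) ℝ :=
  SymplecticGroup.map_mem γ.2 (Int.castRingHom ℝ)

theorem denomR_toReal (γ : symplecticGroup (Fin m) ℤ) : denomR (toReal γ) = denom γ := by
  funext Z
  ext i j
  simp [denom, denomR, toReal, toBlocks₂₁, toBlocks₂₂, Matrix.mul_apply]

theorem numR_toReal (γ : symplecticGroup (Fin m) ℤ) : numR (toReal γ) = num γ := by
  funext Z
  ext i j
  simp [num, numR, toReal, toBlocks₁₁, toBlocks₁₂, Matrix.mul_apply]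

end

section

/-! ### Pullback of smooth functions along symplectic matrices -/

theorem det_mem_subalgebra {R S : Type*} [CommRing R] [CommRing S] [Algebra R S]
    (A : Subalgebra R S) {M : Matrix (Fin m) (Fin m) S} (hM : ∀ i j, M i j ∈ A) : M.det ∈ A := by
  rw [det_apply]
  exact sum_mem fun σ _ => by
    rcases Int.units_eq_one_or (Equiv.Perm.sign σ) with h | h <;> rw [h]
    · simpa using prod_mem fun i _ => hM _ _
    · simpa using prod_mem fun i _ => hM _ _

theorem adjugate_mem_subalgebra {R S : Type*} [CommRing R] [CommRing S] [Algebra R S]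
    (A : Subalgebra R S) {M : Matrix (Fin m) (Fin m) S} (hM : ∀ i j, M i j ∈ A) (i j : Fin m) :
    M.adjugate i j ∈ A := by
  rw [adjugate_apply]
  refine det_mem_subalgebra A fun k l => ?_
  rw [updateRow_apply]
  split_ifs
  · rw [Pi.single_apply]
    split_ifs
    exacts [one_mem _, zero_mem _]
  · exact hM k l

variable (m) in
/-- The algebra of functions that are holomorphic (infinitely differentiable over `ℂ`) on the Siegel
upper half space, in coordinates. -/
def holAlg : Subalgebra ℂ ((SymIndex m → ℂ) → ℂ) where
  carrier := {f | ContDiffOn ℂ ∞ f (coordDomain m)}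
  mul_mem' hf hg := ContDiffOn.mul hf hg
  add_mem' hf hg := ContDiffOn.add hf hg
  algebraMap_mem' _ := contDiffOn_const

theorem holAlg_inv {f : (SymIndex m → ℂ) → ℂ} (hf : f ∈ holAlg m)
    (h0 : ∀ u ∈ coordDomain m, f u ≠ 0) : (fun u => (f u)⁻¹) ∈ holAlg m :=
  ContDiffOn.inv (show ContDiffOn ℂ ∞ f (coordDomain m) from hf) h0

theorem differentiableAt_of_holAlg {f : (SymIndex m → ℂ) → ℂ} (hf : f ∈ holAlg m)
    {u : SymIndex m → ℂ} (hu : u ∈ coordDomain m) : DifferentiableAt ℂ f u :=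
  (ContDiffOn.contDiffAt hf (isOpen_coordDomain.mem_nhds hu)).differentiableAt (by simp)

theorem entry_mem_holAlg (i j : Fin m) : (fun u => ofEntries u i j) ∈ holAlg m := by
  change ContDiffOn ℂ ∞ _ _
  exact (contDiff_apply ℂ ℂ _).contDiffOn

theorem const_mem_holAlg (c : ℂ) : (fun _ => c) ∈ holAlg m := (holAlg m).algebraMap_mem c

theorem sum_mem_holAlg {ι : Type*} (s : Finset ι) {f : ι → (SymIndex m → ℂ) → ℂ}
    (hf : ∀ i ∈ s, f i ∈ holAlg m) : (fun u => ∑ i ∈ s, f i u) ∈ holAlg m := by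
  have := sum_mem hf
  convert this using 1
  ext u; simp

theorem mul_entry_mem_holAlg {A B : (SymIndex m → ℂ) → Matrix (Fin m) (Fin m) ℂ}
    (hA : ∀ i j, (fun u => A u i j) ∈ holAlg m) (hB : ∀ i j, (fun u => B u i j) ∈ holAlg m)
    (i j : Fin m) : (fun u => (A u * B u) i j) ∈ holAlg m := by
  simp only [Matrix.mul_apply]
  exact sum_mem_holAlg _ fun k _ => mul_mem (hA i k) (hB k j)

theorem denomR_entry_mem_holAlg (g : Matrix (Fin m ⊕ Fin m) (Fin m ⊕ Fin m) ℝ) (i j : Fin m) :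
    (fun u => denomR g (ofEntries u) i j) ∈ holAlg m := by
  have h := mul_entry_mem_holAlg (A := fun _ => g.toBlocks₂₁.map Complex.ofReal)
    (B := ofEntries) (fun _ _ => const_mem_holAlg _) entry_mem_holAlg i j
  exact (holAlg m).add_mem h (const_mem_holAlg (g.toBlocks₂₂.map Complex.ofReal i j))

theorem numR_entry_mem_holAlg (g : Matrix (Fin m ⊕ Fin m) (Fin m ⊕ Fin m) ℝ) (i j : Fin m) :
    (fun u => numR g (ofEntries u) i j) ∈ holAlg m := by
  have h := mul_entry_mem_holAlg (A := fun _ => g.toBlocks₁₁.map Complex.ofReal)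
    (B := ofEntries) (fun _ _ => const_mem_holAlg _) entry_mem_holAlg i j
  exact (holAlg m).add_mem h (const_mem_holAlg (g.toBlocks₁₂.map Complex.ofReal i j))

theorem det_mem_holAlg {A : (SymIndex m → ℂ) → Matrix (Fin m) (Fin m) ℂ}
    (hA : ∀ i j, (fun u => A u i j) ∈ holAlg m) : (fun u => (A u).det) ∈ holAlg m := by
  have h := det_mem_subalgebra (holAlg m) (M := Matrix.of fun i j u => A u i j) hA
  convert h using 1
  ext u
  exact (RingHom.map_det (Pi.evalRingHom (fun _ : SymIndex m → ℂ => ℂ) u)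
    (Matrix.of fun i j u => A u i j)).symm

theorem adjugate_mem_holAlg {A : (SymIndex m → ℂ) → Matrix (Fin m) (Fin m) ℂ}
    (hA : ∀ i j, (fun u => A u i j) ∈ holAlg m) (i j : Fin m) :
    (fun u => (A u).adjugate i j) ∈ holAlg m := by
  have h := adjugate_mem_subalgebra (holAlg m) (M := Matrix.of fun i j u => A u i j) hA i j
  convert h using 1
  ext u
  exact congr_fun (congr_fun (RingHom.map_adjugate
    (Pi.evalRingHom (fun _ : SymIndex m → ℂ => ℂ) u) (Matrix.of fun i j u => A u i j)).symm i) j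

theorem inv_mem_holAlg {A : (SymIndex m → ℂ) → Matrix (Fin m) (Fin m) ℂ}
    (hA : ∀ i j, (fun u => A u i j) ∈ holAlg m) (h0 : ∀ u ∈ coordDomain m, (A u).det ≠ 0)
    (i j : Fin m) : (fun u => (A u)⁻¹ i j) ∈ holAlg m := by
  simp only [Matrix.inv_def, Ring.inverse_eq_inv', Matrix.smul_apply, smul_eq_mul]
  exact mul_mem (holAlg_inv (det_mem_holAlg hA) h0) (adjugate_mem_holAlg hA i j)

theorem mem_smoothAlg_of_holAlg {f : upperHalfSpace m → ℂ} {g : (SymIndex m → ℂ) → ℂ}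
    (hg : g ∈ holAlg m) (h : ∀ u (hu : u ∈ coordDomain m), f ⟨_, hu⟩ = g u) : f ∈ smoothAlg m :=
  mem_smoothAlg (ContDiffOn.restrict_scalars ℝ hg) h

/-- A matrix-valued function with holomorphic entries, as a matrix of smooth functions. -/
def holMatrix (A : Matrix (Fin m) (Fin m) ℂ → Matrix (Fin m) (Fin m) ℂ)
    (hA : ∀ i j, (fun u => A (ofEntries u) i j) ∈ holAlg m) :
    Matrix (Fin m) (Fin m) (smoothAlg m) :=
  Matrix.of fun i j => ⟨fun z => A z.1 i j, mem_smoothAlg_of_holAlg (hA i j) fun _ _ => rfl⟩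

theorem derivDir_holAlg {V : SymIndex m → ℂ} {f : smoothAlg m} {g : (SymIndex m → ℂ) → ℂ}
    (hg : g ∈ holAlg m) (h : ∀ u (hu : u ∈ coordDomain m), f.1 ⟨_, hu⟩ = g u)
    (z : upperHalfSpace m) : (derivDir V f).1 z = fderiv ℂ g (entries z.1) V := by
  rw [derivDir_apply_of_eq h, wirtDeriv_of_differentiableAt
    (differentiableAt_of_holAlg hg (entries_mem_coordDomain z.2))]

/-- Evaluation at a point. -/
def evalAt (z : upperHalfSpace m) : smoothAlg m →+* ℂ :=
  (Pi.evalRingHom (fun _ : upperHalfSpace m => ℂ) z).comp (smoothAlg m).val.toRingHom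

theorem evalAt_apply (z : upperHalfSpace m) (f : smoothAlg m) : evalAt z f = f.1 z := rfl

theorem evalAt_ext {f g : smoothAlg m} (h : ∀ z, evalAt z f = evalAt z g) : f = g :=
  Subtype.ext (funext h)

theorem evalAt_algebraMap (z : upperHalfSpace m) (c : ℂ) :
    evalAt z (algebraMap ℂ (smoothAlg m) c) = c := rfl

theorem evalAt_smul (z : upperHalfSpace m) (c : ℂ) (f : smoothAlg m) :
    evalAt z (c • f) = c * evalAt z f := rfl

/-- The matrix of coordinate functions. -/
def coordMatrix (m : ℕ) : Matrix (Fin m) (Fin m) (smoothAlg m) := holMatrix id entry_mem_holAlg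

theorem derivDir_coordMatrix (V : SymIndex m → ℂ) (i j : Fin m) :
    derivDir V (coordMatrix m i j) = algebraMap ℂ _ (ofEntries V i j) := by
  refine Subtype.ext (funext fun z => ?_)
  rw [derivDir_holAlg (entry_mem_holAlg i j) fun _ _ => rfl]
  have h : (fun u : SymIndex m → ℂ => ofEntries u i j) = (ContinuousLinearMap.proj (R := ℂ)
      (φ := fun _ => ℂ) ⟨(min i j, max i j), min_le_max⟩ : (SymIndex m → ℂ) →L[ℂ] ℂ) := rfl
  rw [h, ContinuousLinearMap.fderiv]
  rfl

theorem map_derivation_mul {R A : Type*} [CommRing R] [CommRing A] [Algebra R A]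
    (D : Derivation R A A) (M N : Matrix (Fin m) (Fin m) A) :
    (M * N).map D = M.map D * N + M * N.map D := by
  ext i j
  simp only [map_apply, Matrix.add_apply, Matrix.mul_apply, map_sum, Derivation.leibniz,
    smul_eq_mul, ← Finset.sum_add_distrib]
  exact Finset.sum_congr rfl fun k _ => by ring

/-- The derivation of `C Z + D` in direction `V` is `C V`. -/
theorem map_derivDir_affine (V : SymIndex m → ℂ) (C D : Matrix (Fin m) (Fin m) ℂ) :
    (C.map (algebraMap ℂ (smoothAlg m)) * coordMatrix m + D.map (algebraMap ℂ _)).map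
      (derivDir V) = (C * ofEntries V).map (algebraMap ℂ _) := by
  rw [Matrix.map_add _ (map_add _), map_derivation_mul]
  have h0 : ∀ M : Matrix (Fin m) (Fin m) ℂ,
      (M.map (algebraMap ℂ (smoothAlg m))).map (derivDir V) = 0 := fun M => by ext; simp
  have h1 : (coordMatrix m).map (derivDir V) = (ofEntries V).map (algebraMap ℂ _) := by
    refine Matrix.ext fun i j => ?_
    exact derivDir_coordMatrix V i j
  rw [h0, h0, h1, Matrix.map_mul]
  simp

variable {g : Matrix (Fin m ⊕ Fin m) (Fin m ⊕ Fin m) ℝ} (hg : g ∈ symplecticGroup (Fin m) ℝ)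

variable (g) in
/-- `C Z + D` as a matrix of smooth functions. -/
def denomMatrix : Matrix (Fin m) (Fin m) (smoothAlg m) :=
  holMatrix (denomR g) (denomR_entry_mem_holAlg g)

variable (g) in
/-- `A Z + B` as a matrix of smooth functions. -/
def numMatrix : Matrix (Fin m) (Fin m) (smoothAlg m) :=
  holMatrix (numR g) (numR_entry_mem_holAlg g)

include hg in
theorem det_denomR_ne_zero {u : SymIndex m → ℂ} (hu : u ∈ coordDomain m) :
    (denomR g (ofEntries u)).det ≠ 0 := (isUnit_det_denomR hg hu).ne_zero

/-- `(C Z + D)⁻¹` as a matrix of smooth functions. -/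
def denomInv : Matrix (Fin m) (Fin m) (smoothAlg m) :=
  holMatrix (fun Z => (denomR g Z)⁻¹)
    (inv_mem_holAlg (denomR_entry_mem_holAlg g) fun _ hu => det_denomR_ne_zero hg hu)

include hg in
theorem moebius_entry_mem_holAlg (i j : Fin m) :
    (fun u => moebius g (ofEntries u) i j) ∈ holAlg m :=
  mul_entry_mem_holAlg (numR_entry_mem_holAlg g)
    (inv_mem_holAlg (denomR_entry_mem_holAlg g) fun _ hu => det_denomR_ne_zero hg hu) i j

/-- `(A Z + B) (C Z + D)⁻¹` as a matrix of smooth functions. -/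
def moebiusMatrix : Matrix (Fin m) (Fin m) (smoothAlg m) :=
  holMatrix (moebius g) (moebius_entry_mem_holAlg hg)

theorem evalAt_ext_matrix {M N : Matrix (Fin m) (Fin m) (smoothAlg m)}
    (h : ∀ z, M.map (evalAt z) = N.map (evalAt z)) : M = N := by
  refine Matrix.ext fun i j => ?_
  exact evalAt_ext fun z => congr_fun (congr_fun (h z) i) j

theorem map_algebraMap_map_evalAt (M : Matrix (Fin m) (Fin m) ℂ) (z : upperHalfSpace m) :
    (M.map (algebraMap ℂ (smoothAlg m))).map (evalAt z) = M := rfl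

theorem map_evalAt_mul (M N : Matrix (Fin m) (Fin m) (smoothAlg m)) (z : upperHalfSpace m) :
    (M * N).map (evalAt z) = M.map (evalAt z) * N.map (evalAt z) := Matrix.map_mul

theorem denomMatrix_eq : denomMatrix g =
    (g.toBlocks₂₁.map Complex.ofReal).map (algebraMap ℂ (smoothAlg m)) * coordMatrix m +
      (g.toBlocks₂₂.map Complex.ofReal).map (algebraMap ℂ _) :=
  evalAt_ext_matrix fun z => by
    rw [Matrix.map_add _ (map_add _), map_evalAt_mul]; rfl

theorem numMatrix_eq : numMatrix g =
    (g.toBlocks₁₁.map Complex.ofReal).map (algebraMap ℂ (smoothAlg m)) * coordMatrix m +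
      (g.toBlocks₁₂.map Complex.ofReal).map (algebraMap ℂ _) :=
  evalAt_ext_matrix fun z => by
    rw [Matrix.map_add _ (map_add _), map_evalAt_mul]; rfl

theorem denomInv_mul : denomInv hg * denomMatrix g = 1 :=
  evalAt_ext_matrix fun z => by
    rw [map_evalAt_mul, Matrix.map_one _ (map_zero _) (map_one _)]
    exact Matrix.nonsing_inv_mul _ (isUnit_det_denomR hg z.2)

theorem mul_denomInv : denomMatrix g * denomInv hg = 1 :=
  evalAt_ext_matrix fun z => by
    rw [map_evalAt_mul, Matrix.map_one _ (map_zero _) (map_one _)]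
    exact Matrix.mul_nonsing_inv _ (isUnit_det_denomR hg z.2)

theorem moebiusMatrix_mul : moebiusMatrix hg * denomMatrix g = numMatrix g :=
  evalAt_ext_matrix fun z => by
    rw [map_evalAt_mul]
    exact moebius_mul_denomR hg z.2

theorem map_derivDir_denomInv (V : SymIndex m → ℂ) :
    (denomInv hg).map (derivDir V) = - (denomInv hg *
      (g.toBlocks₂₁.map Complex.ofReal * ofEntries V).map (algebraMap ℂ _) * denomInv hg) := by
  have h := congrArg (fun M => M.map (derivDir V)) (denomInv_mul hg)
  simp only [map_derivation_mul] at h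
  rw [denomMatrix_eq, map_derivDir_affine, ← denomMatrix_eq] at h
  have h0 : (1 : Matrix (Fin m) (Fin m) (smoothAlg m)).map (derivDir V) = 0 := by
    refine Matrix.ext fun i j => ?_
    by_cases hij : i = j <;> simp [hij]
  rw [h0, add_eq_zero_iff_eq_neg] at h
  have h1 := congrArg (fun M => M * denomInv hg) h
  simpa only [mul_assoc, mul_denomInv, mul_one, Matrix.neg_mul] using h1

theorem sub_moebius_mul {Z : Matrix (Fin m) (Fin m) ℂ} (hg : g ∈ symplecticGroup (Fin m) ℝ)
    (hZ : Z ∈ upperHalfSpace m) :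
    g.toBlocks₁₁.map Complex.ofReal - moebius g Z * g.toBlocks₂₁.map Complex.ofReal =
      (denomR g Z)⁻¹ᵀ := by
  have hu := isUnit_det_denomR hg hZ
  have hu' : IsUnit (denomR g Z)ᵀ.det := by rwa [det_transpose]
  obtain ⟨h1, h2, h3⟩ := blocks_rel hg
  have h1' := congrArg (fun M => M.map Complex.ofReal) h1
  have h3' := congrArg (fun M => (M.map Complex.ofReal)ᵀ) (sub_eq_iff_eq_add.1 h3)
  simp only [map_ofReal_mul, map_ofReal_add, map_ofReal_one, transpose_map, transpose_mul,
    transpose_add, transpose_one, transpose_transpose] at h1' h3'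
  rw [← (moebius_isSymm hg hZ).eq, moebius, transpose_mul]
  have e : g.toBlocks₁₁.map Complex.ofReal =
      (denomR g Z)⁻¹ᵀ * ((denomR g Z)ᵀ * g.toBlocks₁₁.map Complex.ofReal) := by
    rw [← mul_assoc, transpose_nonsing_inv, Matrix.nonsing_inv_mul _ hu', one_mul]
  nth_rewrite 1 [e]
  rw [mul_assoc, ← mul_sub]
  refine (congrArg _ ?_).trans (mul_one _)
  rw [denomR, numR, transpose_add, transpose_add, transpose_mul, transpose_mul, hZ.1.eq, add_mul,
    add_mul, mul_assoc, mul_assoc, h1', h3']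
  abel

theorem map_derivDir_moebiusMatrix (V : SymIndex m → ℂ) :
    (moebiusMatrix hg).map (derivDir V) =
      (denomInv hg)ᵀ * (ofEntries V).map (algebraMap ℂ _) * denomInv hg := by
  have h := congrArg (fun M => M.map (derivDir V)) (moebiusMatrix_mul hg)
  simp only [map_derivation_mul] at h
  rw [denomMatrix_eq, map_derivDir_affine, ← denomMatrix_eq, numMatrix_eq, map_derivDir_affine,
    ← eq_sub_iff_add_eq] at h
  have h1 := congrArg (fun M => M * denomInv hg) h
  simp only [mul_assoc, mul_denomInv, mul_one] at h1
  rw [h1]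
  congr 1
  refine evalAt_ext_matrix fun z => ?_
  rw [Matrix.map_sub _ (map_sub _), map_evalAt_mul, map_evalAt_mul, map_algebraMap_map_evalAt,
    map_algebraMap_map_evalAt, map_algebraMap_map_evalAt]
  change _ - moebius g z.1 * _ = (denomR g z.1)⁻¹ᵀ * _
  rw [← mul_assoc, ← sub_mul, sub_moebius_mul hg z.2]

/-- The action of a real symplectic matrix on the Siegel upper half space. -/
def act (z : upperHalfSpace m) : upperHalfSpace m := ⟨moebius g z.1, moebius_mem hg z.2⟩

variable (g) in
/-- The action of a real symplectic matrix in coordinates. -/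
def coordAct (u : SymIndex m → ℂ) : SymIndex m → ℂ := entries (moebius g (ofEntries u))

include hg in
theorem coordAct_mapsTo : Set.MapsTo (coordAct g) (coordDomain m) (coordDomain m) :=
  fun _ hu => entries_mem_coordDomain (moebius_mem hg hu)

include hg in
theorem contDiffOn_coordAct : ContDiffOn ℂ ∞ (coordAct g) (coordDomain m) :=
  contDiffOn_pi.2 fun _ => moebius_entry_mem_holAlg hg _ _

theorem comp_act_eq (f : upperHalfSpace m → ℂ) (u : SymIndex m → ℂ) (hu : u ∈ coordDomain m) :
    f (act hg ⟨_, hu⟩) = extend f (coordAct g u) := (extend_entries f _).symm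

/-- Pullback of smooth functions along the action of a real symplectic matrix. -/
def pullback : smoothAlg m →ₐ[ℂ] smoothAlg m where
  toFun f := ⟨fun z => f.1 (act hg z), mem_smoothAlg
    ((contDiffOn_extend f).comp ((contDiffOn_coordAct hg).restrict_scalars ℝ)
      (coordAct_mapsTo hg)) (comp_act_eq hg f.1)⟩
  map_one' := rfl
  map_mul' _ _ := rfl
  map_zero' := rfl
  map_add' _ _ := rfl
  commutes' _ := rfl

theorem evalAt_pullback (z : upperHalfSpace m) (f : smoothAlg m) :
    evalAt z (pullback hg f) = evalAt (act hg z) f := rfl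

include hg in
theorem differentiableAt_coordAct {u : SymIndex m → ℂ} (hu : u ∈ coordDomain m) :
    DifferentiableAt ℂ (coordAct g) u :=
  ((contDiffOn_coordAct hg).contDiffAt (isOpen_coordDomain.mem_nhds hu)).differentiableAt (by simp)

include hg in
theorem fderiv_coordAct (V : SymIndex m → ℂ) (z : upperHalfSpace m) :
    fderiv ℂ (coordAct g) (entries z.1) V =
      entries ((denomR g z.1)⁻¹ᵀ * ofEntries V * (denomR g z.1)⁻¹) := by
  funext ij
  have h := congrArg (evalAt z)
    (congr_fun (congr_fun (map_derivDir_moebiusMatrix hg V) ij.1.1) ij.1.2)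
  have h2 : evalAt z ((moebiusMatrix hg).map (derivDir V) ij.1.1 ij.1.2) =
      fderiv ℂ (fun u => moebius g (ofEntries u) ij.1.1 ij.1.2) (entries z.1) V :=
    derivDir_holAlg (moebius_entry_mem_holAlg hg _ _) (fun _ _ => rfl) z
  rw [h2] at h
  have h3 : fderiv ℂ (coordAct g) (entries z.1) V ij =
      fderiv ℂ (fun u => moebius g (ofEntries u) ij.1.1 ij.1.2) (entries z.1) V := by
    have := (hasFDerivAt_pi'.1
      (differentiableAt_coordAct hg (entries_mem_coordDomain z.2)).hasFDerivAt ij).fderiv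
    exact (congrArg (fun L => L V) this).symm
  rw [h3, h]
  have h4 : ∀ M : Matrix (Fin m) (Fin m) (smoothAlg m),
      evalAt z (M ij.1.1 ij.1.2) = (M.map (evalAt z)) ij.1.1 ij.1.2 := fun _ => rfl
  rw [h4, map_evalAt_mul, map_evalAt_mul]
  rfl

/-- The chain rule for the Wirtinger derivatives and a holomorphic change of variables. -/
theorem derivDir_pullback (V : SymIndex m → ℂ) (f : smoothAlg m) (z : upperHalfSpace m) :
    evalAt z (derivDir V (pullback hg f)) = wirtDeriv (extend f.1)
      (entries ((denomR g z.1)⁻¹ᵀ * ofEntries V * (denomR g z.1)⁻¹))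
      (entries (act hg z).1) := by
  have hz := entries_mem_coordDomain z.2
  have e : evalAt z (derivDir V (pullback hg f)) =
      wirtDeriv (extend f.1 ∘ coordAct g) V (entries z.1) :=
    derivDir_apply_of_eq (comp_act_eq hg f.1) z
  have hd := differentiableAt_coordAct hg hz
  have hc : coordAct g (entries z.1) = entries (act hg z).1 := by
    rw [coordAct, ofEntries_entries z.2.1]; rfl
  have h1 : HasFDerivAt (extend f.1 ∘ coordAct g) _ (entries z.1) :=
    HasFDerivAt.comp (entries z.1)
      (differentiableAt_extend f (coordAct_mapsTo hg hz)).hasFDerivAt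
      (hd.hasFDerivAt.restrictScalars ℝ)
  rw [e, wirtDeriv, h1.fderiv, ← fderiv_coordAct hg, wirtDeriv, hc]
  simp

/-- The direction `(E_{ij} + E_{ji}) / 2`. -/
def symDir (i j : Fin m) : SymIndex m → ℂ :=
  entries ((1 / 2 : ℂ) • (Matrix.single i j 1 + Matrix.single j i 1))

theorem ofEntries_symDir (i j : Fin m) :
    ofEntries (symDir i j) = (1 / 2 : ℂ) • (Matrix.single i j 1 + Matrix.single j i 1) := by
  refine ofEntries_entries ?_
  rw [Matrix.IsSymm, transpose_smul, transpose_add, transpose_single, transpose_single, add_comm]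

theorem symDir_comm (i j : Fin m) : symDir i j = symDir j i := by
  rw [symDir, symDir, add_comm]

/-- The derivation `∂_{ij}`. -/
def pd (i j : Fin m) : Derivation ℂ (smoothAlg m) (smoothAlg m) := derivDir (symDir i j)

theorem pd_symm (i j : Fin m) : pd i j = pd j i := by rw [pd, pd, symDir_comm]

theorem pd_comm (i j k l : Fin m) (f : smoothAlg m) : pd i j (pd k l f) = pd k l (pd i j f) :=
  derivDir_comm _ _ f

theorem pd_pullback (i j : Fin m) (f : smoothAlg m) :
    pd i j (pullback hg f) =
      ∑ a, ∑ b, denomInv hg i a * denomInv hg j b * pullback hg (pd a b f) := by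
  refine evalAt_ext fun z => ?_
  rw [pd, derivDir_pullback, ofEntries_symDir]
  simp only [map_sum, map_mul, evalAt_pullback]
  set N := (denomR g z.1)⁻¹ with hN
  have h1 : ∀ i a, evalAt z (denomInv hg i a) = N i a := fun _ _ => rfl
  have h2 : entries (Nᵀ * ((1 / 2 : ℂ) • (Matrix.single i j 1 + Matrix.single j i 1)) * N) =
      ∑ a, ∑ b, (N i a * N j b) • symDir a b := by
    funext kl
    simp only [entries, symDir, Finset.sum_apply, Pi.smul_apply, Matrix.smul_apply, smul_eq_mul,
      Matrix.mul_smul, Matrix.smul_mul, Matrix.mul_add, Matrix.add_mul, Matrix.add_apply]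
    have h3 : ∀ i j, (Nᵀ * Matrix.single i j (1 : ℂ) * N) kl.1.1 kl.1.2 =
        N i kl.1.1 * N j kl.1.2 := by
      intro i j
      simp [Matrix.mul_apply, Matrix.single_apply, Finset.sum_ite_eq, ite_and]
    rw [h3, h3]
    simp only [Matrix.single_apply, ite_and, mul_add, Finset.sum_add_distrib, mul_ite, mul_one,
      mul_zero]
    simp
    ring
  rw [h2]
  simp only [wirtDeriv_sum_dir, wirtDeriv_smul_dir, h1]
  rfl

end

section

/-! ### Expansion of a determinant along a row and a column -/

theorem det_updateCol_single_of_row {R : Type*} [CommRing R] (M : Matrix (Fin m) (Fin m) R)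
    (o : Fin m) (h : M o = Pi.single o 1) : (M.updateCol o (Pi.single o 1)).det = M.det := by
  have h1 : M.adjugate o o = M.det := by
    rw [adjugate_apply]
    congr 1
    rw [← h, updateRow_eq_self]
  have h2 : M.adjugate o o = (M.updateCol o (Pi.single o 1)).det := by
    rw [← transpose_apply M.adjugate, adjugate_transpose, adjugate_apply, updateRow_transpose,
      det_transpose]
  rw [← h2, h1]

/-- The matrix with row and column `o` replaced by those of the identity matrix. -/
def clearCross {R : Type*} [CommRing R] (M : Matrix (Fin m) (Fin m) R) (o : Fin m) :
    Matrix (Fin m) (Fin m) R := (M.updateRow o (Pi.single o 1)).updateCol o (Pi.single o 1)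

theorem clearCross_apply_of_ne {R : Type*} [CommRing R] (M : Matrix (Fin m) (Fin m) R)
    {o i j : Fin m} (hi : i ≠ o) (hj : j ≠ o) : clearCross M o i j = M i j := by
  simp [clearCross, hi, hj]

theorem clearCross_apply_left {R : Type*} [CommRing R] (M : Matrix (Fin m) (Fin m) R)
    {o j : Fin m} : clearCross M o o j = Pi.single (M := fun _ => R) o 1 j := by
  by_cases hj : j = o
  · subst hj; simp [clearCross]
  · simp [clearCross, hj]

theorem clearCross_apply_right {R : Type*} [CommRing R] (M : Matrix (Fin m) (Fin m) R)
    {o i : Fin m} : clearCross M o i o = Pi.single (M := fun _ => R) o 1 i := by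
  simp [clearCross]

/-- The entries, off row and column `o`, of the adjugate of the minor of `M` at `(o, o)`. -/
def minorAdj {R : Type*} [CommRing R] (M : Matrix (Fin m) (Fin m) R) (o i j : Fin m) : R :=
  if i = o ∨ j = o then 0 else (clearCross M o).adjugate i j

theorem minorAdj_of_ne {R : Type*} [CommRing R] (M : Matrix (Fin m) (Fin m) R)
    {o i j : Fin m} (hi : i ≠ o) (hj : j ≠ o) :
    minorAdj M o i j = (clearCross M o).adjugate i j := by simp [minorAdj, hi, hj]

theorem det_updateRow_single_eq {R : Type*} [CommRing R] (M : Matrix (Fin m) (Fin m) R)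
    {o i k : Fin m} (hi : i ≠ o) (hk : k ≠ o) :
    ((M.updateRow o (Pi.single k 1)).updateRow i (Pi.single o 1)).det = - minorAdj M o k i := by
  have h1 : ((M.updateRow o (Pi.single k 1)).updateRow i (Pi.single o 1)).det =
      - ((M.updateRow o (Pi.single o 1)).updateRow i (Pi.single k 1)).det := by
    have := det_permute (Equiv.swap i o)
      ((M.updateRow o (Pi.single o 1)).updateRow i (Pi.single k 1))
    rw [Equiv.Perm.sign_swap hi] at this
    have h3 : ((M.updateRow o (Pi.single o 1)).updateRow i (Pi.single k 1)).submatrix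
        (Equiv.swap i o) id = (M.updateRow o (Pi.single k 1)).updateRow i (Pi.single o 1) := by
      ext a b
      by_cases ha : a = i
      · subst ha; simp [updateRow_apply, hi.symm]
      · by_cases ha' : a = o
        · subst ha'; simp [updateRow_apply, hi.symm]
        · simp [updateRow_apply, Equiv.swap_apply_of_ne_of_ne ha ha', ha, ha']
    rw [h3] at this
    rw [this]
    simp
  rw [h1, minorAdj_of_ne M hk hi, adjugate_apply,
    ← det_updateCol_single_of_row ((M.updateRow o (Pi.single o 1)).updateRow i (Pi.single k 1)) o
      (by rw [updateRow_ne hi.symm, updateRow_self])]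
  congr 2
  ext a b
  by_cases ha : a = i
  · subst ha
    by_cases hb : b = o
    · subst hb; simp [hi, hk.symm]
    · simp [hb]
  · by_cases hb : b = o
    · subst hb
      simp [clearCross, updateRow_apply, ha]
    · simp [clearCross, updateRow_apply, ha, hb]

/-- The bordered determinant: expansion of `det M` along row and column `o`. -/
theorem det_eq_sub_sum_minorAdj {R : Type*} [CommRing R] (M : Matrix (Fin m) (Fin m) R)
    (o : Fin m) : M.det = M o o * (clearCross M o).det -
      ∑ k, ∑ i, M o k * M i o * minorAdj M o k i := by
  have h0 : (M.updateRow o (Pi.single o 1)).det = (clearCross M o).det :=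
    (det_updateCol_single_of_row _ o (by rw [updateRow_self])).symm
  rw [det_eq_sum_mul_adjugate_row M o, ← Finset.add_sum_erase _ _ (Finset.mem_univ o),
    adjugate_apply, h0, sub_eq_add_neg, ← Finset.sum_neg_distrib]
  congr 1
  rw [← Finset.add_sum_erase _ (fun k => - ∑ i, M o k * M i o * minorAdj M o k i)
    (Finset.mem_univ o)]
  have h1 : ∑ i, M o o * M i o * minorAdj M o o i = 0 := by simp [minorAdj]
  rw [h1, neg_zero, zero_add]
  refine Finset.sum_congr rfl fun k hk => ?_
  have hk' : k ≠ o := Finset.ne_of_mem_erase hk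
  rw [adjugate_apply, det_eq_sum_mul_adjugate_col _ o, Finset.mul_sum, ← Finset.sum_neg_distrib]
  refine Finset.sum_congr rfl fun i _ => ?_
  by_cases hi : i = o
  · subst hi
    simp [minorAdj, hk'.symm]
  · rw [adjugate_apply, updateRow_ne hi, det_updateRow_single_eq M hi hk']
    ring

theorem sum_mul_minorAdj {R : Type*} [CommRing R] (M : Matrix (Fin m) (Fin m) R)
    {o a k : Fin m} (ha : a ≠ o) : ∑ i, M a i * minorAdj M o i k =
      if k = a then (clearCross M o).det else 0 := by
  by_cases hk : k = o
  · subst hk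
    simp [minorAdj, ha.symm]
  · have h := congr_fun (congr_fun (mul_adjugate (clearCross M o)) a) k
    rw [Matrix.mul_apply, Matrix.smul_apply, Matrix.one_apply] at h
    simp only [smul_eq_mul, mul_ite, mul_one, mul_zero] at h
    simp only [eq_comm (a := k)]
    rw [← h]
    refine Finset.sum_congr rfl fun i _ => ?_
    by_cases hi : i = o
    · subst hi
      rw [clearCross_apply_right]
      simp [minorAdj, ha]
    · rw [clearCross_apply_of_ne M ha hi, minorAdj_of_ne M hi hk]

theorem clearCross_isSymm {R : Type*} [CommRing R] {M : Matrix (Fin m) (Fin m) R}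
    (hM : M.IsSymm) (o : Fin m) : (clearCross M o).IsSymm := by
  ext i j
  rw [transpose_apply]
  by_cases hi : i = o
  · subst hi; rw [clearCross_apply_left, clearCross_apply_right]
  · by_cases hj : j = o
    · subst hj; rw [clearCross_apply_left, clearCross_apply_right]
    · rw [clearCross_apply_of_ne M hi hj, clearCross_apply_of_ne M hj hi, hM.apply]

theorem minorAdj_symm {R : Type*} [CommRing R] {M : Matrix (Fin m) (Fin m) R}
    (hM : M.IsSymm) (o i j : Fin m) : minorAdj M o i j = minorAdj M o j i := by
  simp only [minorAdj, or_comm (a := i = o), (clearCross_isSymm hM o).adjugate.apply j i]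

/-- If `a = b = o` this is the expansion of the bordered determinant. Otherwise one of the rows `a`, `b`
is not the row `o`, and its product with the adjugate of the minor is a multiple of a unit vector. -/
theorem sum_sum_mul_minorAdj {R : Type*} [CommRing R] {M : Matrix (Fin m) (Fin m) R}
    (hM : M.IsSymm) (o a b : Fin m) : ∑ i, ∑ j, M a i * M b j * minorAdj M o i j =
      M a b * (clearCross M o).det - if a = o ∧ b = o then M.det else 0 := by
  have key : ∀ a b, a ≠ o → ∑ i, ∑ j, M a i * M b j * minorAdj M o i j =
      M a b * (clearCross M o).det := by
    intro a b ha
    rw [Finset.sum_comm]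
    have : ∀ j, ∑ i, M a i * M b j * minorAdj M o i j =
        M b j * ∑ i, M a i * minorAdj M o i j := fun j => by
      rw [Finset.mul_sum]
      exact Finset.sum_congr rfl fun i _ => by ring
    simp only [this, sum_mul_minorAdj M ha, mul_ite, mul_zero, Finset.sum_ite_eq',
      Finset.mem_univ, if_true]
    rw [hM.apply]
  by_cases ha : a = o
  · by_cases hb : b = o
    · rw [if_pos ⟨ha, hb⟩, ha, hb, det_eq_sub_sum_minorAdj M o, sub_sub_cancel]
      refine Finset.sum_congr rfl fun i _ => Finset.sum_congr rfl fun j _ => ?_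
      rw [hM.apply o j]
    · rw [if_neg (fun h => hb h.2), sub_zero, ← hM.apply, ← key b a hb, Finset.sum_comm]
      refine Finset.sum_congr rfl fun i _ => Finset.sum_congr rfl fun j _ => ?_
      rw [minorAdj_symm hM]
      ring
  · rw [if_neg (fun h => ha h.1), sub_zero, key a b ha]

/-- The trace of `M_o adj(M_o)`, where the minor `M_o` has size `m - 1`. -/
theorem sum_sum_minorAdj {R : Type*} [CommRing R] {M : Matrix (Fin m) (Fin m) R}
    (hM : M.IsSymm) (o : Fin m) : ∑ i, ∑ j, M i j * minorAdj M o i j =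
      ((m : R) - 1) * (clearCross M o).det := by
  have h : ∀ i, ∑ j, M i j * minorAdj M o i j = if i = o then 0 else (clearCross M o).det := by
    intro i
    split_ifs with hi
    · simp [minorAdj, hi]
    · have := sum_mul_minorAdj M (k := i) hi
      rw [if_pos rfl] at this
      rw [← this]
      exact Finset.sum_congr rfl fun j _ => by rw [minorAdj_symm hM]
  simp only [h]
  rw [← Finset.add_sum_erase _ _ (Finset.mem_univ o), if_pos rfl, zero_add,
    Finset.sum_congr rfl fun i hi => if_neg (Finset.ne_of_mem_erase hi)]
  simp [Finset.card_erase_of_mem, Fin.pos o]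

/-! ### Constant coefficient differential operators -/

/-- A symmetric matrix of commuting derivations of a commutative algebra. -/
structure CommDerivations (m : ℕ) (A : Type*) [CommRing A] [Algebra ℂ A] where
  /-- The entries of the matrix. -/
  d : Fin m → Fin m → Derivation ℂ A A
  symm : ∀ i j, d i j = d j i
  comm : ∀ i j k l f, d i j (d k l f) = d k l (d i j f)

variable {A : Type*} [CommRing A] [Algebra ℂ A] (S : CommDerivations m A)

/-- The set of the operators `∂_{ij}`. -/
def pdSet : Set (Module.End ℂ A) := Set.range fun ij : Fin m × Fin m => (S.d ij.1 ij.2).toLinearMap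

/-- The commutative algebra of differential operators generated by the `∂_{ij}`. -/
def DiffOps : Type _ := Algebra.adjoin ℂ (pdSet S)

instance : CommRing (DiffOps S) :=
  { (inferInstance : Ring (Algebra.adjoin ℂ (pdSet S))) with
    mul_comm := (Algebra.isMulCommutative_adjoin ℂ (by
      rintro _ ⟨ij, rfl⟩ _ ⟨kl, rfl⟩
      exact LinearMap.ext fun f => S.comm _ _ _ _ f)).is_comm.comm }

instance : Algebra ℂ (DiffOps S) := inferInstanceAs (Algebra ℂ (Algebra.adjoin ℂ (pdSet S)))

/-- The matrix of the operators `∂_{ij}`. -/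
def pdMatrix : Matrix (Fin m) (Fin m) (DiffOps S) :=
  Matrix.of fun i j => ⟨(S.d i j).toLinearMap, Algebra.subset_adjoin ⟨(i, j), rfl⟩⟩

/-- The operator `Δ = det(∂_{ij})`. -/
def detOp : Module.End ℂ A := (pdMatrix S).det.1

theorem pdMatrix_isSymm : (pdMatrix S).IsSymm := by
  refine Matrix.ext fun i j => Subtype.ext ?_
  change (S.d j i).toLinearMap = (S.d i j).toLinearMap
  rw [S.symm]

variable {S}

theorem pdMatrix_apply (i j : Fin m) (f : A) : (pdMatrix S i j).1 f = S.d i j f := rfl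

theorem diffOps_mul_apply (X Y : DiffOps S) (f : A) : (X * Y).1 f = X.1 (Y.1 f) := rfl

theorem diffOps_sum_apply {ι : Type*} (s : Finset ι) (X : ι → DiffOps S) (f : A) :
    (∑ i ∈ s, X i).1 f = ∑ i ∈ s, (X i).1 f := by
  refine (congrArg (fun L : Module.End ℂ A => L f) (map_sum (Algebra.adjoin ℂ (pdSet S)).val X s)).trans
    ?_
  rw [LinearMap.sum_apply]
  rfl

theorem diffOps_sub_apply (X Y : DiffOps S) (f : A) :
    (X - Y).1 f = X.1 f - Y.1 f := rfl

/-- The pairs of operators that are intertwined by `T`. -/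
def intertwined (T : Module.End ℂ (A)) : Subalgebra ℂ (DiffOps S × DiffOps S) where
  carrier := {X | ∀ f, X.1.1 (T f) = T (X.2.1 f)}
  mul_mem' {X Y} hX hY f := by
    change X.1.1 (Y.1.1 (T f)) = T (X.2.1 (Y.2.1 f))
    rw [hY, hX]
  add_mem' {X Y} hX hY f := by
    change X.1.1 (T f) + Y.1.1 (T f) = T (X.2.1 f + Y.2.1 f)
    rw [hX, hY, map_add]
  algebraMap_mem' c f := by
    change c • T f = T (c • f)
    rw [map_smul]

theorem det_mem_intertwined {T : Module.End ℂ (A)} {M N : Matrix (Fin m) (Fin m)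
    (DiffOps S)} (h : ∀ i j f, (M i j).1 (T f) = T ((N i j).1 f)) (f : A) :
    M.det.1 (T f) = T (N.det.1 f) := by
  have h1 := det_mem_subalgebra (intertwined T) (M := Matrix.of fun i j => (M i j, N i j)) h
  have h2 := RingHom.map_det (RingHom.fst (DiffOps S) (DiffOps S))
    (Matrix.of fun i j => (M i j, N i j))
  have h3 := RingHom.map_det (RingHom.snd (DiffOps S) (DiffOps S))
    (Matrix.of fun i j => (M i j, N i j))
  have h4 := h1 f
  change (RingHom.fst (DiffOps S) (DiffOps S) _).1 (T f) =
    T ((RingHom.snd (DiffOps S) (DiffOps S) _).1 f) at h4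
  rw [h2, h3] at h4
  exact h4

theorem adjugate_mem_intertwined {T : Module.End ℂ (A)} {M N : Matrix (Fin m) (Fin m)
    (DiffOps S)} (h : ∀ i j f, (M i j).1 (T f) = T ((N i j).1 f)) (i j : Fin m)
    (f : A) : (M.adjugate i j).1 (T f) = T ((N.adjugate i j).1 f) := by
  rw [adjugate_apply, adjugate_apply]
  refine det_mem_intertwined (fun k l f => ?_) f
  rw [updateRow_apply, updateRow_apply]
  split_ifs
  · rw [Pi.single_apply]
    split_ifs
    · rfl
    · exact (map_zero T).symm
  · exact h k l f

theorem map_mul_mul_transpose_apply {R : Type*} [CommRing R] [Algebra ℂ R]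
    (N : Matrix (Fin m) (Fin m) ℂ) (M : Matrix (Fin m) (Fin m) R) (i j : Fin m) :
    (N.map (algebraMap ℂ R) * M * Nᵀ.map (algebraMap ℂ R)) i j =
      ∑ a, ∑ b, (N i a * N j b) • M a b := by
  rw [Matrix.mul_apply]
  simp only [Matrix.mul_apply, Finset.sum_mul]
  rw [Finset.sum_comm]
  refine Finset.sum_congr rfl fun a _ => Finset.sum_congr rfl fun b _ => ?_
  rw [map_apply, map_apply, mul_right_comm, ← map_mul, ← Algebra.smul_def, transpose_apply]

/-- A linear change of variables. -/
theorem detOp_linear {T : Module.End ℂ (A)} (N : Matrix (Fin m) (Fin m) ℂ)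
    (h : ∀ i j f, S.d i j (T f) = T (∑ a, ∑ b, (N i a * N j b) • S.d a b f)) (f : A) :
    detOp S (T f) = (N.det ^ 2) • T (detOp S f) := by
  have h1 := det_mem_intertwined (T := T) (M := pdMatrix S)
    (N := N.map (algebraMap ℂ (DiffOps S)) * pdMatrix S * Nᵀ.map (algebraMap ℂ (DiffOps S)))
    (fun i j f => by
      rw [pdMatrix_apply, h]
      congr 1
      rw [map_mul_mul_transpose_apply, diffOps_sum_apply]
      simp only [diffOps_sum_apply]
      rfl) f
  rw [det_mul, det_mul, mul_right_comm, ← RingHom.mapMatrix_apply, ← RingHom.mapMatrix_apply,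
    ← RingHom.map_det, ← RingHom.map_det, ← map_mul, det_transpose, ← sq, ← Algebra.smul_def] at h1
  rw [detOp, h1]
  exact map_smul T _ _

/-- Intertwining with `Δ` along a partial inversion. Only the operators in row `o` see the change
of variables, each of them to first order, so that `Δ = ∂_{oo} d - ∑ ∂_{oi} ∂_{oj} a_{ij}` (with
`d` and `a` the determinant and the adjugate of the minor) can be computed explicitly. -/
theorem detOp_partialInversion {T : Module.End ℂ (A)} (o : Fin m)
    (n : Fin m → A)
    (h₁ : ∀ i j f, i ≠ o → j ≠ o → S.d i j (T f) = T (S.d i j f))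
    (h₂ : ∀ j f, j ≠ o → S.d o j (T f) = ∑ a, n a * T (S.d a j f))
    (h₃ : ∀ f, S.d o o (T f) = - ((((m : ℂ) - 1) / 2) • (n o * T f)) +
      ∑ a, ∑ b, n a * n b * T (S.d a b f))
    (h₄ : ∀ j a, j ≠ o → S.d o j (n a) = if a = j then - ((1 / 2 : ℂ) • n o) else 0)
    (f : A) : detOp S (T f) = n o ^ 2 * T (detOp S f) := by
  set D := pdMatrix S with hD
  have hsymm : D.IsSymm := pdMatrix_isSymm S
  have hc : ∀ i j f, (clearCross D o i j).1 (T f) = T ((clearCross D o i j).1 f) := by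
    intro i j f
    by_cases hi : i = o
    · subst hi
      rw [clearCross_apply_left, Pi.single_apply]
      split_ifs
      · rfl
      · exact (map_zero T).symm
    · by_cases hj : j = o
      · subst hj
        rw [clearCross_apply_right, Pi.single_apply, if_neg hi]
        exact (map_zero T).symm
      · rw [clearCross_apply_of_ne _ hi hj]
        exact h₁ i j f hi hj
  have hd := det_mem_intertwined hc f
  have ha : ∀ i j, (minorAdj D o i j).1 (T f) = T ((minorAdj D o i j).1 f) := by
    intro i j
    rw [minorAdj]
    split_ifs
    · exact (map_zero T).symm
    · exact adjugate_mem_intertwined hc i j f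
  -- Second derivatives `∂_{oi} ∂_{oj}`; the term of lower order comes from `∂_{oi} n_j`.
  have hsec : ∀ i j g, i ≠ o → j ≠ o → S.d o i (S.d o j (T g)) =
      - ((1 / 2 : ℂ) • (n o * T (S.d i j g))) +
        ∑ a, ∑ b, n a * n b * T (S.d a i (S.d b j g)) := by
    intro i j g hi hj
    rw [h₂ j g hj, map_sum]
    simp only [Derivation.leibniz, smul_eq_mul, Finset.sum_add_distrib, h₄ i _ hi,
      h₂ i _ hi, mul_ite, mul_zero, Finset.sum_ite_eq', Finset.mem_univ, if_true]
    rw [add_comm]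
    congr 1
    · rw [mul_neg, mul_smul_comm, mul_comm]
    · simp only [Finset.mul_sum]
      rw [Finset.sum_comm]
      exact Finset.sum_congr rfl fun a _ => Finset.sum_congr rfl fun b _ => by ring
  have e0 : detOp S = (D o o * (clearCross D o).det -
      ∑ i, ∑ j, D o i * D o j * minorAdj D o i j).1 := by
    have := sum_sum_mul_minorAdj hsymm o o o
    rw [if_pos ⟨rfl, rfl⟩] at this
    rw [this, sub_sub_cancel]
    rfl
  have e1 : (∑ i, ∑ j, D o i * D o j * minorAdj D o i j).1 (T f) =
      - ((((m : ℂ) - 1) / 2) • (n o * T ((clearCross D o).det.1 f))) +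
        ∑ a, ∑ b, n a * n b * T ((∑ i, ∑ j, D a i * D b j * minorAdj D o i j).1 f) := by
    have e2 : ∀ i j, (D o i * D o j * minorAdj D o i j).1 (T f) =
        - ((1 / 2 : ℂ) • (n o * T ((D i j * minorAdj D o i j).1 f))) +
        ∑ a, ∑ b, n a * n b * T ((D a i * D b j * minorAdj D o i j).1 f) := by
      intro i j
      by_cases hij : i = o ∨ j = o
      · have hz : minorAdj D o i j = 0 := by rw [minorAdj, if_pos hij]
        have hz' : ∀ g : A, (0 : DiffOps S).1 g = 0 := fun _ => rfl
        simp only [hz, mul_zero, hz', map_zero, smul_zero, neg_zero, Finset.sum_const_zero,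
          add_zero]
      · rw [not_or] at hij
        have := hsec i j ((minorAdj D o i j).1 f) hij.1 hij.2
        simp only [diffOps_mul_apply, ha]
        exact this
    simp only [diffOps_sum_apply, e2, Finset.sum_add_distrib, map_sum, Finset.mul_sum]
    congr 1
    -- The lower order terms add up to `(m-1)/2`, matching the one in `h₃`.
    · have e3 := congrArg (fun X => T (X.1 f)) (sum_sum_minorAdj hsymm o)
      simp only [diffOps_sum_apply, map_sum] at e3
      have e4 : (((m : DiffOps S) - 1) * (clearCross D o).det).1 f =
          ((m : ℂ) - 1) • (clearCross D o).det.1 f := by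
        have : ((m : DiffOps S) - 1) = algebraMap ℂ (DiffOps S) ((m : ℂ) - 1) := by simp
        rw [this, ← Algebra.smul_def]
        rfl
      rw [e4, map_smul] at e3
      simp only [Finset.sum_neg_distrib, ← Finset.smul_sum, ← Finset.mul_sum]
      rw [e3, mul_smul_comm, smul_smul]
      congr 2
      ring
    · rw [Finset.sum_congr rfl fun i _ => Finset.sum_comm]
      rw [Finset.sum_comm]
      refine Finset.sum_congr rfl fun a _ => ?_
      rw [Finset.sum_congr rfl fun i _ => Finset.sum_comm]
      rw [Finset.sum_comm]
  have e5 : ∀ a b, T ((∑ i, ∑ j, D a i * D b j * minorAdj D o i j).1 f) =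
      T (S.d a b ((clearCross D o).det.1 f)) - if a = o ∧ b = o then T (detOp S f) else 0 := by
    intro a b
    rw [sum_sum_mul_minorAdj hsymm, diffOps_sub_apply, map_sub]
    congr 1
    split_ifs
    · rfl
    · exact map_zero T
  nth_rewrite 1 [e0]
  rw [diffOps_sub_apply, e1, diffOps_mul_apply, hd, pdMatrix_apply, h₃]
  simp only [e5, mul_sub, Finset.sum_sub_distrib, mul_ite, mul_zero, ite_and, Finset.sum_ite_eq',
    Finset.mem_univ, if_true, Finset.sum_ite_irrel, Finset.sum_const_zero]
  ring

end

section

/-! ### The transformation law of `Δ` under generators of the symplectic group -/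

theorem mul_neg_smul {A : Type*} [CommRing A] [Algebra ℂ A] (c : ℂ) (a b : A) :
    a * -(c • b) = -(c • (a * b)) := by rw [mul_neg, mul_smul_comm]

variable (m) in
/-- The derivations `∂_{ij}` of the algebra of smooth functions. -/
def pdSystem : CommDerivations m (smoothAlg m) := ⟨pd, pd_symm, pd_comm⟩

section Automorphy

variable {g : Matrix (Fin m ⊕ Fin m) (Fin m ⊕ Fin m) ℝ} (hg : g ∈ symplecticGroup (Fin m) ℝ)

variable (g) in
/-- The factor of automorphy `det(CZ + D)`. -/
def autFactor : smoothAlg m := (denomMatrix g).det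

/-- The inverse of the factor of automorphy. -/
def autFactorInv : smoothAlg m := (denomInv hg).det

theorem autFactorInv_mul : autFactorInv hg * autFactor g = 1 := by
  rw [autFactorInv, autFactor, ← det_mul, denomInv_mul, det_one]

theorem evalAt_autFactor (z : upperHalfSpace m) :
    evalAt z (autFactor g) = (denomR g z.1).det :=
  RingHom.map_det (evalAt z) (denomMatrix g)

theorem evalAt_autFactorInv (z : upperHalfSpace m) :
    evalAt z (autFactorInv hg) = (denomR g z.1).det⁻¹ := by
  rw [← evalAt_autFactor]
  exact eq_inv_of_mul_eq_one_left (by rw [← map_mul, autFactorInv_mul, map_one])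

/-- The operator `Δ` raises the weight from `(m-1)/2` to `(m+3)/2`: it intertwines the actions of
`g` in these weights. The power of the factor of automorphy of exponent `-(m-1)/2` is represented
by any solution `μ` of the differential equation that characterizes it. -/
def DetOpEquivariant : Prop :=
  ∀ μ : smoothAlg m, (∀ i j, autFactor g * pd i j μ =
      -((((m : ℂ) - 1) / 2) • (pd i j (autFactor g) * μ))) →
    ∀ f, detOp (pdSystem m) (μ * pullback hg f) =
      autFactorInv hg ^ 2 * (μ * pullback hg (detOp (pdSystem m) f))

/-- The operator `f ↦ μ · γ^* f`. -/
def twistedPullback (μ : smoothAlg m) : Module.End ℂ (smoothAlg m) :=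
  (LinearMap.mulLeft ℂ μ).comp (pullback hg).toLinearMap

theorem twistedPullback_apply (μ f : smoothAlg m) :
    twistedPullback hg μ f = μ * pullback hg f := rfl

/-- If `C = 0`, the factor of automorphy is constant and `γ` acts by an affine change of variables. -/
theorem detOpEquivariant_of_lower_eq_zero (hC : g.toBlocks₂₁ = 0) : DetOpEquivariant hg := by
  intro μ hμ f
  set N : Matrix (Fin m) (Fin m) ℂ := (g.toBlocks₂₂.map Complex.ofReal)⁻¹ with hN
  have hden : denomMatrix g = (g.toBlocks₂₂.map Complex.ofReal).map (algebraMap ℂ _) := by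
    rw [denomMatrix_eq, hC]
    ext i j
    simp
  have hinv : denomInv hg = N.map (algebraMap ℂ _) := by
    refine evalAt_ext_matrix fun z => ?_
    rw [map_algebraMap_map_evalAt]
    change (denomR g z.1)⁻¹ = N
    rw [hN, denomR, hC]
    congr 1
    ext i j
    simp
  have hj : autFactorInv hg = algebraMap ℂ _ N.det := by
    rw [autFactorInv, hinv]
    exact (RingHom.map_det (algebraMap ℂ (smoothAlg m)) N).symm
  have hj' : autFactor g = algebraMap ℂ _ (g.toBlocks₂₂.map Complex.ofReal).det := by
    rw [autFactor, hden]
    exact (RingHom.map_det (algebraMap ℂ (smoothAlg m)) _).symm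
  have hμ0 : ∀ i j, pd i j μ = 0 := by
    intro i j
    have h1 := hμ i j
    have h2 : pd i j (autFactor g) = 0 := by rw [hj', Derivation.map_algebraMap]
    rw [h2, zero_mul, smul_zero, neg_zero] at h1
    have h3 := congrArg (fun x => autFactorInv hg * x) h1
    simpa only [← mul_assoc, autFactorInv_mul, one_mul, mul_zero] using h3
  have h := detOp_linear (S := pdSystem m) (T := twistedPullback hg μ) N (fun i j f => by
    change pd i j (μ * pullback hg f) = μ * pullback hg (∑ a, ∑ b, (N i a * N j b) • pd a b f)
    rw [Derivation.leibniz, hμ0, smul_zero, add_zero, pd_pullback, smul_eq_mul, hinv]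
    congr 1
    rw [map_sum]
    refine Finset.sum_congr rfl fun a _ => ?_
    rw [map_sum]
    refine Finset.sum_congr rfl fun b _ => ?_
    rw [map_smul, Algebra.smul_def, map_mul]
    rfl) f
  rw [twistedPullback_apply, twistedPullback_apply] at h
  rw [h, hj, ← map_pow, Algebra.smul_def]

end Automorphy

/-- The partial inversion in the coordinates `s`. -/
def partialJ (s : Finset (Fin m)) : Matrix (Fin m ⊕ Fin m) (Fin m ⊕ Fin m) ℝ :=
  fromBlocks (diagonal fun i => if i ∈ s then 0 else 1) (diagonal fun i => if i ∈ s then -1 else 0)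
    (diagonal fun i => if i ∈ s then 1 else 0) (diagonal fun i => if i ∈ s then 0 else 1)

theorem partialJ_mem (s : Finset (Fin m)) : partialJ s ∈ symplecticGroup (Fin m) ℝ := by
  rw [partialJ, SymplecticGroup.fromBlocks_mem_iff]
  simp only [diagonal_transpose, diagonal_mul_diagonal, diagonal_sub]
  refine ⟨?_, ?_, ?_⟩
  · congr 1; ext i; split_ifs <;> simp
  · congr 1; ext i; split_ifs <;> simp
  · rw [← diagonal_one]; congr 1; ext i; split_ifs <;> simp

theorem partialJ_univ : partialJ (Finset.univ : Finset (Fin m)) = J (Fin m) ℝ := by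
  simp [partialJ, J]
  rw [← diagonal_one, ← diagonal_neg]

theorem partialJ_insert {s : Finset (Fin m)} {o : Fin m} (ho : o ∉ s) :
    partialJ (insert o s) = partialJ {o} * partialJ s := by
  rw [partialJ, partialJ, partialJ, fromBlocks_multiply]
  simp only [diagonal_mul_diagonal, diagonal_add]
  congr 2 <;>
  · ext i
    by_cases h1 : i = o
    · subst h1; simp [ho]
    · simp [h1]

theorem partialJ_lower (o : Fin m) :
    (partialJ {o}).toBlocks₂₁ = Matrix.single o o 1 := by
  rw [partialJ, toBlocks_fromBlocks₂₁]
  ext i j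
  by_cases hij : i = j
  · subst hij
    by_cases h : i = o
    · subst h; simp
    · simp [h, Ne.symm h]
  · rw [diagonal_apply_ne _ hij, Matrix.single_apply, if_neg]
    rintro ⟨rfl, rfl⟩
    exact hij rfl

section PartialInversion

variable (o : Fin m)

theorem denomMatrix_partialJ_self (b : Fin m) :
    denomMatrix (partialJ {o}) o b = coordMatrix m o b := by
  refine evalAt_ext fun z => ?_
  change denomR (partialJ {o}) z.1 o b = z.1 o b
  rw [denomR, partialJ_lower, partialJ, toBlocks_fromBlocks₂₂]
  simp [Matrix.mul_apply, Matrix.single_apply, diagonal_apply, apply_ite Complex.ofReal]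

theorem denomMatrix_partialJ_of_ne {i : Fin m} (hi : i ≠ o) (b : Fin m) :
    denomMatrix (partialJ {o}) i b = if i = b then 1 else 0 := by
  refine evalAt_ext fun z => ?_
  have : evalAt z (denomMatrix (partialJ {o}) i b) = if i = b then 1 else 0 := by
    change denomR (partialJ {o}) z.1 i b = _
    rw [denomR, partialJ_lower, partialJ, toBlocks_fromBlocks₂₂]
    simp [Matrix.mul_apply, diagonal_apply, hi, hi.symm, apply_ite]
  rw [this]
  split_ifs <;> simp

theorem denomInv_partialJ_of_ne {i : Fin m} (hi : i ≠ o) (a : Fin m) :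
    denomInv (partialJ_mem {o}) i a = if i = a then 1 else 0 := by
  have h := congr_fun (congr_fun (mul_denomInv (partialJ_mem {o})) i) a
  rw [Matrix.mul_apply] at h
  simp only [denomMatrix_partialJ_of_ne o hi, ite_mul, one_mul, zero_mul, Finset.sum_ite_eq,
    Finset.mem_univ, if_true] at h
  rw [h, Matrix.one_apply]

theorem coord_mul_denomInv_partialJ :
    coordMatrix m o o * denomInv (partialJ_mem {o}) o o = 1 := by
  have h := congr_fun (congr_fun (mul_denomInv (partialJ_mem {o})) o) o
  rw [Matrix.mul_apply, Finset.sum_eq_single o, denomMatrix_partialJ_self] at h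
  · rw [h, Matrix.one_apply_eq]
  · intro b _ hb
    rw [denomInv_partialJ_of_ne o hb, if_neg hb, mul_zero]
  · simp

theorem autFactor_partialJ : autFactor (partialJ {o}) = coordMatrix m o o := by
  have h : denomMatrix (partialJ {o}) =
      (1 : Matrix (Fin m) (Fin m) (smoothAlg m)).updateRow o (coordMatrix m o) := by
    refine Matrix.ext fun i j => ?_
    by_cases hi : i = o
    · subst hi
      rw [updateRow_self, denomMatrix_partialJ_self]
    · rw [updateRow_ne hi, denomMatrix_partialJ_of_ne o hi, Matrix.one_apply]
  rw [autFactor, h, ← cramer_transpose_apply, transpose_one, cramer_one]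
  rfl

theorem autFactorInv_partialJ :
    autFactorInv (partialJ_mem {o}) = denomInv (partialJ_mem {o}) o o := by
  have h1 := autFactorInv_mul (partialJ_mem {o})
  rw [autFactor_partialJ] at h1
  calc _ = autFactorInv (partialJ_mem {o}) *
        (coordMatrix m o o * denomInv (partialJ_mem {o}) o o) := by
          rw [coord_mul_denomInv_partialJ, mul_one]
    _ = _ := by rw [← mul_assoc, h1, one_mul]

theorem pd_coord_self (i j : Fin m) :
    pd i j (coordMatrix m o o) = if i = o ∧ j = o then 1 else 0 := by
  rw [pd, derivDir_coordMatrix, ofEntries_symDir]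
  by_cases hi : i = o <;> by_cases hj : j = o <;>
    simp [hi, hj]
  rw [one_add_one_eq_two, ← map_ofNat (algebraMap ℂ (smoothAlg m)) 2, ← map_mul]
  norm_num

theorem pd_denomInv_partialJ {j : Fin m} (hj : j ≠ o) (a : Fin m) :
    pd o j (denomInv (partialJ_mem {o}) o a) =
      if a = j then -((1 / 2 : ℂ) • denomInv (partialJ_mem {o}) o o) else 0 := by
  have h := congr_fun (congr_fun (map_derivDir_denomInv (partialJ_mem {o}) (symDir o j)) o) a
  have e : ∀ b c, ((partialJ {o}).toBlocks₂₁.map Complex.ofReal * ofEntries (symDir o j)) b c =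
      if b = o ∧ c = j then 1 / 2 else 0 := by
    intro b c
    have hs : (Matrix.single o o (1 : ℝ)).map Complex.ofReal = Matrix.single o o 1 := by
      ext b c
      simp [Matrix.single_apply, apply_ite Complex.ofReal]
    rw [partialJ_lower, ofEntries_symDir, hs]
    by_cases hb : b = o
    · subst hb
      rw [Matrix.single_mul_apply_same]
      by_cases hc : c = j
      · subst hc
        simp [hj]
      · simp [hj, hc, Ne.symm hc]
    · rw [Matrix.single_mul_apply_of_ne _ _ _ _ _ hb, if_neg (fun h => hb h.1)]
  rw [pd]
  refine h.trans ?_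
  rw [Matrix.neg_apply, mul_assoc, Matrix.mul_apply, Finset.sum_eq_single o, Matrix.mul_apply,
    Finset.sum_eq_single j, map_apply, e, if_pos ⟨rfl, rfl⟩, denomInv_partialJ_of_ne o hj]
  · by_cases ha : a = j
    · rw [if_pos ha, if_pos ha.symm, mul_one, mul_comm, Algebra.smul_def]
    · rw [if_neg ha, if_neg (Ne.symm ha), mul_zero, mul_zero, neg_zero]
  · intro b _ hb
    rw [map_apply, e, if_neg (fun h => hb h.2), map_zero, zero_mul]
  · simp
  · intro b _ hb
    rw [Matrix.mul_apply, Finset.sum_eq_zero, mul_zero]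
    intro c _
    rw [map_apply, e, if_neg (fun h => hb h.1), map_zero, zero_mul]
  · simp

/-- The partial inversion in one coordinate `o`, whose factor of automorphy is `Z_{oo}`. -/
theorem detOpEquivariant_partialJ : DetOpEquivariant (partialJ_mem {o}) := by
  intro μ hμ f
  rw [autFactorInv_partialJ]
  simp only [autFactor_partialJ, pd_coord_self] at hμ
  have hμ0 : ∀ i j, ¬ (i = o ∧ j = o) → pd i j μ = 0 := by
    intro i j hij
    have h1 := hμ i j
    rw [if_neg hij, zero_mul, smul_zero, neg_zero] at h1
    calc pd i j μ = (coordMatrix m o o * denomInv (partialJ_mem {o}) o o) * pd i j μ := by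
          rw [coord_mul_denomInv_partialJ, one_mul]
      _ = denomInv (partialJ_mem {o}) o o * (coordMatrix m o o * pd i j μ) := by ring
      _ = 0 := by rw [h1, mul_zero]
  have hμ1 : pd o o μ = -((((m : ℂ) - 1) / 2) • (denomInv (partialJ_mem {o}) o o * μ)) := by
    have h1 := hμ o o
    rw [if_pos ⟨rfl, rfl⟩, one_mul] at h1
    calc pd o o μ = (coordMatrix m o o * denomInv (partialJ_mem {o}) o o) * pd o o μ := by
          rw [coord_mul_denomInv_partialJ, one_mul]
      _ = denomInv (partialJ_mem {o}) o o * (coordMatrix m o o * pd o o μ) := by ring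
      _ = _ := by rw [h1]; exact mul_neg_smul _ _ _
  have h0 : ∀ i j f, ¬ (i = o ∧ j = o) → pd i j (μ * pullback (partialJ_mem {o}) f) =
      μ * pd i j (pullback (partialJ_mem {o}) f) := by
    intro i j f hij
    rw [Derivation.leibniz, hμ0 i j hij, smul_zero, add_zero, smul_eq_mul]
  refine detOp_partialInversion (S := pdSystem m) (T := twistedPullback (partialJ_mem {o}) μ) o
    (fun a => denomInv (partialJ_mem {o}) o a) ?_ ?_ ?_ ?_ f
  · intro i j f hi hj
    refine (h0 i j f fun h => hi h.1).trans ?_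
    rw [pd_pullback, twistedPullback_apply]
    simp only [denomInv_partialJ_of_ne o hi, denomInv_partialJ_of_ne o hj, ite_mul, mul_ite,
      one_mul, mul_one, zero_mul, mul_zero, Finset.sum_ite_eq, Finset.mem_univ, if_true]
    rfl
  · intro j f hj
    refine (h0 o j f fun h => hj h.2).trans ?_
    rw [pd_pullback]
    simp only [denomInv_partialJ_of_ne o hj, ite_mul, mul_ite, mul_one, zero_mul,
      mul_zero, Finset.sum_ite_eq, Finset.mem_univ, if_true, Finset.mul_sum]
    exact Finset.sum_congr rfl fun a _ => mul_left_comm _ _ _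
  · intro f
    refine (Derivation.leibniz (pd o o) μ _).trans ?_
    change μ • pd o o (pullback (partialJ_mem {o}) f) + pullback (partialJ_mem {o}) f • pd o o μ = _
    rw [pd_pullback, hμ1, twistedPullback_apply, smul_eq_mul, smul_eq_mul, add_comm]
    congr 1
    · refine (mul_neg_smul _ _ _).trans ?_
      congr 2
      ring
    · simp only [Finset.mul_sum]
      exact Finset.sum_congr rfl fun a _ => Finset.sum_congr rfl fun b _ => mul_left_comm _ _ _
  · intro j a hj
    exact pd_denomInv_partialJ o hj a

end PartialInversion

/-! ### Complex powers of `det(Z - Z̄)` -/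

theorem contDiffAt_comp_extend {φ : ℂ → ℂ} (f : smoothAlg m)
    (hφ : ∀ z, ContDiffAt ℂ ∞ φ (f.1 z)) :
    ContDiffOn ℝ ∞ (fun u => φ (extend f.1 u)) (coordDomain m) := by
  intro u hu
  have h1 := (hφ ⟨_, hu⟩).restrict_scalars ℝ
  rw [← extend_of_mem f.1 hu] at h1
  exact (h1.comp u (contDiffAt_extend f hu)).contDiffWithinAt

/-- Composition of a smooth function with a holomorphic function of one variable. -/
def compHol (φ : ℂ → ℂ) (f : smoothAlg m) (hφ : ∀ z, ContDiffAt ℂ ∞ φ (f.1 z)) : smoothAlg m :=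
  ⟨fun z => φ (f.1 z), mem_smoothAlg (contDiffAt_comp_extend f hφ) fun u hu => by
    rw [extend_of_mem f.1 hu]⟩

theorem derivDir_compHol (φ : ℂ → ℂ) (f : smoothAlg m) (hφ : ∀ z, ContDiffAt ℂ ∞ φ (f.1 z))
    (V : SymIndex m → ℂ) (z : upperHalfSpace m) :
    evalAt z (derivDir V (compHol φ f hφ)) =
      deriv φ (f.1 z) * evalAt z (derivDir V f) := by
  have e : evalAt z (derivDir V (compHol φ f hφ)) =
      wirtDeriv (φ ∘ extend f.1) V (entries z.1) :=
    derivDir_apply_of_eq (fun u hu => by rw [Function.comp, extend_of_mem f.1 hu]; rfl) z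
  have hz := entries_mem_coordDomain z.2
  have h1 : HasDerivAt φ (deriv φ (f.1 z)) (extend f.1 (entries z.1)) := by
    rw [extend_entries]
    exact ((hφ z).differentiableAt (by simp)).hasDerivAt
  have h2 : HasFDerivAt (φ ∘ extend f.1) _ (entries z.1) :=
    HasFDerivAt.comp (entries z.1) (h1.hasFDerivAt.restrictScalars ℝ)
      (differentiableAt_extend f hz).hasFDerivAt
  rw [e, wirtDeriv, h2.fderiv, evalAt_apply, derivDir_apply, wirtDeriv]
  simp
  ring

theorem cpow_eq_of_ray {c : ℂ} (hc : c ≠ 0) {r : ℝ} (hr : 0 < r) (σ : ℂ) :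
    ((r : ℂ) * c) ^ σ = c ^ σ * Complex.exp (σ * Complex.log ((r : ℂ) * c / c)) := by
  have hr' : (r : ℂ) ≠ 0 := by exact_mod_cast hr.ne'
  rw [mul_div_cancel_right₀ _ hc, Complex.cpow_def_of_ne_zero (mul_ne_zero hr' hc),
    Complex.cpow_def_of_ne_zero hc, Complex.log_ofReal_mul hr hc, ← Complex.exp_add,
    Complex.ofReal_log hr.le]
  congr 1
  ring

/-- The complex powers of a smooth function all of whose values lie on one open ray. -/
theorem exists_rayPow (f : smoothAlg m) {c : ℂ} (hc : c ≠ 0)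
    (hf : ∀ z, ∃ r : ℝ, 0 < r ∧ f.1 z = r * c) (σ : ℂ) :
    ∃ h : smoothAlg m, (∀ z, h.1 z = f.1 z ^ σ) ∧
      ∀ V, f * derivDir V h = σ • (derivDir V f * h) := by
  have hs : ∀ z, f.1 z / c ∈ Complex.slitPlane := by
    intro z
    obtain ⟨r, hr, h⟩ := hf z
    rw [h, mul_div_cancel_right₀ _ hc, Complex.mem_slitPlane_iff]
    left; simpa using hr
  set φ : ℂ → ℂ := fun w => c ^ σ * Complex.exp (σ * Complex.log (w / c)) with hφ
  have h1 : ∀ z, ContDiffAt ℂ ∞ φ (f.1 z) := by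
    intro z
    have h2 : ContDiffAt ℂ ∞ (fun w : ℂ => Complex.log (w / c)) (f.1 z) :=
      (Complex.contDiffAt_log (hs z)).comp (f.1 z) (contDiffAt_id.div_const c)
    exact contDiffAt_const.mul (Complex.contDiff_exp.contDiffAt.comp (f.1 z)
      (contDiffAt_const.mul h2))
  have h0 : ∀ z, f.1 z ≠ 0 := by
    intro z
    obtain ⟨r, hr, h⟩ := hf z
    rw [h]
    exact mul_ne_zero (by exact_mod_cast hr.ne') hc
  refine ⟨compHol φ f h1, fun z => ?_, fun V => evalAt_ext fun z => ?_⟩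
  · obtain ⟨r, hr, h⟩ := hf z
    change φ (f.1 z) = _
    rw [hφ, h, cpow_eq_of_ray hc hr]
  · have h3 : HasDerivAt φ (c ^ σ * (Complex.exp (σ * Complex.log (f.1 z / c)) *
        (σ * (1 / c / (f.1 z / c))))) (f.1 z) :=
      ((((hasDerivAt_id (f.1 z)).div_const c).clog (hs z)).const_mul σ).cexp.const_mul _
    rw [map_mul, derivDir_compHol, h3.deriv, evalAt_smul, map_mul]
    change f.1 z * _ = σ * (_ * φ (f.1 z))
    have := h0 z
    rw [hφ]
    field_simp

/-- Complex conjugation of smooth functions. -/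
def conjSmooth (f : smoothAlg m) : smoothAlg m :=
  ⟨fun z => (starRingEnd ℂ) (f.1 z), mem_smoothAlg
    (g := fun u => (Complex.conjCLE : ℂ →L[ℝ] ℂ) (extend f.1 u))
    ((Complex.conjCLE : ℂ →L[ℝ] ℂ).contDiff.comp_contDiffOn (contDiffOn_extend f)) fun u hu => by
      rw [extend_of_mem f.1 hu]; rfl⟩

theorem derivDir_conjSmooth {f : smoothAlg m} {g : (SymIndex m → ℂ) → ℂ} (hg : g ∈ holAlg m)
    (h : ∀ u (hu : u ∈ coordDomain m), f.1 ⟨_, hu⟩ = g u) (V : SymIndex m → ℂ) :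
    derivDir V (conjSmooth f) = 0 := by
  refine evalAt_ext fun z => ?_
  rw [map_zero]
  refine (derivDir_apply_of_eq (g := fun u => (starRingEnd ℂ) (g u)) (fun u hu => ?_) z).trans
    (wirtDeriv_conj (differentiableAt_of_holAlg hg (entries_mem_coordDomain z.2)) V)
  rw [← h u hu]; rfl

variable (m) in
/-- The matrix `Z - Z̄`. -/
def subConjMatrix : Matrix (Fin m) (Fin m) (smoothAlg m) :=
  coordMatrix m - (coordMatrix m).map conjSmooth

theorem subConjMatrix_map_evalAt (z : upperHalfSpace m) :
    (subConjMatrix m).map (evalAt z) = z.1 - z.1.map (starRingEnd ℂ) := rfl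

theorem evalAt_det_subConjMatrix (z : upperHalfSpace m) :
    evalAt z (subConjMatrix m).det = detSubConj z.1 :=
  RingHom.map_det (evalAt z) (subConjMatrix m)

theorem map_derivDir_subConjMatrix (V : SymIndex m → ℂ) :
    (subConjMatrix m).map (derivDir V) = (ofEntries V).map (algebraMap ℂ _) := by
  refine Matrix.ext fun i j => ?_
  change derivDir V (coordMatrix m i j - conjSmooth (coordMatrix m i j)) = _
  rw [map_sub, derivDir_coordMatrix, derivDir_conjSmooth (entry_mem_holAlg i j) fun _ _ => rfl,
    sub_zero]
  rfl

theorem detSubConj_eq (Z : Matrix (Fin m) (Fin m) ℂ) :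
    detSubConj Z = ((Z.map Complex.im).det : ℝ) * (2 * Complex.I) ^ m := by
  rw [detSubConj, sub_conj_eq, det_smul, Fintype.card_fin, mul_comm]
  congr 1
  exact (RingHom.map_det Complex.ofRealHom (Z.map Complex.im)).symm

theorem detSubConj_ray (z : upperHalfSpace m) :
    ∃ r : ℝ, 0 < r ∧ (subConjMatrix m).det.1 z = r * (2 * Complex.I) ^ m :=
  ⟨_, z.2.2.det_pos, (evalAt_det_subConjMatrix z).trans (detSubConj_eq z.1)⟩

theorem two_I_pow_ne_zero : (2 * Complex.I) ^ m ≠ 0 := pow_ne_zero _ (by simp)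

variable (m) in
/-- The function `det(Z - Z̄) ^ σ`. -/
def subConjPow (σ : ℂ) : smoothAlg m :=
  (exists_rayPow (subConjMatrix m).det two_I_pow_ne_zero detSubConj_ray σ).choose

theorem evalAt_subConjPow (σ : ℂ) (z : upperHalfSpace m) :
    evalAt z (subConjPow m σ) = detSubConj z.1 ^ σ := by
  rw [← evalAt_det_subConjMatrix]
  exact (exists_rayPow (subConjMatrix m).det two_I_pow_ne_zero detSubConj_ray σ).choose_spec.1 z

theorem derivDir_subConjPow (σ : ℂ) (V : SymIndex m → ℂ) :
    (subConjMatrix m).det * derivDir V (subConjPow m σ) =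
      σ • (derivDir V (subConjMatrix m).det * subConjPow m σ) :=
  (exists_rayPow (subConjMatrix m).det two_I_pow_ne_zero detSubConj_ray σ).choose_spec.2 V

theorem detSubConj_ne_zero (z : upperHalfSpace m) : detSubConj z.1 ≠ 0 := by
  rw [detSubConj_eq]
  exact mul_ne_zero (by exact_mod_cast z.2.2.det_pos.ne') two_I_pow_ne_zero

theorem subConjPow_mul_neg (σ : ℂ) : subConjPow m (-σ) * subConjPow m σ = 1 :=
  evalAt_ext fun z => by
    rw [map_mul, evalAt_subConjPow, evalAt_subConjPow, ← Complex.cpow_add _ _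
      (detSubConj_ne_zero z), neg_add_cancel, Complex.cpow_zero, map_one]

end

section

open scoped ComplexOrder

/-! ### Equivariance of the Maass operator -/

/-- The Maass operator on smooth functions. -/
def maass (k : ℕ) (f : smoothAlg m) : smoothAlg m :=
  subConjPow m (-((k : ℂ) - ((m : ℂ) + 1) / 2 + 1)) *
    detOp (pdSystem m) (subConjPow m ((k : ℂ) - ((m : ℂ) + 1) / 2 + 1) * f)

section

variable {g : Matrix (Fin m ⊕ Fin m) (Fin m ⊕ Fin m) ℝ} (hg : g ∈ symplecticGroup (Fin m) ℝ)

/-- The weight `k` action on smooth functions. -/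
def slashSmooth (k : ℕ) (f : smoothAlg m) : smoothAlg m := autFactorInv hg ^ k * pullback hg f

/-- The Maass operator commutes with the action of `g`. -/
def MaassEquivariant : Prop :=
  ∀ k f, maass k (slashSmooth hg k f) = slashSmooth hg (k + 2) (maass k f)

theorem autFactor_mul_pd_autFactorInv_pow (i j : Fin m) (k : ℕ) :
    autFactor g * pd i j (autFactorInv hg ^ k) =
      -((k : ℂ) • (pd i j (autFactor g) * autFactorInv hg ^ k)) := by
  have h0 : autFactor g * pd i j (autFactorInv hg) = -(pd i j (autFactor g) * autFactorInv hg) := by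
    have h := congrArg (pd i j) (autFactorInv_mul hg)
    rw [Derivation.leibniz, Derivation.map_one_eq_zero, smul_eq_mul, smul_eq_mul,
      add_comm] at h
    rw [eq_neg_of_add_eq_zero_left h, mul_comm]
  induction k with
  | zero => simp
  | succ k ih =>
    rw [pow_succ, Derivation.leibniz, smul_eq_mul, smul_eq_mul]
    refine evalAt_ext fun z => ?_
    have h0' := congrArg (evalAt z) h0
    have ih' := congrArg (evalAt z) ih
    simp only [map_mul, map_add, map_neg, evalAt_smul] at h0' ih' ⊢
    push_cast
    linear_combination (evalAt z) (autFactorInv hg ^ k) * h0' + evalAt z (autFactorInv hg) * ih'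

include hg in
/-- The function `|det(CZ + D)| ^ (2σ)` and its logarithmic derivatives. -/
theorem exists_normPow (σ : ℂ) : ∃ h : smoothAlg m,
    (∀ z, evalAt z h = ((Complex.normSq (denomR g z.1).det : ℝ) : ℂ) ^ σ) ∧
      ∀ i j, autFactor g * pd i j h = σ • (pd i j (autFactor g) * h) := by
  have he : ∀ z, evalAt z (autFactor g * conjSmooth (autFactor g)) =
      ((Complex.normSq (denomR g z.1).det : ℝ) : ℂ) := by
    intro z
    rw [map_mul, ← Complex.mul_conj, ← evalAt_autFactor]
    rfl
  have h0 : ∀ z : upperHalfSpace m, (denomR g z.1).det ≠ 0 := fun z =>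
    (isUnit_det_denomR hg z.2).ne_zero
  obtain ⟨h, h1, h2⟩ := exists_rayPow (autFactor g * conjSmooth (autFactor g)) one_ne_zero
    (fun z => ⟨_, Complex.normSq_pos.2 (h0 z), by rw [mul_one]; exact he z⟩) σ
  refine ⟨h, fun z => ?_, fun i j => evalAt_ext fun z => ?_⟩
  · rw [← he]
    exact h1 z
  · have h3 := congrArg (evalAt z) (h2 (symDir i j))
    have h4 : derivDir (symDir i j) (conjSmooth (autFactor g)) = 0 :=
      derivDir_conjSmooth (det_mem_holAlg (denomR_entry_mem_holAlg g))
        (fun u hu => evalAt_autFactor ⟨_, hu⟩) _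
    rw [Derivation.leibniz, h4, smul_zero, zero_add, smul_eq_mul] at h3
    simp only [map_mul, evalAt_smul] at h3 ⊢
    have h5 : evalAt z (conjSmooth (autFactor g)) ≠ 0 := by
      have : evalAt z (conjSmooth (autFactor g)) = (starRingEnd ℂ) (evalAt z (autFactor g)) := rfl
      rw [this, evalAt_autFactor]
      simpa using h0 z
    apply mul_left_cancel₀ h5
    rw [pd]
    linear_combination h3

/-- Multiplication by `det(Z - Z̄)^σ` turns the weight `k` action into that of weight
`k - σ = (m-1)/2`, and turns `Δ_k` into `Δ`. -/
theorem maassEquivariant_of_detOp (h : DetOpEquivariant hg) : MaassEquivariant hg := by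
  intro k f
  set σ : ℂ := (k : ℂ) - ((m : ℂ) + 1) / 2 + 1 with hσ
  obtain ⟨ν, hν, hν'⟩ := exists_normPow hg σ
  obtain ⟨ν₂, hν₂, -⟩ := exists_normPow hg (-σ)
  have h0 : ∀ z : upperHalfSpace m, (Complex.normSq (denomR g z.1).det : ℝ) ≠ 0 := fun z =>
    (Complex.normSq_pos.2 (isUnit_det_denomR hg z.2).ne_zero).ne'
  -- `det(Z - Z̄) = |j|² det(γZ - conj γZ)` for `j = det(CZ + D)`. As `|j|²` is a positive real, the
  -- complex power is multiplicative here.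
  have hw : ∀ (τ : ℂ) (ν : smoothAlg m),
      (∀ z, evalAt z ν = ((Complex.normSq (denomR g z.1).det : ℝ) : ℂ) ^ τ) →
      subConjPow m τ = ν * pullback hg (subConjPow m τ) := by
    intro τ ν hν
    refine evalAt_ext fun z => ?_
    rw [map_mul, hν, evalAt_pullback, evalAt_subConjPow, evalAt_subConjPow,
      detSubConj_moebius hg z.2]
    change _ = _ * detSubConj (moebius g z.1) ^ τ
    have hr : 0 < (Complex.normSq (denomR g z.1).det : ℝ) :=
      Complex.normSq_pos.2 (isUnit_det_denomR hg z.2).ne_zero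
    have hr' : ((Complex.normSq (denomR g z.1).det : ℝ) : ℂ) ≠ 0 := by exact_mod_cast hr.ne'
    have hc : detSubConj (moebius g z.1) ≠ 0 := detSubConj_ne_zero (act hg z)
    rw [Complex.cpow_def_of_ne_zero (mul_ne_zero hr' hc), Complex.cpow_def_of_ne_zero hr',
      Complex.cpow_def_of_ne_zero hc, Complex.log_ofReal_mul hr hc, ← Complex.exp_add,
      Complex.ofReal_log hr.le, add_mul]
  have hνν : ν₂ * ν = 1 := evalAt_ext fun z => by
    rw [map_mul, hν, hν₂, ← Complex.cpow_add _ _ (by exact_mod_cast h0 z), neg_add_cancel,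
      Complex.cpow_zero, map_one]
  -- `|j|^{2σ} j^{-k}` and `j^{-(m-1)/2}` have the same logarithmic derivatives, as `σ - k = -(m-1)/2`.
  have hμ : ∀ i j, autFactor g * pd i j (ν * autFactorInv hg ^ k) =
      -((((m : ℂ) - 1) / 2) • (pd i j (autFactor g) * (ν * autFactorInv hg ^ k))) := by
    intro i j
    rw [Derivation.leibniz, smul_eq_mul, smul_eq_mul]
    refine evalAt_ext fun z => ?_
    have e1 := congrArg (evalAt z) (autFactor_mul_pd_autFactorInv_pow hg i j k)
    have e2 := congrArg (evalAt z) (hν' i j)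
    simp only [map_mul, map_add, map_neg, evalAt_smul] at e1 e2 ⊢
    linear_combination evalAt z ν * e1 + evalAt z (autFactorInv hg ^ k) * e2 +
      evalAt z (pd i j (autFactor g)) * evalAt z ν * evalAt z (autFactorInv hg ^ k) * hσ
  have key := h _ hμ (subConjPow m σ * f)
  rw [maass, maass, slashSmooth, slashSmooth, ← hσ]
  have e3 : subConjPow m σ * (autFactorInv hg ^ k * pullback hg f) =
      ν * autFactorInv hg ^ k * pullback hg (subConjPow m σ * f) := by
    nth_rewrite 1 [hw σ ν hν]
    rw [map_mul]
    ring
  rw [e3, key]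
  nth_rewrite 1 [hw (-σ) ν₂ hν₂]
  rw [map_mul (pullback hg) (subConjPow m (-σ))]
  calc _ = (ν₂ * ν) * (autFactorInv hg ^ (k + 2) * (pullback hg (subConjPow m (-σ)) *
        pullback hg (detOp (pdSystem m) (subConjPow m σ * f)))) := by ring
    _ = _ := by rw [hνν, one_mul]

end

section Generation

variable {g h : Matrix (Fin m ⊕ Fin m) (Fin m ⊕ Fin m) ℝ} (hg : g ∈ symplecticGroup (Fin m) ℝ)
  (hh : h ∈ symplecticGroup (Fin m) ℝ)

theorem slashSmooth_mul (k : ℕ) (f : smoothAlg m) :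
    slashSmooth (mul_mem hg hh) k f = slashSmooth hh k (slashSmooth hg k f) := by
  refine evalAt_ext fun z => ?_
  have h1 : act (mul_mem hg hh) z = act hg (act hh z) := Subtype.ext (moebius_mul hh z.2)
  simp only [slashSmooth, map_mul, map_pow, evalAt_pullback, evalAt_autFactorInv, h1]
  rw [denomR_mul g hh z.2, det_mul, mul_inv, mul_pow]
  change _ = _ * ((denomR g (moebius h z.1)).det⁻¹ ^ k * _)
  ring

theorem maassEquivariant_mul (h₁ : MaassEquivariant hg) (h₂ : MaassEquivariant hh) :
    MaassEquivariant (mul_mem hg hh) := by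
  intro k f
  rw [slashSmooth_mul hg hh, h₂, h₁, slashSmooth_mul hg hh]

theorem maassEquivariant_of_eq {g g' : Matrix (Fin m ⊕ Fin m) (Fin m ⊕ Fin m) ℝ}
    {hg : g ∈ symplecticGroup (Fin m) ℝ} (h : MaassEquivariant hg) (e : g = g')
    (hg' : g' ∈ symplecticGroup (Fin m) ℝ) : MaassEquivariant hg' := by
  subst e; exact h

theorem maassEquivariant_of_lower_eq_zero (hC : g.toBlocks₂₁ = 0) : MaassEquivariant hg :=
  maassEquivariant_of_detOp hg (detOpEquivariant_of_lower_eq_zero hg hC)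

theorem maassEquivariant_partialJ (s : Finset (Fin m)) : MaassEquivariant (partialJ_mem s) := by
  induction s using Finset.induction_on with
  | empty =>
    refine maassEquivariant_of_lower_eq_zero _ ?_
    rw [partialJ, toBlocks_fromBlocks₂₁]
    simp
  | insert o s ho ih =>
    exact maassEquivariant_of_eq (maassEquivariant_mul _ _
      (maassEquivariant_of_detOp _ (detOpEquivariant_partialJ o)) ih) (partialJ_insert ho).symm _

theorem maassEquivariant_J : MaassEquivariant (SymplecticGroup.J_mem (Fin m) ℝ) :=
  maassEquivariant_of_eq (maassEquivariant_partialJ Finset.univ) partialJ_univ _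

theorem maassEquivariant_neg_J :
    MaassEquivariant (SymplecticGroup.neg_mem (SymplecticGroup.J_mem (Fin m) ℝ)) := by
  refine maassEquivariant_of_eq (maassEquivariant_mul _ _ (maassEquivariant_mul _ _
    maassEquivariant_J maassEquivariant_J) maassEquivariant_J) ?_ _
  rw [J_squared, neg_one_mul]

/-- The symplectic matrix of the translation by a symmetric matrix. -/
def translation (X : Matrix (Fin m) (Fin m) ℝ) : Matrix (Fin m ⊕ Fin m) (Fin m ⊕ Fin m) ℝ :=
  fromBlocks 1 X 0 1

theorem translation_mem {X : Matrix (Fin m) (Fin m) ℝ} (hX : X.IsSymm) :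
    translation X ∈ symplecticGroup (Fin m) ℝ := by
  rw [translation, SymplecticGroup.fromBlocks_mem_iff]
  simp [hX.eq]

theorem maassEquivariant_translation {X : Matrix (Fin m) (Fin m) ℝ} (hX : X.IsSymm) :
    MaassEquivariant (translation_mem hX) :=
  maassEquivariant_of_lower_eq_zero _ (toBlocks_fromBlocks₂₁ ..)

theorem translation_mul_neg (X : Matrix (Fin m) (Fin m) ℝ) :
    translation X * translation (-X) = 1 := by
  rw [translation, translation, fromBlocks_multiply]
  simp

theorem I_smul_one_mem : Complex.I • (1 : Matrix (Fin m) (Fin m) ℂ) ∈ upperHalfSpace m := by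
  refine ⟨by rw [Matrix.IsSymm, transpose_smul, transpose_one], ?_⟩
  have : (Complex.I • (1 : Matrix (Fin m) (Fin m) ℂ)).map Complex.im = 1 := by
    ext i j
    by_cases hij : i = j <;> simp [Matrix.one_apply, hij]
  rw [this]
  exact Matrix.PosDef.one

include hg in
/-- `det(tC + D)` is a polynomial in `t` that does not vanish at `t = i`. -/
theorem exists_det_add_ne_zero :
    ∃ t : ℝ, (t • g.toBlocks₂₁ + g.toBlocks₂₂).det ≠ 0 := by
  set C := g.toBlocks₂₁.map Complex.ofReal
  set D := g.toBlocks₂₂.map Complex.ofReal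
  set P : Polynomial ℂ := ((Polynomial.X : Polynomial ℂ) • C.map Polynomial.C +
    D.map Polynomial.C).det with hP
  have heval : ∀ t : ℂ, P.eval t = (t • C + D).det := by
    intro t
    have h := RingHom.map_det (Polynomial.evalRingHom t)
      ((Polynomial.X : Polynomial ℂ) • C.map Polynomial.C + D.map Polynomial.C)
    refine h.trans ?_
    congr 1
    ext i j
    change Polynomial.eval t (Polynomial.X * Polynomial.C (C i j) + Polynomial.C (D i j)) =
      t * C i j + D i j
    rw [Polynomial.eval_add, Polynomial.eval_mul, Polynomial.eval_X, Polynomial.eval_C,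
      Polynomial.eval_C]
  have hP0 : P ≠ 0 := by
    intro h0
    have h1 := heval Complex.I
    rw [h0, Polynomial.eval_zero] at h1
    have h2 := (isUnit_det_denomR hg I_smul_one_mem).ne_zero
    apply h2
    rw [h1, denomR, Matrix.mul_smul, mul_one]
  by_contra! hcon
  apply hP0
  apply Polynomial.eq_zero_of_infinite_isRoot
  refine (Set.infinite_range_of_injective (f := fun n : ℕ => (n : ℂ)) Nat.cast_injective).mono ?_
  rintro _ ⟨n, rfl⟩
  have h1 := congrArg Complex.ofReal (hcon n)
  change P.eval (n : ℂ) = 0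
  rw [heval]
  have h2 := RingHom.map_det Complex.ofRealHom ((n : ℝ) • g.toBlocks₂₁ + g.toBlocks₂₂)
  rw [Complex.ofReal_zero] at h1
  rw [← h1]
  refine Eq.trans ?_ h2.symm
  congr 1
  ext i j
  simp [C, D]

include hg in
theorem lower_blocks_symm : g.toBlocks₂₁ * g.toBlocks₂₂ᵀ = g.toBlocks₂₂ * g.toBlocks₂₁ᵀ := by
  have h := (blocks_rel (SymplecticGroup.transpose_mem hg)).2.1
  have h1 : gᵀ.toBlocks₁₂ = g.toBlocks₂₁ᵀ := rfl
  have h2 : gᵀ.toBlocks₂₂ = g.toBlocks₂₂ᵀ := rfl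
  rwa [h1, h2, transpose_transpose, transpose_transpose] at h

/-- The Maass operator commutes with the whole symplectic group: after a translation the block `D`
becomes invertible, and then the lower left block can be cleared by a conjugate of a
translation. -/
theorem maassEquivariant : MaassEquivariant hg := by
  obtain ⟨t, ht⟩ := exists_det_add_ne_zero hg
  set C := g.toBlocks₂₁ with hC
  set D := g.toBlocks₂₂ with hD
  have ht1 : (t • (1 : Matrix (Fin m) (Fin m) ℝ)).IsSymm := by
    rw [Matrix.IsSymm, transpose_smul, transpose_one]
  have ht2 : (-(t • (1 : Matrix (Fin m) (Fin m) ℝ))).IsSymm := by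
    rw [Matrix.IsSymm, transpose_neg, ht1.eq]
  set D' := t • C + D with hD'
  have hu : IsUnit D'.det := isUnit_iff_ne_zero.2 ht
  have hu' : IsUnit D'ᵀ.det := by rwa [det_transpose]
  have hsym : C * D'ᵀ = D' * Cᵀ := by
    rw [hD', transpose_add, transpose_smul, mul_add, add_mul, lower_blocks_symm hg,
      Matrix.mul_smul, Matrix.smul_mul]
  have hX : (D'⁻¹ * C).IsSymm := by
    rw [Matrix.IsSymm, transpose_mul, transpose_nonsing_inv]
    calc Cᵀ * D'ᵀ⁻¹ = D'⁻¹ * (D' * Cᵀ) * D'ᵀ⁻¹ := by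
          rw [← mul_assoc, Matrix.nonsing_inv_mul _ hu, one_mul]
      _ = D'⁻¹ * C := by
          rw [← hsym, mul_assoc, Matrix.mul_nonsing_inv_cancel_right _ _ hu']
  have hX2 : (-(D'⁻¹ * C)).IsSymm := by rw [Matrix.IsSymm, transpose_neg, hX.eq]
  have hJ := SymplecticGroup.J_mem (Fin m) ℝ
  have hnJ := SymplecticGroup.neg_mem hJ
  have hp := mul_mem (mul_mem (mul_mem (mul_mem hg (translation_mem ht1)) hJ)
    (translation_mem hX)) hnJ
  have hJJ : -J (Fin m) ℝ * J (Fin m) ℝ = 1 := by rw [neg_mul, J_squared, neg_neg]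
  have hJJ' : J (Fin m) ℝ * -J (Fin m) ℝ = 1 := by rw [mul_neg, J_squared, neg_neg]
  -- Conjugation by `J` makes a lower triangular matrix of the translation by `D'⁻¹C`, and this
  -- clears the block `C` of `g` times the translation by `t`.
  have hp0 : (g * translation (t • 1) * J (Fin m) ℝ * translation (D'⁻¹ * C) *
      -J (Fin m) ℝ).toBlocks₂₁ = 0 := by
    have hgb : g = fromBlocks g.toBlocks₁₁ g.toBlocks₁₂ C D := (fromBlocks_toBlocks g).symm
    rw [hgb, translation, translation, J, fromBlocks_neg]
    simp only [fromBlocks_multiply, toBlocks_fromBlocks₂₁]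
    simp only [mul_zero, mul_one, zero_add, add_zero, mul_neg, neg_zero,
      Matrix.mul_smul]
    rw [← hD', ← mul_assoc, Matrix.mul_nonsing_inv _ hu, one_mul]
    simp
  refine maassEquivariant_of_eq (maassEquivariant_mul hp
    (mul_mem (mul_mem (mul_mem hJ (translation_mem hX2)) hnJ) (translation_mem ht2))
    (maassEquivariant_of_lower_eq_zero hp hp0)
    (maassEquivariant_mul _ _ (maassEquivariant_mul _ _ (maassEquivariant_mul _ _
      maassEquivariant_J (maassEquivariant_translation hX2)) maassEquivariant_neg_J)
      (maassEquivariant_translation ht2))) ?_ hg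
  calc _ = g * translation (t • 1) * J (Fin m) ℝ * translation (D'⁻¹ * C) *
        ((-J (Fin m) ℝ * J (Fin m) ℝ) * translation (-(D'⁻¹ * C))) * -J (Fin m) ℝ *
        translation (-(t • 1)) := by simp only [mul_assoc]
    _ = g * translation (t • 1) * J (Fin m) ℝ * (translation (D'⁻¹ * C) *
        translation (-(D'⁻¹ * C))) * -J (Fin m) ℝ *
        translation (-(t • 1)) := by rw [hJJ, one_mul]; simp only [mul_assoc]
    _ = g * translation (t • 1) * (J (Fin m) ℝ * -J (Fin m) ℝ) * translation (-(t • 1)) := by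
        rw [translation_mul_neg, mul_one]; simp only [mul_assoc]
    _ = g := by rw [hJJ', mul_one, mul_assoc, translation_mul_neg, mul_one]

end Generation

/-- The iterated Maass operator on smooth functions. -/
def maassIter (k : ℕ) : ℕ → smoothAlg m → smoothAlg m
  | 0, f => f
  | r + 1, f => maass (k + 2 * r) (maassIter k r f)

theorem maassIter_slashSmooth {g : Matrix (Fin m ⊕ Fin m) (Fin m ⊕ Fin m) ℝ}
    (hg : g ∈ symplecticGroup (Fin m) ℝ) (k r : ℕ) (f : smoothAlg m) :
    maassIter k r (slashSmooth hg k f) = slashSmooth hg (k + 2 * r) (maassIter k r f) := by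
  induction r with
  | zero => rfl
  | succ r ih =>
    change maass _ (maassIter k r _) = _
    rw [ih, maassEquivariant hg]
    rfl

/-! ### Comparison with operators on functions of a matrix -/

theorem wirtinger_eq {F : Matrix (Fin m) (Fin m) ℂ → ℂ} {f : smoothAlg m}
    (hF : ∀ z : upperHalfSpace m, F z.1 = f.1 z) (V : SymIndex m → ℂ) (z : upperHalfSpace m) :
    (1 / 2) * (lineDeriv ℝ F z.1 (ofEntries V) -
      Complex.I * lineDeriv ℝ F z.1 (Complex.I • ofEntries V)) = evalAt z (derivDir V f) := by
  have hz := entries_mem_coordDomain z.2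
  have key : ∀ W, lineDeriv ℝ F z.1 (ofEntries W) = fderiv ℝ (extend f.1) (entries z.1) W := by
    intro W
    rw [← (differentiableAt_extend f hz).lineDeriv_eq_fderiv]
    unfold lineDeriv
    refine Filter.EventuallyEq.deriv_eq ?_
    have hc : Continuous fun t : ℝ => entries z.1 + t • W := by fun_prop
    have hopen : (fun t : ℝ => entries z.1 + t • W) ⁻¹' coordDomain m ∈ nhds (0 : ℝ) :=
      (isOpen_coordDomain.preimage hc).mem_nhds (by simpa using hz)
    filter_upwards [hopen] with t ht
    rw [extend_of_mem f.1 ht, ← hF]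
    change F (z.1 + t • ofEntries W) = F (ofEntries (entries z.1 + t • W))
    rw [ofEntries_add, ofEntries_smul, ofEntries_entries z.2.1]
  rw [← ofEntries_smul, key, key]
  rfl

theorem partialZ_eq {F : Matrix (Fin m) (Fin m) ℂ → ℂ} {f : smoothAlg m}
    (hF : ∀ z : upperHalfSpace m, F z.1 = f.1 z) (i j : Fin m) (z : upperHalfSpace m) :
    partialZ i j F z.1 = (pd i j f).1 z := by
  have h0 : (symUnit i j).IsSymm := by
    rw [symUnit]
    split_ifs with hij
    · rw [Matrix.IsSymm, transpose_single]
    · rw [Matrix.IsSymm, transpose_add, transpose_single, transpose_single, add_comm]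
  have h1 := wirtinger_eq hF (entries (symUnit i j)) z
  rw [ofEntries_entries h0] at h1
  rw [partialZ, wirtinger, h1]
  change _ = wirtDeriv (extend f.1) (symDir i j) (entries z.1)
  have h2 : symDir i j = (if i = j then (1 : ℂ) else 1 / 2) • entries (symUnit i j) := by
    rw [symDir, symUnit]
    split_ifs with hij
    · subst hij
      rw [one_smul]
      congr 1
      ext a b
      simp
      ring
    · rfl
  rw [h2, wirtDeriv_smul_dir]
  rfl

theorem foldr_partialZ_eq {F : Matrix (Fin m) (Fin m) ℂ → ℂ} {f : smoothAlg m}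
    (hF : ∀ z : upperHalfSpace m, F z.1 = f.1 z) (σ : Equiv.Perm (Fin m)) (l : List (Fin m))
    (z : upperHalfSpace m) :
    l.foldr (fun i g => partialZ (σ i) i g) F z.1 =
      (l.foldr (fun i g => pd (σ i) i g) f).1 z := by
  induction l generalizing z with
  | nil => exact hF z
  | cons a l ih => exact partialZ_eq ih _ _ z

theorem detOp_apply {A : Type*} [CommRing A] [Algebra ℂ A] (S : CommDerivations m A) (f : A) :
    detOp S f = ∑ σ : Equiv.Perm (Fin m), ((Equiv.Perm.sign σ : ℤ) : ℂ) •
      (List.finRange m).foldr (fun i g => S.d (σ i) i g) f := by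
  rw [detOp, det_apply', diffOps_sum_apply]
  refine Finset.sum_congr rfl fun σ _ => ?_
  have h1 : (((Equiv.Perm.sign σ : ℤ) : DiffOps S)) =
      algebraMap ℂ (DiffOps S) ((Equiv.Perm.sign σ : ℤ) : ℂ) :=
    (map_intCast (algebraMap ℂ (DiffOps S)) _).symm
  rw [h1, ← Algebra.smul_def]
  change ((Equiv.Perm.sign σ : ℤ) : ℂ) • (∏ i, pdMatrix S (σ i) i).1 f = _
  congr 1
  rw [Fin.prod_univ_def]
  induction List.finRange m with
  | nil => rfl
  | cons a l ih =>
    rw [List.map_cons, List.prod_cons, diffOps_mul_apply, ih]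
    rfl

theorem detPartial_eq {F : Matrix (Fin m) (Fin m) ℂ → ℂ} {f : smoothAlg m}
    (hF : ∀ z : upperHalfSpace m, F z.1 = f.1 z) (z : upperHalfSpace m) :
    detPartial F z.1 = (detOp (pdSystem m) f).1 z := by
  rw [detPartial, detOp_apply]
  change _ = evalAt z _
  rw [map_sum]
  refine Finset.sum_congr rfl fun σ _ => ?_
  rw [evalAt_smul, foldr_partialZ_eq hF]
  rfl

theorem maassOperator_eq {F : Matrix (Fin m) (Fin m) ℂ → ℂ} {f : smoothAlg m}
    (hF : ∀ z : upperHalfSpace m, F z.1 = f.1 z) (k : ℕ) (z : upperHalfSpace m) :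
    maassOperator k F z.1 = (maass k f).1 z := by
  rw [maassOperator, detPartial_eq (f := subConjPow m ((k : ℂ) - ((m : ℂ) + 1) / 2 + 1) * f)
    (fun z => ?_)]
  · change _ = evalAt z (maass k f)
    have h : evalAt z (maass k f) = evalAt z (subConjPow m _) * evalAt z (detOp (pdSystem m) _) :=
      map_mul _ _ _
    rw [h, evalAt_subConjPow, evalAt_apply]
    congr 2
    ring
  · rw [hF]
    change _ = evalAt z (_ * f)
    rw [map_mul, evalAt_subConjPow, evalAt_apply]

/-- On smooth functions the iterated Maass operator is `maassIter`. -/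
theorem iteratedMaass_eq {F : Matrix (Fin m) (Fin m) ℂ → ℂ} {f : smoothAlg m}
    (hF : ∀ z : upperHalfSpace m, F z.1 = f.1 z) (k r : ℕ) (z : upperHalfSpace m) :
    iteratedMaass k r F z.1 = (maassIter k r f).1 z := by
  induction r generalizing z with
  | zero => exact hF z
  | succ r ih => exact maassOperator_eq ih _ z

theorem slash_eq {F : Matrix (Fin m) (Fin m) ℂ → ℂ} {f : smoothAlg m}
    (hF : ∀ z : upperHalfSpace m, F z.1 = f.1 z) (γ : symplecticGroup (Fin m) ℤ) (k : ℕ)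
    (z : upperHalfSpace m) : slash k F γ z.1 = (slashSmooth (toReal_mem γ) k f).1 z := by
  change _ = evalAt z (slashSmooth (toReal_mem γ) k f)
  rw [slashSmooth, map_mul, map_pow, evalAt_autFactorInv, evalAt_pullback, evalAt_apply, ← hF,
    slash, denomR_toReal, inv_pow]
  change _ = _ * F (moebius (toReal γ) z.1)
  rw [moebius, denomR_toReal, numR_toReal]

end

section

/-! ### The Maass operator in terms of `∂_{ij}` and `(2πY)⁻¹` -/

theorem derivation_prod {R A ι : Type*} [CommRing R] [CommRing A] [Algebra R A] [DecidableEq ι]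
    (D : Derivation R A A) (s : Finset ι) (f : ι → A) :
    D (∏ i ∈ s, f i) = ∑ i ∈ s, D (f i) * ∏ j ∈ s.erase i, f j := by
  induction s using Finset.induction_on with
  | empty => simp
  | insert a s ha ih =>
    rw [Finset.prod_insert ha, Derivation.leibniz, ih, Finset.sum_insert ha,
      Finset.erase_insert ha, smul_eq_mul, smul_eq_mul, Finset.mul_sum, add_comm,
      mul_comm (∏ i ∈ s, f i)]
    congr 1
    refine Finset.sum_congr rfl fun i hi => ?_
    have hia : a ≠ i := fun h => ha (h ▸ hi)
    rw [Finset.erase_insert_of_ne hia, Finset.prod_insert (by simp [ha])]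
    ring

/-- Jacobi's formula for the derivative of a determinant. -/
theorem derivation_det {R A : Type*} [CommRing R] [CommRing A] [Algebra R A]
    (D : Derivation R A A) (M : Matrix (Fin m) (Fin m) A) :
    D M.det = (M.adjugate * M.map D).trace := by
  have h1 : D M.det = ∑ i, (M.updateCol i fun k => D (M k i)).det := by
    simp only [det_apply']
    rw [map_sum, Finset.sum_comm]
    refine Finset.sum_congr rfl fun σ _ => ?_
    rw [Derivation.leibniz, Derivation.map_intCast, smul_zero, add_zero, smul_eq_mul,
      derivation_prod, Finset.mul_sum]
    refine Finset.sum_congr rfl fun i _ => ?_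
    congr 1
    rw [← Finset.mul_prod_erase _ _ (Finset.mem_univ i), updateCol_self]
    congr 1
    refine Finset.prod_congr rfl fun j hj => ?_
    rw [updateCol_ne (Finset.ne_of_mem_erase hj)]
  rw [h1, trace]
  refine Finset.sum_congr rfl fun i _ => ?_
  rw [← cramer_apply, cramer_eq_adjugate_mulVec]
  rfl

theorem det_subConjMatrix_mul : (subConjMatrix m).det * subConjPow m (-1) = 1 :=
  evalAt_ext fun z => by
    rw [map_mul, evalAt_subConjPow, evalAt_det_subConjMatrix, Complex.cpow_neg_one,
      mul_inv_cancel₀ (detSubConj_ne_zero z), map_one]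

theorem isUnit_det_subConjMatrix : IsUnit (subConjMatrix m).det :=
  IsUnit.of_mul_eq_one _ det_subConjMatrix_mul

theorem subConjMatrix_isSymm : (subConjMatrix m).IsSymm := by
  refine evalAt_ext_matrix fun z => ?_
  have h := z.2.1
  change (z.1 - z.1.map (starRingEnd ℂ))ᵀ = z.1 - z.1.map (starRingEnd ℂ)
  rw [transpose_sub, h.eq, ← transpose_map, h.eq]

variable (m) in
/-- The matrix `(Z - Z̄)⁻¹`. -/
def subConjInv : Matrix (Fin m) (Fin m) (smoothAlg m) := (subConjMatrix m)⁻¹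

theorem subConjInv_isSymm : (subConjInv m).IsSymm := by
  rw [subConjInv, Matrix.IsSymm, transpose_nonsing_inv, subConjMatrix_isSymm.eq]

theorem subConjInv_symm (a b : Fin m) : subConjInv m a b = subConjInv m b a :=
  subConjInv_isSymm.apply b a

theorem map_evalAt_subConjInv (z : upperHalfSpace m) :
    (subConjInv m).map (evalAt z) = (z.1 - z.1.map (starRingEnd ℂ))⁻¹ := by
  refine (Matrix.inv_eq_left_inv ?_).symm
  rw [← subConjMatrix_map_evalAt, ← map_evalAt_mul, subConjInv,
    nonsing_inv_mul _ isUnit_det_subConjMatrix, Matrix.map_one _ (map_zero _) (map_one _)]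

theorem pd_subConjMatrix (i j : Fin m) : (subConjMatrix m).map (pd i j) =
    (1 / 2 : ℂ) • (Matrix.single i j 1 + Matrix.single j i 1) := by
  rw [pd, map_derivDir_subConjMatrix, ofEntries_symDir]
  refine evalAt_ext_matrix fun z => Matrix.ext fun a b => ?_
  change (1 / 2 : ℂ) * (Matrix.single i j (1 : ℂ) a b + Matrix.single j i (1 : ℂ) a b) =
    (1 / 2 : ℂ) * (evalAt z (Matrix.single i j 1 a b) + evalAt z (Matrix.single j i 1 a b))
  simp only [Matrix.single_apply, apply_ite (evalAt z), map_one, map_zero]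

theorem pd_det_subConjMatrix (i j : Fin m) :
    pd i j (subConjMatrix m).det = (subConjMatrix m).det * subConjInv m i j := by
  have h0 : (subConjMatrix m).adjugate = (subConjMatrix m).det • subConjInv m := by
    have h := congrArg (· * subConjInv m) (adjugate_mul (subConjMatrix m))
    simp only [mul_assoc] at h
    rw [subConjInv, mul_nonsing_inv _ isUnit_det_subConjMatrix, mul_one, Matrix.smul_mul,
      one_mul] at h
    exact h
  rw [derivation_det, pd_subConjMatrix, h0, Matrix.mul_smul, Matrix.smul_mul, trace_smul,
    trace_smul, Matrix.mul_add, trace_add, Matrix.trace_mul_single, Matrix.trace_mul_single,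
    subConjInv_symm j i]
  refine evalAt_ext fun z => ?_
  rw [evalAt_smul]
  simp only [smul_eq_mul, map_mul, map_add, MulOpposite.op_one, one_smul]
  ring

theorem pd_subConjPow (σ : ℂ) (i j : Fin m) :
    pd i j (subConjPow m σ) = σ • (subConjInv m i j * subConjPow m σ) := by
  have h := derivDir_subConjPow (m := m) σ (symDir i j)
  have h2 : derivDir (symDir i j) (subConjMatrix m).det = _ := pd_det_subConjMatrix i j
  rw [h2] at h
  refine evalAt_ext fun z => ?_
  have h3 := congrArg (evalAt z) h
  simp only [map_mul, evalAt_smul] at h3 ⊢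
  apply mul_left_cancel₀ ((evalAt_det_subConjMatrix z).trans_ne (detSubConj_ne_zero z))
  rw [pd, h3]
  ring

/-- The derivative of the inverse matrix: `∂M⁻¹ = -M⁻¹ (∂M) M⁻¹`. -/
theorem pd_subConjInv (i j a b : Fin m) : pd i j (subConjInv m a b) =
    -((1 / 2 : ℂ) • (subConjInv m a i * subConjInv m j b + subConjInv m a j * subConjInv m i b)) := by
  have h := congrArg (fun M : Matrix _ _ _ => M.map (pd i j))
    (mul_nonsing_inv _ (isUnit_det_subConjMatrix (m := m)))
  rw [map_derivation_mul, pd_subConjMatrix] at h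
  have h1 : (1 : Matrix (Fin m) (Fin m) (smoothAlg m)).map (pd i j) = 0 := by
    ext a b
    by_cases hab : a = b <;> simp [hab]
  rw [h1] at h
  have h2 := congrArg (subConjInv m * ·) (eq_neg_of_add_eq_zero_right h)
  simp only [← mul_assoc] at h2
  have h3 : subConjInv m * subConjMatrix m = 1 := nonsing_inv_mul _ isUnit_det_subConjMatrix
  rw [h3, one_mul] at h2
  have h4 := congr_fun (congr_fun h2 a) b
  refine Eq.trans h4 ?_
  have h5 : ∀ i j : Fin m, (subConjInv m * Matrix.single i j (1 : smoothAlg m) * subConjInv m) a b =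
      subConjInv m a i * subConjInv m j b := by
    intro i j
    simp [Matrix.mul_apply, Matrix.single_apply, ite_and]
  refine evalAt_ext fun z => ?_
  change evalAt z ((subConjInv m * -((1 / 2 : ℂ) • (Matrix.single i j (1 : smoothAlg m) +
    Matrix.single j i (1 : smoothAlg m)) * subConjInv m)) a b) = _
  rw [Matrix.mul_neg, Matrix.smul_mul, Matrix.mul_smul, ← mul_assoc, Matrix.mul_add,
    Matrix.add_mul, Matrix.neg_apply, map_neg, map_neg, Matrix.smul_apply, evalAt_smul,
    evalAt_smul, Matrix.add_apply, h5, h5]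

/-- The entries of `(2πY)⁻¹`. -/
def imInv (a b : Fin m) : smoothAlg m := (Complex.I / Real.pi) • subConjInv m a b

theorem evalAt_imInv (z : upperHalfSpace m) (a b : Fin m) :
    evalAt z (imInv a b) = (((2 * Real.pi) • z.1.map Complex.im)⁻¹ a b : ℝ) := by
  have h0 : z.1 - z.1.map (starRingEnd ℂ) =
      (Complex.I / Real.pi) • ((2 * Real.pi) • z.1.map Complex.im).map Complex.ofReal := by
    ext i j
    have : (Real.pi : ℂ) ≠ 0 := by exact_mod_cast Real.pi_ne_zero
    change z.1 i j - (starRingEnd ℂ) (z.1 i j) =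
      Complex.I / Real.pi * ((2 * Real.pi * (z.1 i j).im : ℝ) : ℂ)
    rw [Complex.sub_conj]
    push_cast
    field_simp
  set Y := (2 * Real.pi) • z.1.map Complex.im with hY
  have hYp : Y.PosDef := z.2.2.smul (by positivity)
  have h1 : (Complex.I / Real.pi) • (z.1 - z.1.map (starRingEnd ℂ))⁻¹ =
      Y⁻¹.map Complex.ofReal := by
    have h2 : (z.1 - z.1.map (starRingEnd ℂ))⁻¹ =
        (Complex.I / Real.pi : ℂ)⁻¹ • Y⁻¹.map Complex.ofReal := by
      refine Matrix.inv_eq_left_inv ?_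
      have h3 : (Complex.I / Real.pi : ℂ) ≠ 0 :=
        div_ne_zero Complex.I_ne_zero (by exact_mod_cast Real.pi_ne_zero)
      have h4 : Y⁻¹.map Complex.ofReal * Y.map Complex.ofReal = 1 := by
        have := congrArg (fun M : Matrix _ _ ℝ => M.map Complex.ofRealHom)
          (nonsing_inv_mul _ (isUnit_iff_ne_zero.2 hYp.det_pos.ne'))
        rw [Matrix.map_mul, Matrix.map_one _ (map_zero _) (map_one _)] at this
        exact this
      rw [h0, Matrix.smul_mul, Matrix.mul_smul, h4, smul_smul, inv_mul_cancel₀ h3, one_smul]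
    rw [h2, smul_smul, mul_inv_cancel₀, one_smul]
    exact div_ne_zero Complex.I_ne_zero (by exact_mod_cast Real.pi_ne_zero)
  rw [← map_evalAt_subConjInv] at h1
  exact congr_fun (congr_fun h1 a) b

/-- On the entries of `(2πY)⁻¹` the operators `π⁻¹ ∂_{ij}` are quadratic with coefficient `i/2`. -/
theorem pd_imInv (i j a b : Fin m) : (Real.pi : ℂ)⁻¹ • pd i j (imInv a b) =
    (Complex.I / 2) • (imInv a i * imInv j b + imInv a j * imInv i b) := by
  refine evalAt_ext fun z => ?_
  rw [imInv, Derivation.map_smul, pd_subConjInv]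
  simp only [imInv, evalAt_smul, map_neg, map_add, map_mul]
  have : (Real.pi : ℂ) ≠ 0 := by exact_mod_cast Real.pi_ne_zero
  field_simp
  linear_combination (-(evalAt z (subConjInv m a i) * evalAt z (subConjInv m j b) +
    evalAt z (subConjInv m a j) * evalAt z (subConjInv m i b))) * Complex.I_sq

/-- The operator `π⁻¹ det(Z - Z̄) ^ {-σ} ∘ ∂_{ij} ∘ det(Z - Z̄) ^ σ`, see `raising_eq`. -/
def raising (σ : ℂ) (i j : Fin m) (f : smoothAlg m) : smoothAlg m :=
  (Real.pi : ℂ)⁻¹ • pd i j f - (Complex.I * σ) • (imInv i j * f)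

theorem raising_eq (σ : ℂ) (i j : Fin m) (f : smoothAlg m) :
    pd i j (subConjPow m σ * f) = (Real.pi : ℂ) • (subConjPow m σ * raising σ i j f) := by
  refine evalAt_ext fun z => ?_
  rw [Derivation.leibniz, pd_subConjPow, raising, imInv]
  simp only [smul_eq_mul, evalAt_smul, map_sub, map_add, map_mul]
  have : (Real.pi : ℂ) ≠ 0 := by exact_mod_cast Real.pi_ne_zero
  field_simp
  linear_combination (evalAt z (subConjPow m σ)) * σ * evalAt z f *
    evalAt z (subConjInv m i j) * Complex.I_sq

theorem foldr_pd_eq (σ : ℂ) (τ : Equiv.Perm (Fin m)) (l : List (Fin m)) (f : smoothAlg m) :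
    l.foldr (fun i g => pd (τ i) i g) (subConjPow m σ * f) = (Real.pi : ℂ) ^ l.length •
      (subConjPow m σ * l.foldr (fun i g => raising σ (τ i) i g) f) := by
  induction l with
  | nil => simp
  | cons a l ih =>
    rw [List.foldr_cons, ih, Derivation.map_smul, raising_eq, smul_smul, ← pow_succ]
    rfl

/-- The normalized Maass operator is the determinant of the operators `raising`. -/
theorem pi_inv_pow_smul_maass (k : ℕ) (f : smoothAlg m) :
    ((Real.pi : ℂ) ^ m)⁻¹ • maass k f = ∑ τ : Equiv.Perm (Fin m), ((Equiv.Perm.sign τ : ℤ) : ℂ) •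
      (List.finRange m).foldr
        (fun i g => raising ((k : ℂ) - ((m : ℂ) + 1) / 2 + 1) (τ i) i g) f := by
  rw [maass]
  set σ : ℂ := (k : ℂ) - ((m : ℂ) + 1) / 2 + 1
  have hpi : (Real.pi : ℂ) ^ m ≠ 0 := pow_ne_zero _ (by exact_mod_cast Real.pi_ne_zero)
  have h1 : detOp (pdSystem m) (subConjPow m σ * f) =
      ∑ τ : Equiv.Perm (Fin m), ((Equiv.Perm.sign τ : ℤ) : ℂ) • (Real.pi : ℂ) ^ m •
      (subConjPow m σ * (List.finRange m).foldr (fun i g => raising σ (τ i) i g) f) := by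
    rw [detOp_apply]
    refine Finset.sum_congr rfl fun τ _ => ?_
    refine congrArg _ ((foldr_pd_eq σ τ _ f).trans ?_)
    rw [List.length_finRange]
  refine evalAt_ext fun z => ?_
  have h2 : evalAt z (subConjPow m (-σ)) * evalAt z (subConjPow m σ) = 1 := by
    rw [← map_mul, subConjPow_mul_neg, map_one]
  rw [h1, evalAt_smul, map_mul]
  simp only [map_sum, evalAt_smul, map_mul, Finset.mul_sum]
  refine Finset.sum_congr rfl fun τ _ => ?_
  field_simp
  linear_combination evalAt z ((List.finRange m).foldr
    (fun i g => raising σ (τ i) i g) f) * h2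

/-- A group of functions that is stable under the operators `raising` is stable under the
normalized Maass operators. -/
theorem pi_inv_pow_smul_maass_mem {A : AddSubgroup (smoothAlg m)} (k : ℕ)
    (hA : ∀ i j, ∀ f ∈ A, raising ((k : ℂ) - ((m : ℂ) + 1) / 2 + 1) i j f ∈ A) {f : smoothAlg m}
    (hf : f ∈ A) : ((Real.pi : ℂ) ^ m)⁻¹ • maass k f ∈ A := by
  rw [pi_inv_pow_smul_maass]
  refine sum_mem fun τ _ => ?_
  rw [Int.cast_smul_eq_zsmul]
  refine A.zsmul_mem ?_ _
  induction List.finRange m with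
  | nil => exact hf
  | cons a l ih => exact hA _ _ _ ih

end

/-! ### Fourier series on the Siegel upper half space -/

/-- The character `Z ↦ e^{2πi tr(SZ)}`. -/
def expTr (S : FourierIndex m) (Z : Matrix (Fin m) (Fin m) ℂ) : ℂ :=
  Complex.exp (2 * Real.pi * Complex.I * (S.1.map (Rat.cast : ℚ → ℂ) * Z).trace)

theorem trace_mul_posSemidef_nonneg {S P : Matrix (Fin m) (Fin m) ℝ} (hS : S.PosSemidef)
    (hP : P.PosSemidef) : 0 ≤ (S * P).trace := by
  open scoped MatrixOrder in
  obtain ⟨B, hB⟩ := CStarAlgebra.nonneg_iff_eq_star_mul_self.mp hP.nonneg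
  rw [hB, star_eq_conjTranspose, ← mul_assoc, trace_mul_comm, ← mul_assoc]
  exact (hS.mul_mul_conjTranspose_same B).trace_nonneg

theorem im_trace (S : FourierIndex m) (Z : Matrix (Fin m) (Fin m) ℂ) :
    (S.1.map (Rat.cast : ℚ → ℂ) * Z).trace.im =
      (S.1.map (Rat.cast : ℚ → ℝ) * Z.map Complex.im).trace := by
  simp only [trace, diag_apply, Matrix.mul_apply, Complex.im_sum, map_apply]
  refine Finset.sum_congr rfl fun i _ => Finset.sum_congr rfl fun j _ => ?_
  rw [Complex.mul_im, Complex.ratCast_re, Complex.ratCast_im, zero_mul, add_zero]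

theorem norm_expTr (S : FourierIndex m) (Z : Matrix (Fin m) (Fin m) ℂ) :
    ‖expTr S Z‖ =
      Real.exp (-(2 * Real.pi * (S.1.map (Rat.cast : ℚ → ℝ) * Z.map Complex.im).trace)) := by
  rw [expTr, Complex.norm_exp, ← im_trace]
  congr 1
  set t := (S.1.map (Rat.cast : ℚ → ℂ) * Z).trace
  simp [mul_assoc]

theorem abs_entry_le_trace {S : Matrix (Fin m) (Fin m) ℝ} (hS : S.PosSemidef) (i j : Fin m) :
    |S i j| ≤ S.trace := by
  have hd : ∀ i, 0 ≤ S i i := fun i => hS.diag_nonneg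
  have hle : ∀ i, S i i ≤ S.trace := fun i =>
    Finset.single_le_sum (f := fun i => S i i) (fun i _ => hd i) (Finset.mem_univ i)
  by_cases hij : i = j
  · subst hij
    rw [abs_of_nonneg (hd i)]
    exact hle i
  · have hsum : S i i + S j j ≤ S.trace := by
      have := Finset.sum_le_sum_of_subset_of_nonneg (Finset.subset_univ {i, j})
        (fun k _ _ => hd k)
      rwa [Finset.sum_pair hij] at this
    have hsym : S j i = S i j := by
      have := hS.isHermitian.apply i j
      simpa using this
    have h1 := hS.dotProduct_mulVec_nonneg (Pi.single i 1 + Pi.single j 1)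
    have h2 := hS.dotProduct_mulVec_nonneg (Pi.single i 1 - Pi.single j 1)
    simp [mulVec_add, mulVec_sub, add_dotProduct, sub_dotProduct, hsym] at h1 h2
    have h3 := hle i
    rw [abs_le]
    constructor <;> linarith

/-- Near a positive definite matrix, the traces `tr(SW)` with positive semidefinite `S` are bounded
below by `tr(S)` up to the trace against a fixed positive definite matrix. -/
theorem exists_trace_lower_bound {Y : Matrix (Fin m) (Fin m) ℝ} (hY : Y.PosDef) :
    ∃ δ > 0, ∀ S W : Matrix (Fin m) (Fin m) ℝ, S.PosSemidef → W.IsSymm →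
      (∀ i j, |W i j - Y i j| ≤ δ) →
      (S * ((1 / 2 : ℝ) • Y)).trace + δ * S.trace ≤ (S * W).trace := by
  have hY2 : ((1 / 2 : ℝ) • Y).PosDef := hY.smul (by norm_num)
  obtain ⟨δ, hδ, h⟩ := exists_pos_sub_posDef hY2
  refine ⟨δ, hδ, fun S W hS hW hWY => ?_⟩
  have h1 := h (W - (1 / 2 : ℝ) • Y) (hW.sub (isSymm_of_posDef hY2)) fun i j => by
    refine le_of_eq_of_le ?_ (hWY i j)
    congr 1
    simp only [Matrix.sub_apply, Matrix.smul_apply, smul_eq_mul]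
    ring
  have h2 := trace_mul_posSemidef_nonneg hS h1.posSemidef
  rw [Matrix.mul_sub, Matrix.mul_sub, trace_sub, trace_sub, Matrix.mul_smul S δ, mul_one,
    trace_smul, smul_eq_mul] at h2
  linarith

/-- The linear form `u ↦ tr(SZ)` in the coordinates `u` of `Z`. -/
def traceForm (S : FourierIndex m) : (SymIndex m → ℂ) →L[ℂ] ℂ :=
  ∑ i, ∑ j, (S.1 i j : ℂ) • ContinuousLinearMap.proj (R := ℂ) (φ := fun _ : SymIndex m => ℂ)
    ⟨(min j i, max j i), min_le_max⟩

theorem traceForm_apply (S : FourierIndex m) (u : SymIndex m → ℂ) :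
    traceForm S u = (S.1.map (Rat.cast : ℚ → ℂ) * ofEntries u).trace := by
  simp only [traceForm, trace, diag_apply, Matrix.mul_apply, map_apply]
  simp [ofEntries_apply]

theorem norm_traceForm_le (S : FourierIndex m) :
    ‖traceForm S‖ ≤ m ^ 2 * (S.1.map (Rat.cast : ℚ → ℝ)).trace := by
  have h : ∀ i j, ‖(S.1 i j : ℂ) • (ContinuousLinearMap.proj (R := ℂ)
      (φ := fun _ : SymIndex m => ℂ) ⟨(min j i, max j i), min_le_max⟩)‖ ≤
        (S.1.map (Rat.cast : ℚ → ℝ)).trace := by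
    intro i j
    rw [norm_smul]
    have h1 : ‖(S.1 i j : ℂ)‖ = |((S.1 i j : ℚ) : ℝ)| := by
      rw [← Complex.ofReal_ratCast, Complex.norm_real, Real.norm_eq_abs]
    have h2 := abs_entry_le_trace S.2.2 i j
    have h3 : ‖(ContinuousLinearMap.proj (R := ℂ) (φ := fun _ : SymIndex m => ℂ)
        ⟨(min j i, max j i), min_le_max⟩)‖ ≤ 1 :=
      ContinuousLinearMap.opNorm_le_bound _ zero_le_one fun u => by
        rw [one_mul]; exact norm_le_pi_norm u _
    rw [h1]
    calc _ ≤ |((S.1 i j : ℚ) : ℝ)| * 1 := by gcongr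
      _ ≤ _ := by rw [mul_one]; exact h2
  calc ‖traceForm S‖ ≤ ∑ i : Fin m, ∑ j : Fin m, (S.1.map (Rat.cast : ℚ → ℝ)).trace :=
        norm_sum_le_of_le _ fun i _ => norm_sum_le_of_le _ fun j _ => h i j
    _ = _ := by simp; ring

theorem hasFDerivAt_expTr (S : FourierIndex m) (u : SymIndex m → ℂ) :
    HasFDerivAt (fun u => expTr S (ofEntries u))
      ((2 * Real.pi * Complex.I * expTr S (ofEntries u)) • traceForm S) u := by
  have h := (((traceForm S).hasFDerivAt (x := u)).const_mul (2 * Real.pi * Complex.I)).cexp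
  simp only [traceForm_apply] at h
  refine h.congr_fderiv ?_
  rw [smul_smul, mul_comm]
  rfl

/-- Termwise differentiation of an absolutely convergent Fourier series. -/
theorem hasFDerivAt_tsum_expTr {c : FourierIndex m → ℂ}
    (hc : ∀ z : upperHalfSpace m, Summable fun S => c S * expTr S z.1) {u : SymIndex m → ℂ}
    (hu : u ∈ coordDomain m) :
    HasFDerivAt (fun u => ∑' S, c S * expTr S (ofEntries u))
      (∑' S, (c S * (2 * Real.pi * Complex.I * expTr S (ofEntries u))) • traceForm S) u ∧
    Summable fun S => (c S * (2 * Real.pi * Complex.I * expTr S (ofEntries u))) • traceForm S := by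
  obtain ⟨δ, hδ, h⟩ := exists_trace_lower_bound hu.2
  set Y := (ofEntries u).map Complex.im with hY
  have hz2 : Complex.I • ((1 / 2 : ℝ) • Y).map Complex.ofReal ∈ upperHalfSpace m := by
    have h1 : (Complex.I • ((1 / 2 : ℝ) • Y).map Complex.ofReal).map Complex.im =
        (1 / 2 : ℝ) • Y := by ext i j; simp
    refine ⟨?_, by rw [h1]; exact hu.2.smul (by norm_num)⟩
    exact ((((map_im_isSymm hu.1).smul (1 / 2 : ℝ)).map Complex.ofReal).smul Complex.I)
  have hsum := (hc ⟨_, hz2⟩).norm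
  -- Near `u` the terms are dominated by those of the series at `iY/2`: the decay that is gained
  -- absorbs the factor `tr S` that bounds `traceForm S`.
  have hbound : ∀ S, ∀ v ∈ Metric.ball u δ,
      ‖(c S * (2 * Real.pi * Complex.I * expTr S (ofEntries v))) • traceForm S‖ ≤
        m ^ 2 / δ * ‖c S * expTr S (Complex.I • ((1 / 2 : ℝ) • Y).map Complex.ofReal)‖ := by
    intro S v hv
    have h2 : (Complex.I • ((1 / 2 : ℝ) • Y).map Complex.ofReal).map Complex.im =
        (1 / 2 : ℝ) • Y := by ext i j; simp
    have h1 := h (S.1.map (Rat.cast : ℚ → ℝ)) ((ofEntries v).map Complex.im) S.2.2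
      (map_im_isSymm (ofEntries_isSymm v)) fun i j => by
        rw [hY, ofEntries_im, ofEntries_im, ← Complex.sub_im]
        refine (Complex.abs_im_le_norm _).trans ?_
        have := (dist_le_pi_dist v u ⟨(min i j, max i j), min_le_max⟩).trans
          (Metric.mem_ball.1 hv).le
        rwa [dist_eq_norm] at this
    rw [norm_smul, norm_mul, norm_mul, norm_mul (c S), norm_expTr, norm_expTr, h2]
    set T := (S.1.map (Rat.cast : ℚ → ℝ)).trace with hT
    set A := (S.1.map (Rat.cast : ℚ → ℝ) * ((1 / 2 : ℝ) • Y)).trace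
    set B := (S.1.map (Rat.cast : ℚ → ℝ) * (ofEntries v).map Complex.im).trace
    have hpi := Real.pi_pos
    have hnorm : ‖(2 * Real.pi * Complex.I : ℂ)‖ = 2 * Real.pi := by
      simp [abs_of_pos hpi]
    rw [hnorm]
    have e1 : Real.exp (-(2 * Real.pi * B)) ≤
        Real.exp (-(2 * Real.pi * A)) * Real.exp (-(2 * Real.pi * δ * T)) := by
      rw [← Real.exp_add, Real.exp_le_exp]
      nlinarith
    have e2 : 2 * Real.pi * δ * T * Real.exp (-(2 * Real.pi * δ * T)) ≤ 1 := by
      have := Real.add_one_le_exp (2 * Real.pi * δ * T)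
      rw [Real.exp_neg, ← div_eq_mul_inv, div_le_one (Real.exp_pos _)]
      linarith
    have hT0 : 0 ≤ T := S.2.2.trace_nonneg
    calc ‖c S‖ * (2 * Real.pi * Real.exp (-(2 * Real.pi * B))) * ‖traceForm S‖
        ≤ ‖c S‖ * (2 * Real.pi * (Real.exp (-(2 * Real.pi * A)) *
          Real.exp (-(2 * Real.pi * δ * T)))) * (m ^ 2 * T) := by
          gcongr
          exact norm_traceForm_le S
      _ = m ^ 2 / δ * (‖c S‖ * Real.exp (-(2 * Real.pi * A))) *
          (2 * Real.pi * δ * T * Real.exp (-(2 * Real.pi * δ * T))) := by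
          field_simp
      _ ≤ m ^ 2 / δ * (‖c S‖ * Real.exp (-(2 * Real.pi * A))) * 1 := by gcongr
      _ = _ := mul_one _
  have hsum' := hsum.mul_left ((m : ℝ) ^ 2 / δ)
  refine ⟨?_, Summable.of_norm_bounded hsum' fun S => hbound S u (Metric.mem_ball_self hδ)⟩
  refine hasFDerivAt_tsum_of_isPreconnected hsum' Metric.isOpen_ball
    (convex_ball u δ).isPreconnected (fun S v _ => ?_) hbound (Metric.mem_ball_self hδ)
    (hc ⟨_, hu⟩) (Metric.mem_ball_self hδ)
  exact ((hasFDerivAt_expTr S v).const_mul (c S)).congr_fderiv (smul_smul _ _ _)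

/-- The derivative of a Fourier series in the direction `V`. -/
theorem hasSum_fderiv_expTr {c : FourierIndex m → ℂ}
    (hc : ∀ z : upperHalfSpace m, Summable fun S => c S * expTr S z.1) {u : SymIndex m → ℂ}
    (hu : u ∈ coordDomain m) (V : SymIndex m → ℂ) :
    HasSum (fun S => (c S * (2 * Real.pi * Complex.I * traceForm S V)) * expTr S (ofEntries u))
      (fderiv ℂ (fun u => ∑' S, c S * expTr S (ofEntries u)) u V) := by
  obtain ⟨h1, h2⟩ := hasFDerivAt_tsum_expTr hc hu
  rw [h1.fderiv]
  have h3 := (ContinuousLinearMap.apply ℂ ℂ V).hasSum h2.hasSum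
  refine h3.congr_fun ?_
  intro S
  simp
  ring

/-- Directional derivatives of a convergent Fourier series are again such series, so the order of
smoothness can be raised by induction, for all coefficients at once. -/
theorem contDiffOn_tsum_expTr (n : ℕ) {c : FourierIndex m → ℂ}
    (hc : ∀ z : upperHalfSpace m, Summable fun S => c S * expTr S z.1) :
    ContDiffOn ℂ n (fun u => ∑' S, c S * expTr S (ofEntries u)) (coordDomain m) := by
  have hd : ∀ c : FourierIndex m → ℂ,
      (∀ z : upperHalfSpace m, Summable fun S => c S * expTr S z.1) →
      DifferentiableOn ℂ (fun u => ∑' S, c S * expTr S (ofEntries u)) (coordDomain m) :=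
    fun c hc u hu => (hasFDerivAt_tsum_expTr hc hu).1.differentiableAt.differentiableWithinAt
  induction n generalizing c with
  | zero => exact contDiffOn_zero.2 (hd c hc).continuousOn
  | succ n ih =>
    push_cast
    rw [contDiffOn_succ_iff_fderiv_of_isOpen isOpen_coordDomain]
    refine ⟨hd c hc, fun h => absurd h (by simp), ?_⟩
    rw [contDiffOn_clm_apply]
    intro V
    have hc' : ∀ z : upperHalfSpace m, Summable fun S =>
        (c S * (2 * Real.pi * Complex.I * traceForm S V)) * expTr S z.1 := by
      intro z
      have h := (hasSum_fderiv_expTr hc (entries_mem_coordDomain z.2) V).summable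
      rwa [ofEntries_entries z.2.1] at h
    refine (ih hc').congr fun u hu => ?_
    exact (hasSum_fderiv_expTr hc hu V).tsum_eq.symm

theorem tsum_expTr_mem_holAlg {c : FourierIndex m → ℂ}
    (hc : ∀ z : upperHalfSpace m, Summable fun S => c S * expTr S z.1) :
    (fun u => ∑' S, c S * expTr S (ofEntries u)) ∈ holAlg m :=
  contDiffOn_infty.2 fun n => contDiffOn_tsum_expTr n hc

/-- A function that is given by a Fourier series is smooth. -/
theorem exists_smooth_of_hasSum {F : Matrix (Fin m) (Fin m) ℂ → ℂ} {c : FourierIndex m → ℂ}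
    (hF : ∀ z : upperHalfSpace m, HasSum (fun S => c S * expTr S z.1) (F z.1)) :
    ∃ f : smoothAlg m, ∀ z : upperHalfSpace m, F z.1 = f.1 z :=
  ⟨⟨fun z => F z.1, mem_smoothAlg_of_holAlg (tsum_expTr_mem_holAlg fun z => (hF z).summable)
    fun _ hu => (hF ⟨_, hu⟩).tsum_eq.symm⟩, fun _ => rfl⟩

/-! ### Nearly holomorphic Fourier series with coefficients in a ring -/

/-- The function is given by a Fourier series whose coefficients, and the entries of whose
frequencies, lie in `R`. -/
def IsFourierSeries (R : Subring ℂ) (g : smoothAlg m) : Prop :=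
  ∃ c : FourierIndex m → ℂ, (∀ S, c S ∈ R) ∧
    (∀ S, c S ≠ 0 → ∀ i j, ((S.1 i j : ℚ) : ℂ) ∈ R) ∧
    ∀ z : upperHalfSpace m, HasSum (fun S => c S * expTr S z.1) (g.1 z)

theorem traceForm_symDir (S : FourierIndex m) (i j : Fin m) : traceForm S (symDir i j) = S.1 i j := by
  rw [traceForm_apply, ofEntries_symDir, Matrix.mul_smul, trace_smul, Matrix.mul_add, trace_add,
    Matrix.trace_mul_single, Matrix.trace_mul_single]
  simp only [map_apply, MulOpposite.op_one, one_smul, smul_eq_mul]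
  rw [S.2.1.apply i j]
  ring

theorem pd_apply_of_hasSum {g : smoothAlg m} {c : FourierIndex m → ℂ}
    (hg : ∀ z : upperHalfSpace m, HasSum (fun S => c S * expTr S z.1) (g.1 z)) (i j : Fin m)
    (z : upperHalfSpace m) :
    HasSum (fun S => (c S * (2 * Real.pi * Complex.I * (S.1 i j : ℂ))) * expTr S z.1)
      ((pd i j g).1 z) := by
  have h1 := hasSum_fderiv_expTr (fun z => (hg z).summable) (entries_mem_coordDomain z.2)
    (symDir i j)
  simp only [traceForm_symDir, ofEntries_entries z.2.1] at h1
  rwa [pd, derivDir_holAlg (tsum_expTr_mem_holAlg fun z => (hg z).summable)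
    fun u hu => (hg ⟨_, hu⟩).tsum_eq.symm]

theorem IsFourierSeries.pd {R : Subring ℂ} (hI : Complex.I ∈ R) {g : smoothAlg m}
    (hg : IsFourierSeries R g) (i j : Fin m) :
    IsFourierSeries R ((Real.pi : ℂ)⁻¹ • pd i j g) := by
  obtain ⟨c, hc, hS, hsum⟩ := hg
  refine ⟨fun S => c S * (2 * Complex.I * S.1 i j), fun S => ?_, fun S h => ?_, fun z => ?_⟩
  -- The entries of `S` are known to lie in `R` only where the coefficient does not vanish.
  · by_cases h : c S = 0
    · have e : c S * (2 * Complex.I * (S.1 i j : ℂ)) = 0 := by rw [h, zero_mul]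
      exact (congrArg (· ∈ R) e).mpr R.zero_mem
    · exact R.mul_mem (hc S) (R.mul_mem (R.mul_mem (ofNat_mem R 2) hI) (hS S h i j))
  · exact hS S (left_ne_zero_of_mul h)
  · have h := (pd_apply_of_hasSum hsum i j z).mul_left (Real.pi : ℂ)⁻¹
    have hpi : (Real.pi : ℂ) ≠ 0 := by exact_mod_cast Real.pi_ne_zero
    refine h.congr_fun fun S => ?_
    field_simp

theorem imInv_symm (a b : Fin m) : imInv a b = imInv b a := by
  rw [imInv, imInv, subConjInv_symm]

/-- The polynomials in the entries of `(2πY)⁻¹` with coefficients in `R`, as smooth functions. -/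
def imInvEval (R : Subring ℂ) : MvPolynomial (SymIndex m) R →+* smoothAlg m :=
  MvPolynomial.eval₂Hom ((algebraMap ℂ (smoothAlg m)).comp R.subtype)
    fun ij => imInv ij.1.1 ij.1.2

theorem imInvEval_C (R : Subring ℂ) (c : R) :
    imInvEval (m := m) R (MvPolynomial.C c) = algebraMap ℂ (smoothAlg m) c :=
  MvPolynomial.eval₂_C _ _ _

theorem imInvEval_X (R : Subring ℂ) (i j : Fin m) :
    imInvEval R (MvPolynomial.X ⟨(min i j, max i j), min_le_max⟩) = imInv i j := by
  refine (MvPolynomial.eval₂_X _ _ _).trans ?_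
  rcases le_total i j with h | h
  · simp [h]
  · simp [h, imInv_symm i j]

theorem evalAt_imInvEval (R : Subring ℂ) (p : MvPolynomial (SymIndex m) R)
    (z : upperHalfSpace m) : evalAt z (imInvEval R p) =
      MvPolynomial.eval (symEntries ((2 * Real.pi) • z.1.map Complex.im)⁻¹)
        (MvPolynomial.map R.subtype p) := by
  rw [MvPolynomial.eval_map, imInvEval, MvPolynomial.coe_eval₂Hom, MvPolynomial.hom_eval₂]
  congr 1
  funext ij
  exact evalAt_imInv z _ _

/-- The operators `π⁻¹ ∂_{ij}` preserve polynomials in `(2πY)⁻¹` over a ring that contains `i` and `1/2`. -/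
theorem exists_pd_imInvEval {R : Subring ℂ} (hI : Complex.I ∈ R) (h2 : (1 / 2 : ℂ) ∈ R)
    (i j : Fin m) (p : MvPolynomial (SymIndex m) R) :
    ∃ p', (Real.pi : ℂ)⁻¹ • pd i j (imInvEval R p) = imInvEval R p' := by
  induction p using MvPolynomial.induction_on with
  | C a =>
    refine ⟨0, ?_⟩
    rw [imInvEval_C, Derivation.map_algebraMap, smul_zero, map_zero]
  | add p q hp hq =>
    obtain ⟨p', hp⟩ := hp
    obtain ⟨q', hq⟩ := hq
    refine ⟨p' + q', ?_⟩
    rw [map_add, map_add, smul_add, hp, hq, map_add]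
  | mul_X p s hp =>
    obtain ⟨p', hp⟩ := hp
    let X' : Fin m → Fin m → MvPolynomial (SymIndex m) R := fun i j =>
      MvPolynomial.X ⟨(min i j, max i j), min_le_max⟩
    have hX : ∀ i j, imInvEval R (X' i j) = imInv i j := imInvEval_X R
    refine ⟨p' * MvPolynomial.X s + p * (MvPolynomial.C (⟨_, hI⟩ * ⟨_, h2⟩) *
      (X' s.1.1 i * X' j s.1.2 + X' s.1.1 j * X' i s.1.2)), ?_⟩
    have hs : imInvEval R (MvPolynomial.X s) = imInv s.1.1 s.1.2 := MvPolynomial.eval₂_X _ _ _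
    rw [(imInvEval R).map_mul p (MvPolynomial.X s), Derivation.leibniz]
    simp only [RingHom.map_add, RingHom.map_mul, imInvEval_C, hs, hX]
    rw [← hp]
    have h3 := pd_imInv i j s.1.1 s.1.2
    refine evalAt_ext fun z => ?_
    have h4 := congrArg (evalAt z) h3
    simp only [smul_eq_mul, evalAt_smul, map_add, map_mul, evalAt_algebraMap] at h4 ⊢
    linear_combination evalAt z (imInvEval R p) * h4

/-- The group generated by the products of polynomials in the entries of `(2πY)⁻¹` with coefficients
in `R` and Fourier series over `R`. -/
def nearlyFourier (m : ℕ) (R : Subring ℂ) : AddSubgroup (smoothAlg m) :=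
  AddSubgroup.closure {g | ∃ p h, IsFourierSeries R h ∧ g = imInvEval R p * h}

theorem mem_nearlyFourier {R : Subring ℂ} (p : MvPolynomial (SymIndex m) R) {h : smoothAlg m}
    (hh : IsFourierSeries R h) : imInvEval R p * h ∈ nearlyFourier m R :=
  AddSubgroup.subset_closure ⟨p, h, hh, rfl⟩

theorem IsFourierSeries.mem_nearlyFourier {R : Subring ℂ} {h : smoothAlg m}
    (hh : IsFourierSeries R h) : h ∈ nearlyFourier m R := by
  have := Siegel.mem_nearlyFourier 1 hh
  rwa [map_one, one_mul] at this

/-- By the Leibniz rule, as `π⁻¹ ∂_{ij}` preserves both kinds of factors. -/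
theorem raising_mem_nearlyFourier {R : Subring ℂ} (hI : Complex.I ∈ R) (h2 : (1 / 2 : ℂ) ∈ R)
    {σ : ℂ} (hσ : σ ∈ R) (i j : Fin m) {f : smoothAlg m} (hf : f ∈ nearlyFourier m R) :
    raising σ i j f ∈ nearlyFourier m R := by
  induction hf using AddSubgroup.closure_induction with
  | mem f hf =>
    obtain ⟨p, h, hh, rfl⟩ := hf
    obtain ⟨p', hp'⟩ := exists_pd_imInvEval hI h2 i j p
    have e : raising σ i j (imInvEval R p * h) =
        imInvEval R p * ((Real.pi : ℂ)⁻¹ • Siegel.pd i j h) + imInvEval R p' * h -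
        imInvEval R (MvPolynomial.C (⟨_, hI⟩ * ⟨_, hσ⟩) *
          MvPolynomial.X ⟨(min i j, max i j), min_le_max⟩ * p) * h := by
      rw [← hp', map_mul, map_mul, imInvEval_C, imInvEval_X, raising, Derivation.leibniz]
      refine evalAt_ext fun z => ?_
      simp only [smul_eq_mul, evalAt_smul, map_add, map_sub, map_mul, evalAt_algebraMap]
      push_cast
      ring
    rw [e]
    exact sub_mem (add_mem (mem_nearlyFourier _ (hh.pd hI i j)) (mem_nearlyFourier _ hh))
      (mem_nearlyFourier _ hh)
  | zero =>
    have e : raising σ i j (0 : smoothAlg m) = 0 := by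
      rw [raising, map_zero, mul_zero, smul_zero, smul_zero, sub_zero]
    rw [e]
    exact zero_mem _
  | add f g _ _ hf hg =>
    have e : raising σ i j (f + g) = raising σ i j f + raising σ i j g := by
      rw [raising, raising, raising, map_add, mul_add, smul_add, smul_add]
      abel
    rw [e]
    exact add_mem hf hg
  | neg f _ hf =>
    have e : raising σ i j (-f) = -raising σ i j f := by
      rw [raising, raising]
      refine evalAt_ext fun z => ?_
      simp only [map_neg, map_sub, evalAt_smul, map_mul]
      ring
    rw [e]
    exact neg_mem hf

theorem maassIter_mem_nearlyFourier {R : Subring ℂ} (hI : Complex.I ∈ R) (h2 : (1 / 2 : ℂ) ∈ R)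
    (k r : ℕ) {f : smoothAlg m} (hf : f ∈ nearlyFourier m R) :
    ((Real.pi : ℂ) ^ (m * r))⁻¹ • maassIter k r f ∈ nearlyFourier m R := by
  induction r with
  | zero => simpa [maassIter] using hf
  | succ r ih =>
    have hσ : ∀ l : ℕ, (l : ℂ) - ((m : ℂ) + 1) / 2 + 1 ∈ R := fun l => by
      have : (l : ℂ) - ((m : ℂ) + 1) / 2 + 1 = l - (m + 1) * (1 / 2) + 1 := by ring
      rw [this]
      exact R.add_mem (R.sub_mem (natCast_mem R l) (R.mul_mem (R.add_mem (natCast_mem R m)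
        R.one_mem) h2)) R.one_mem
    have h := pi_inv_pow_smul_maass_mem (k + 2 * r)
      (fun i j f hf => raising_mem_nearlyFourier hI h2 (hσ _) i j hf) ih
    have e : ((Real.pi : ℂ) ^ (m * (r + 1)))⁻¹ • maassIter k (r + 1) f =
        ((Real.pi : ℂ) ^ m)⁻¹ • maass (k + 2 * r)
          (((Real.pi : ℂ) ^ (m * r))⁻¹ • maassIter k r f) := by
      refine evalAt_ext fun z => ?_
      rw [maass, mul_smul_comm, LinearMap.map_smul]
      simp only [evalAt_smul, map_mul]
      rw [maassIter, maass, map_mul, mul_add, mul_one, pow_add, mul_inv]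
      ring
    rw [e]
    exact h

theorem exists_expansion_of_mem_nearlyFourier {R : Subring ℂ} {g : smoothAlg m}
    (hg : g ∈ nearlyFourier m R) : ∃ P : FourierIndex m → MvPolynomial (SymIndex m) ℂ,
      (∀ z : upperHalfSpace m, HasSum (fun S => MvPolynomial.eval
        (symEntries ((2 * Real.pi) • z.1.map Complex.im)⁻¹) (P S) * expTr S z.1) (g.1 z)) ∧
      ∀ S d, (P S).coeff d ∈ R := by
  induction hg using AddSubgroup.closure_induction with
  | mem f hf =>
    obtain ⟨p, h, ⟨c, hc, -, hsum⟩, rfl⟩ := hf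
    refine ⟨fun S => MvPolynomial.C (c S) * MvPolynomial.map R.subtype p, fun z => ?_,
      fun S d => ?_⟩
    · have h1 := (hsum z).mul_left (evalAt z (imInvEval R p))
      refine (h1.congr_fun fun S => ?_)
      rw [evalAt_imInvEval, map_mul, MvPolynomial.eval_C]
      ring
    · rw [MvPolynomial.coeff_C_mul, MvPolynomial.coeff_map]
      exact R.mul_mem (hc S) (SetLike.coe_mem _)
  | zero =>
    exact ⟨0, fun z => by simp, fun S d => by simp⟩
  | add f g _ _ hf hg =>
    obtain ⟨P, hP, hP'⟩ := hf
    obtain ⟨Q, hQ, hQ'⟩ := hg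
    refine ⟨P + Q, fun z => ((hP z).add (hQ z)).congr_fun fun S => ?_, fun S d => ?_⟩
    · rw [Pi.add_apply, map_add, add_mul]
    · rw [Pi.add_apply, MvPolynomial.coeff_add]
      exact R.add_mem (hP' S d) (hQ' S d)
  | neg f _ hf =>
    obtain ⟨P, hP, hP'⟩ := hf
    refine ⟨-P, fun z => (hP z).neg.congr_fun fun S => ?_, fun S d => ?_⟩
    · rw [Pi.neg_apply, map_neg, neg_mul]
    · rw [Pi.neg_apply, MvPolynomial.coeff_neg]
      exact R.neg_mem (hP' S d)

theorem differentiableOn_comp_entries {G : (SymIndex m → ℂ) → ℂ}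
    (hG : DifferentiableOn ℂ G (coordDomain m)) :
    DifferentiableOn ℂ (fun Z : Matrix (Fin m) (Fin m) ℂ => G (entries Z)) (upperHalfSpace m) := by
  have h : DifferentiableOn ℂ (fun Z : Fin m → Fin m → ℂ => G (fun ij => Z ij.1.1 ij.1.2))
      (upperHalfSpace m : Set (Fin m → Fin m → ℂ)) := by
    refine hG.comp (t := coordDomain m) (f := fun (Z : Fin m → Fin m → ℂ) (ij : SymIndex m) =>
      Z ij.1.1 ij.1.2) ?_ fun Z hZ => entries_mem_coordDomain hZ
    fun_prop
  exact h

theorem differentiableOn_add {F G : Matrix (Fin m) (Fin m) ℂ → ℂ}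
    {s : Set (Matrix (Fin m) (Fin m) ℂ)} (hF : DifferentiableOn ℂ F s)
    (hG : DifferentiableOn ℂ G s) : DifferentiableOn ℂ (F + G) s :=
  DifferentiableOn.add (E := Fin m → Fin m → ℂ) hF hG

theorem differentiableOn_neg {F : Matrix (Fin m) (Fin m) ℂ → ℂ}
    {s : Set (Matrix (Fin m) (Fin m) ℂ)} (hF : DifferentiableOn ℂ F s) :
    DifferentiableOn ℂ (-F) s :=
  DifferentiableOn.neg (E := Fin m → Fin m → ℂ) hF

theorem isNearlyHolomorphic_of_mem_nearlyFourier {R : Subring ℂ} {g : smoothAlg m}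
    (hg : g ∈ nearlyFourier m R) {F : Matrix (Fin m) (Fin m) ℂ → ℂ}
    (hF : ∀ z : upperHalfSpace m, F z.1 = g.1 z) : IsNearlyHolomorphic F := by
  induction hg using AddSubgroup.closure_induction generalizing F with
  | mem f hf =>
    obtain ⟨p, h, ⟨c, -, -, hsum⟩, rfl⟩ := hf
    set G : (SymIndex m → ℂ) → ℂ := fun u => ∑' S, c S * expTr S (ofEntries u)
    have hG : G ∈ holAlg m := tsum_expTr_mem_holAlg fun z => (hsum z).summable
    have hGd : DifferentiableOn ℂ G (coordDomain m) := fun u hu =>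
      (differentiableAt_of_holAlg hG hu).differentiableWithinAt
    -- Near holomorphy refers to `Y⁻¹` rather than `(2πY)⁻¹`.
    let p' : MvPolynomial (SymIndex m) ℂ := MvPolynomial.bind₁
      (fun ij => MvPolynomial.C ((2 * Real.pi : ℂ)⁻¹) * MvPolynomial.X ij)
      (MvPolynomial.map R.subtype p)
    refine ⟨MvPolynomial.C (fun Z => G (entries Z)) *
      MvPolynomial.map (Pi.constRingHom (Matrix (Fin m) (Fin m) ℂ) ℂ) p', fun d => ?_,
      fun Z hZ => ?_⟩
    · rw [MvPolynomial.coeff_C_mul, MvPolynomial.coeff_map]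
      exact differentiableOn_comp_entries (G := fun u => G u * p'.coeff d) (hGd.mul_const _)
    · rw [hF ⟨Z, hZ⟩]
      change evalAt ⟨Z, hZ⟩ (_ * h) = _
      rw [map_mul, evalAt_imInvEval, map_mul, map_mul, MvPolynomial.map_C, MvPolynomial.eval_C,
        MvPolynomial.map_map, mul_comm]
      congr 1
      · rw [evalAt_apply, ← (hsum ⟨Z, hZ⟩).tsum_eq]
        change _ = ∑' S, c S * expTr S (ofEntries (entries Z))
        rw [ofEntries_entries hZ.1]
      · have e1 : ((Pi.evalRingHom (fun _ : Matrix (Fin m) (Fin m) ℂ => ℂ) Z).comp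
            (Pi.constRingHom (Matrix (Fin m) (Fin m) ℂ) ℂ)) = RingHom.id ℂ := rfl
        rw [e1, MvPolynomial.map_id]
        have e2 : ∀ x : SymIndex m → ℂ, MvPolynomial.eval x p' =
            MvPolynomial.eval (fun ij => (2 * Real.pi : ℂ)⁻¹ * x ij)
              (MvPolynomial.map R.subtype p) := by
          intro x
          change MvPolynomial.eval₂Hom _ _ _ = _
          rw [MvPolynomial.eval₂Hom_bind₁]
          simp only [MvPolynomial.coe_eval₂Hom, MvPolynomial.eval₂_mul, MvPolynomial.eval₂_C,
            MvPolynomial.eval₂_X, RingHom.id_apply]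
          rfl
        rw [e2]
        congr 2
        funext ij
        have hu : IsUnit (Z.map Complex.im).det := isUnit_iff_ne_zero.2 hZ.2.det_pos.ne'
        have e3 : ((2 * Real.pi) • Z.map Complex.im)⁻¹ =
            (2 * Real.pi)⁻¹ • (Z.map Complex.im)⁻¹ := by
          refine Matrix.inv_eq_left_inv ?_
          have : (2 * Real.pi) ≠ 0 := by positivity
          rw [Matrix.smul_mul, Matrix.mul_smul, nonsing_inv_mul _ hu, smul_smul,
            inv_mul_cancel₀ this, one_smul]
        rw [symEntries, e3, Matrix.smul_apply, smul_eq_mul]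
        push_cast
        rfl
  | zero =>
    refine ⟨0, fun d => ?_, fun Z hZ => ?_⟩
    · rw [MvPolynomial.coeff_zero]
      exact differentiableOn_comp_entries (G := fun _ => 0) (differentiableOn_const 0)
    · rw [hF ⟨Z, hZ⟩, map_zero, map_zero]
      rfl
  | add f g _ _ hf hg =>
    obtain ⟨P, hP, hP'⟩ := hf (F := fun Z => extend f.1 (entries Z)) fun z => extend_entries _ z
    obtain ⟨Q, hQ, hQ'⟩ := hg (F := fun Z => extend g.1 (entries Z)) fun z => extend_entries _ z
    refine ⟨P + Q, fun d => ?_, fun Z hZ => ?_⟩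
    · rw [MvPolynomial.coeff_add]
      exact differentiableOn_add (hP d) (hQ d)
    · rw [hF ⟨Z, hZ⟩, map_add, map_add, ← hP' Z hZ, ← hQ' Z hZ]
      exact (congrArg₂ (· + ·) (extend_entries f.1 ⟨Z, hZ⟩) (extend_entries g.1 ⟨Z, hZ⟩)).symm
  | neg f _ hf =>
    obtain ⟨P, hP, hP'⟩ := hf (F := fun Z => extend f.1 (entries Z)) fun z => extend_entries _ z
    refine ⟨-P, fun d => ?_, fun Z hZ => ?_⟩
    · rw [MvPolynomial.coeff_neg]
      exact differentiableOn_neg (hP d)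
    · rw [hF ⟨Z, hZ⟩, map_neg, map_neg, ← hP' Z hZ]
      exact (congrArg (- ·) (extend_entries f.1 ⟨Z, hZ⟩)).symm

/-! ### Mean values of almost periodic functions -/

theorem norm_mean_exp_le (μ : ℝ) {T : ℝ} (hT : 0 < T) :
    ‖(T : ℂ)⁻¹ * ∫ x in (0 : ℝ)..T, Complex.exp (2 * Real.pi * Complex.I * μ * x)‖ ≤ 1 := by
  have h : ‖∫ x in (0 : ℝ)..T, Complex.exp (2 * Real.pi * Complex.I * μ * x)‖ ≤ 1 * |T - 0| := by
    refine intervalIntegral.norm_integral_le_of_norm_le_const fun x _ => le_of_eq ?_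
    have : (2 * Real.pi * Complex.I * μ * x : ℂ) = ((2 * Real.pi * μ * x : ℝ) : ℂ) * Complex.I := by
      push_cast; ring
    rw [this, Complex.norm_exp_ofReal_mul_I]
  rw [norm_mul, norm_inv, Complex.norm_real, Real.norm_eq_abs, abs_of_pos hT]
  rw [sub_zero, one_mul, abs_of_pos hT] at h
  rw [inv_mul_le_iff₀ hT, mul_one]
  exact h

theorem tendsto_mean_exp (μ : ℝ) : Filter.Tendsto
    (fun T : ℝ => (T : ℂ)⁻¹ * ∫ x in (0 : ℝ)..T, Complex.exp (2 * Real.pi * Complex.I * μ * x))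
    Filter.atTop (𝓝 (if μ = 0 then 1 else 0)) := by
  split_ifs with h
  · subst h
    refine tendsto_const_nhds.congr' ?_
    filter_upwards [Filter.eventually_gt_atTop 0] with T hT
    have : (T : ℂ) ≠ 0 := by exact_mod_cast hT.ne'
    simp [this]
  · set c : ℂ := 2 * Real.pi * Complex.I * μ with hc
    have hc0 : c ≠ 0 := by
      have : (μ : ℂ) ≠ 0 := by exact_mod_cast h
      simp [hc, this, Real.pi_ne_zero]
    have hbd : ∀ T : ℝ, ‖∫ x in (0 : ℝ)..T, Complex.exp (c * x)‖ ≤ 2 / ‖c‖ := by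
      intro T
      rw [integral_exp_mul_complex hc0, norm_div]
      gcongr
      have h1 : ∀ x : ℝ, ‖Complex.exp (c * x)‖ = 1 := by
        intro x
        have : c * x = ((2 * Real.pi * μ * x : ℝ) : ℂ) * Complex.I := by
          rw [hc]; push_cast; ring
        rw [this, Complex.norm_exp_ofReal_mul_I]
      refine (norm_sub_le _ _).trans ?_
      rw [h1, h1]
      norm_num
    have h2 : Filter.Tendsto (fun T : ℝ => T⁻¹ * (2 / ‖c‖)) Filter.atTop (𝓝 0) := by
      simpa using tendsto_inv_atTop_zero.mul_const (2 / ‖c‖)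
    refine squeeze_zero_norm' ?_ h2
    filter_upwards [Filter.eventually_gt_atTop 0] with T hT
    rw [norm_mul, norm_inv, Complex.norm_real, Real.norm_eq_abs, abs_of_pos hT]
    exact mul_le_mul_of_nonneg_left (hbd T) (by positivity)

/-- The coefficients of an absolutely convergent series of characters are its mean values. -/
theorem tendsto_mean {ι : Type*} [Countable ι] {a : ι → ℂ} {l : ι → ℝ}
    (hl : Function.Injective l) (ha : Summable fun i => ‖a i‖) {f : ℝ → ℂ}
    (hf : ∀ x : ℝ, HasSum (fun i => a i * Complex.exp (2 * Real.pi * Complex.I * l i * x)) (f x))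
    (j : ι) : Filter.Tendsto (fun T : ℝ => (T : ℂ)⁻¹ * ∫ x in (0 : ℝ)..T,
      f x * Complex.exp (-(2 * Real.pi * Complex.I * l j * x))) Filter.atTop (𝓝 (a j)) := by
  classical
  have hterm : ∀ (i : ι) (x : ℝ), a i * Complex.exp (2 * Real.pi * Complex.I * l i * x) *
      Complex.exp (-(2 * Real.pi * Complex.I * l j * x)) =
        a i * Complex.exp (2 * Real.pi * Complex.I * (l i - l j : ℝ) * x) := by
    intro i x
    rw [mul_assoc, ← Complex.exp_add]
    congr 2
    push_cast
    ring
  have hint : ∀ T : ℝ, HasSum (fun i => a i * ∫ x in (0 : ℝ)..T,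
      Complex.exp (2 * Real.pi * Complex.I * (l i - l j : ℝ) * x))
      (∫ x in (0 : ℝ)..T, f x * Complex.exp (-(2 * Real.pi * Complex.I * l j * x))) := by
    intro T
    simp_rw [← intervalIntegral.integral_const_mul]
    refine intervalIntegral.hasSum_integral_of_dominated_convergence (fun i _ => ‖a i‖)
      (fun i => ?_) (fun i => ?_) ?_ ?_ ?_
    · refine Continuous.aestronglyMeasurable ?_
      fun_prop
    · refine Filter.Eventually.of_forall fun x _ => ?_
      have : (2 * Real.pi * Complex.I * (l i - l j : ℝ) * x : ℂ) =
          ((2 * Real.pi * (l i - l j) * x : ℝ) : ℂ) * Complex.I := by push_cast; ring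
      rw [norm_mul, this, Complex.norm_exp_ofReal_mul_I, mul_one]
    · exact Filter.Eventually.of_forall fun _ _ => ha
    · exact intervalIntegrable_const
    · refine Filter.Eventually.of_forall fun x _ => ?_
      exact ((hf x).mul_right _).congr_fun fun i => (hterm i x).symm
  have hlim := tendsto_tsum_of_dominated_convergence (𝓕 := Filter.atTop)
    (f := fun (T : ℝ) (i : ι) => a i * ((T : ℂ)⁻¹ * ∫ x in (0 : ℝ)..T,
      Complex.exp (2 * Real.pi * Complex.I * (l i - l j : ℝ) * x)))
    (g := fun i => a i * if l i - l j = 0 then 1 else 0) ha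
    (fun i => (tendsto_mean_exp _).const_mul _) (by
      filter_upwards [Filter.eventually_gt_atTop 0] with T hT i
      rw [norm_mul]
      exact mul_le_of_le_one_right (norm_nonneg _) (norm_mean_exp_le _ hT))
  have h1 : ∑' i, a i * (if l i - l j = 0 then 1 else 0) = a j := by
    rw [tsum_eq_single j]
    · simp
    · intro i hi
      rw [if_neg (sub_ne_zero.2 (hl.ne hi)), mul_zero]
  rw [h1] at hlim
  refine hlim.congr fun T => ?_
  rw [← ((hint T).mul_left (T : ℂ)⁻¹).tsum_eq]
  exact tsum_congr fun i => mul_left_comm _ _ _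

/-- The mean values of a bounded holomorphic function along two horizontal lines agree. -/
theorem mean_eq_of_bounded {h : ℂ → ℂ} {y C : ℝ} (hy : 0 ≤ y)
    (hd : DifferentiableOn ℂ h {w | 0 ≤ w.im})
    (hC : ∀ w : ℂ, 0 ≤ w.im → w.im ≤ y → ‖h w‖ ≤ C) {A B : ℂ}
    (hA : Filter.Tendsto (fun T : ℝ => (T : ℂ)⁻¹ * ∫ x in (0 : ℝ)..T, h x) Filter.atTop (𝓝 A))
    (hB : Filter.Tendsto (fun T : ℝ => (T : ℂ)⁻¹ * ∫ x in (0 : ℝ)..T, h (x + y * Complex.I))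
      Filter.atTop (𝓝 B)) : A = B := by
  have hside : ∀ T : ℝ, ‖∫ s in (0 : ℝ)..y, h (T + s * Complex.I)‖ ≤ C * |y - 0| := by
    intro T
    refine intervalIntegral.norm_integral_le_of_norm_le_const fun s hs => ?_
    rw [Set.uIoc_of_le hy] at hs
    exact hC _ (by simpa using hs.1.le) (by simpa using hs.2)
  -- By Cauchy's theorem the integrals differ by those over the vertical sides, bounded in `T`.
  have hrect : ∀ T : ℝ, 0 ≤ T → ‖(∫ x in (0 : ℝ)..T, h x) -
      ∫ x in (0 : ℝ)..T, h (x + y * Complex.I)‖ ≤ 2 * (C * |y - 0|) := by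
    intro T hT
    have h1 := Complex.integral_boundary_rect_eq_zero_of_differentiableOn h 0 (T + y * Complex.I)
      (hd.mono fun w hw => by
        have := (Complex.mem_reProdIm.1 hw).2
        simp only [Complex.zero_im, Complex.add_im, Complex.ofReal_im, Complex.mul_im,
          Complex.ofReal_re, Complex.I_im, mul_one, Complex.I_re, mul_zero, add_zero,
          zero_add, Set.uIcc_of_le hy] at this
        exact this.1)
    simp only [Complex.zero_re, Complex.zero_im, Complex.add_re, Complex.ofReal_re, Complex.mul_re,
      Complex.I_re, mul_zero, Complex.ofReal_im, Complex.I_im, mul_one, sub_self, add_zero,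
      Complex.add_im, Complex.mul_im, zero_add, Complex.ofReal_zero, zero_mul, smul_eq_mul] at h1
    have h2 := hside T
    have h3 := hside 0
    simp only [Complex.ofReal_zero, zero_add] at h3
    have h4 : (∫ x in (0 : ℝ)..T, h x) - ∫ x in (0 : ℝ)..T, h (x + y * Complex.I) =
        Complex.I * (∫ s in (0 : ℝ)..y, h (s * Complex.I)) -
        Complex.I * (∫ s in (0 : ℝ)..y, h (T + s * Complex.I)) := by
      linear_combination h1
    rw [h4]
    refine (norm_sub_le _ _).trans ?_
    rw [norm_mul, norm_mul, Complex.norm_I, one_mul, one_mul]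
    linarith
  have hlim := hA.sub hB
  have h0 : Filter.Tendsto (fun T : ℝ => T⁻¹ * (2 * (C * |y - 0|))) Filter.atTop (𝓝 0) := by
    simpa using tendsto_inv_atTop_zero.mul_const (2 * (C * |y - 0|))
  refine sub_eq_zero.1 (tendsto_nhds_unique hlim (squeeze_zero_norm' ?_ h0))
  filter_upwards [Filter.eventually_gt_atTop 0] with T hT
  rw [← mul_sub, norm_mul, norm_inv, Complex.norm_real, Real.norm_eq_abs, abs_of_pos hT]
  exact mul_le_mul_of_nonneg_left (hrect T hT.le) (by positivity)

/-! ### A direction that separates the rational symmetric matrices -/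

/-- There is a positive definite `V` such that `S ↦ tr(SV)` is injective on rational symmetric
matrices: a perturbation of the identity by distinct powers of a small transcendental number. -/
theorem exists_separating (m : ℕ) : ∃ V : Matrix (Fin m) (Fin m) ℝ, V.PosDef ∧
    Function.Injective fun S : FourierIndex m => (S.1.map (Rat.cast : ℚ → ℝ) * V).trace := by
  obtain ⟨δ, hδ, h⟩ := exists_pos_sub_posDef (Matrix.PosDef.one (n := Fin m) (R := ℝ))
  obtain ⟨t, ht, htt⟩ := ((Algebraic.countable ℚ ℝ).dense_compl ℝ).exists_mem_open
    (isOpen_Ioo (a := (0 : ℝ)) (b := min δ 1)) (Set.nonempty_Ioo.2 (lt_min hδ one_pos))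
  have ht0 : 0 < t := htt.1
  have ht1 : t < δ := htt.2.trans_le (min_le_left _ _)
  have ht2 : t < 1 := htt.2.trans_le (min_le_right _ _)
  -- The exponents are positive, and distinct for distinct unordered pairs.
  let n : Fin m → Fin m → ℕ := fun i j =>
    (Fintype.equivFin (SymIndex m) ⟨(min i j, max i j), min_le_max⟩ : ℕ) + 1
  have hn : ∀ i j, n i j = n j i := fun i j => by
    simp only [n, min_comm, max_comm]
  have hn' : ∀ i j a b, n i j = n a b → (i = a ∧ j = b) ∨ (i = b ∧ j = a) := by
    intro i j a b hab
    have h1 := (Fintype.equivFin (SymIndex m)).injective (Fin.ext (Nat.succ_injective hab))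
    have h2 := Prod.ext_iff.1 (Subtype.ext_iff.1 h1)
    have h3 : min i j = min a b := h2.1
    have h4 : max i j = max a b := h2.2
    rcases le_total i j with hij | hij <;> rcases le_total a b with hab | hab <;>
      simp [hij, hab] at h3 h4 <;> simp [h3, h4]
  let V : Matrix (Fin m) (Fin m) ℝ := 1 + Matrix.of fun i j => t ^ n i j
  have hVs : V.IsSymm := by
    refine Matrix.isSymm_one.add ?_
    ext i j
    simp [hn i j]
  refine ⟨V, posDef_of_sub_smul_one hδ.le (h V hVs fun i j => ?_), ?_⟩
  · have : V i j - (1 : Matrix (Fin m) (Fin m) ℝ) i j = t ^ n i j := by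
      simp [V]
    rw [this, abs_of_nonneg (by positivity), pow_succ]
    exact (mul_le_of_le_one_left ht0.le (pow_le_one₀ ht0.le ht2.le)).trans ht1.le
  · intro S S' hSS
    have hD : ((S.1 - S'.1).map (Rat.cast : ℚ → ℝ) * V).trace = 0 := by
      rw [Matrix.map_sub _ Rat.cast_sub, Matrix.sub_mul, trace_sub]
      exact sub_eq_zero.2 hSS
    set D := S.1 - S'.1 with hDdef
    have hDs : D.IsSymm := S.2.1.sub S'.2.1
    let p : Polynomial ℚ := Polynomial.C D.trace +
      ∑ i, ∑ j, Polynomial.C (D i j) * Polynomial.X ^ n j i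
    have hp : Polynomial.aeval t p = 0 := by
      rw [← hD]
      simp only [p, map_add, map_sum, map_mul, map_pow, Polynomial.aeval_C, Polynomial.aeval_X, V,
        Matrix.mul_add, Matrix.mul_one, eq_ratCast, trace, diag_apply, Matrix.add_apply,
        map_apply, Matrix.mul_apply, of_apply, Finset.sum_add_distrib]
    have hp0 : p = 0 := by
      by_contra hne
      exact ht ⟨p, hne, hp⟩
    have hD0 : D = 0 := by
      ext a b
      have h1 := congrArg (fun q => Polynomial.coeff q (n b a)) hp0
      simp only [p, Polynomial.coeff_add, Polynomial.finsetSum_coeff, Polynomial.coeff_C_mul,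
        Polynomial.coeff_X_pow, Polynomial.coeff_zero] at h1
      rw [Polynomial.coeff_C_of_ne_zero (Nat.succ_ne_zero _), zero_add] at h1
      have h2 : ∀ i j, D i j * (if n b a = n j i then 1 else 0) =
          D a b * if n b a = n j i then 1 else 0 := by
        intro i j
        split_ifs with hab
        · rcases hn' _ _ _ _ hab with ⟨rfl, rfl⟩ | ⟨rfl, rfl⟩
          · rfl
          · rw [hDs.apply]
        · simp
      simp only [h2, ← Finset.mul_sum] at h1
      refine (mul_eq_zero.1 h1).resolve_right (ne_of_gt ?_)
      refine Finset.sum_pos' (fun i _ => Finset.sum_nonneg fun j _ => by positivity)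
        ⟨a, Finset.mem_univ a, Finset.sum_pos' (fun j _ => by positivity)
          ⟨b, Finset.mem_univ b, by simp⟩⟩
    exact Subtype.ext (sub_eq_zero.1 hD0)

section

/-! ### Fourier expansions of holomorphic periodic functions -/

theorem expTr_add (S : FourierIndex m) (Z W : Matrix (Fin m) (Fin m) ℂ) :
    expTr S (Z + W) = expTr S Z * expTr S W := by
  rw [expTr, expTr, expTr, ← Complex.exp_add, Matrix.mul_add, trace_add, mul_add]

theorem expTr_smul_ofReal (S : FourierIndex m) (w : ℂ) (V : Matrix (Fin m) (Fin m) ℝ) :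
    expTr S (w • V.map Complex.ofReal) = Complex.exp (2 * Real.pi * Complex.I *
      ((S.1.map (Rat.cast : ℚ → ℝ) * V).trace : ℝ) * w) := by
  rw [expTr, Matrix.mul_smul, trace_smul, smul_eq_mul]
  have : (((S.1.map (Rat.cast : ℚ → ℝ) * V).trace : ℝ) : ℂ) =
      (S.1.map (Rat.cast : ℚ → ℂ) * V.map Complex.ofReal).trace := by
    simp [trace, Matrix.mul_apply]
  rw [this]
  congr 1
  ring

theorem expTr_ne_zero (S : FourierIndex m) (Z : Matrix (Fin m) (Fin m) ℂ) : expTr S Z ≠ 0 :=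
  Complex.exp_ne_zero _

theorem map_im_line (Z : Matrix (Fin m) (Fin m) ℂ) (V : Matrix (Fin m) (Fin m) ℝ) (w : ℂ) :
    (Z + w • V.map Complex.ofReal).map Complex.im = Z.map Complex.im + w.im • V := by
  ext i j
  simp

theorem line_mem {Z : Matrix (Fin m) (Fin m) ℂ} (hZ : Z ∈ upperHalfSpace m)
    {V : Matrix (Fin m) (Fin m) ℝ} (hV : V.PosDef) {w : ℂ} (hw : 0 ≤ w.im) :
    Z + w • V.map Complex.ofReal ∈ upperHalfSpace m := by
  refine ⟨hZ.1.add (((isSymm_of_posDef hV).map _).smul w), ?_⟩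
  rw [map_im_line]
  exact hZ.2.add_posSemidef (hV.posSemidef.smul hw)

/-- Uniqueness of Fourier expansions: restricted to `Z + xV` with a separating `V`, the coefficients
are mean values. -/
theorem fourier_unique {a b : FourierIndex m → ℂ} {F : Matrix (Fin m) (Fin m) ℂ → ℂ}
    (ha : ∀ z : upperHalfSpace m, HasSum (fun S => a S * expTr S z.1) (F z.1))
    (hb : ∀ z : upperHalfSpace m, HasSum (fun S => b S * expTr S z.1) (F z.1)) : a = b := by
  obtain ⟨V, hV, hinj⟩ := exists_separating m
  have : Countable (FourierIndex m) :=
    (Subtype.val_injective (p := fun S : Matrix (Fin m) (Fin m) ℚ => S.IsSymm ∧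
      (S.map (Rat.cast : ℚ → ℝ)).PosSemidef)).countable (β := Fin m → Fin m → ℚ)
  set Z : upperHalfSpace m := ⟨_, I_smul_one_mem⟩
  have key : ∀ a : FourierIndex m → ℂ,
      (∀ z : upperHalfSpace m, HasSum (fun S => a S * expTr S z.1) (F z.1)) → ∀ S, _ :=
    fun a ha S => tendsto_mean (a := fun S => a S * expTr S Z.1) hinj (ha Z).summable.norm
      (f := fun x => F (Z.1 + (x : ℂ) • V.map Complex.ofReal)) (fun x => by
        have h1 := ha ⟨_, line_mem Z.2 hV (w := x) (by simp)⟩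
        refine h1.congr_fun fun S => ?_
        rw [expTr_add, expTr_smul_ofReal, mul_assoc]) S
  funext S
  exact mul_right_cancel₀ (expTr_ne_zero S Z.1) (tendsto_nhds_unique (key a ha S) (key b hb S))

section Periodic

variable {F : Matrix (Fin m) (Fin m) ℂ → ℂ} {N : ℕ}

theorem differentiableOn_line (hF : DifferentiableOn ℂ F (upperHalfSpace m))
    {Z : Matrix (Fin m) (Fin m) ℂ} (hZ : Z ∈ upperHalfSpace m)
    {V : Matrix (Fin m) (Fin m) ℝ} (hV : V.PosDef) :
    DifferentiableOn ℂ (fun w : ℂ => F (Z + w • V.map Complex.ofReal)) {w | 0 ≤ w.im} := by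
  refine DifferentiableOn.comp (E := ℂ) (F := Fin m → Fin m → ℂ) (g := F)
    (f := fun w i j => Z i j + w * (V i j : ℂ)) (t := upperHalfSpace m) hF ?_
    fun w hw => line_mem hZ hV hw
  fun_prop

/-- A continuous function that is periodic in the real part is bounded on the strips over
segments. -/
theorem exists_bound_line (hF : DifferentiableOn ℂ F (upperHalfSpace m)) (hN : 0 < N)
    (hper : ∀ z : upperHalfSpace m, ∀ B : Matrix (Fin m) (Fin m) ℤ, B.IsSymm →
      F (z.1 + (N : ℂ) • B.map (Int.cast : ℤ → ℂ)) = F z.1)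
    {Z : Matrix (Fin m) (Fin m) ℂ} (hZ : Z ∈ upperHalfSpace m)
    {V : Matrix (Fin m) (Fin m) ℝ} (hV : V.PosDef) (y : ℝ) :
    ∃ C, ∀ w : ℂ, 0 ≤ w.im → w.im ≤ y → ‖F (Z + w • V.map Complex.ofReal)‖ ≤ C := by
  let Φ : (SymIndex m → ℝ) × ℝ → Matrix (Fin m) (Fin m) ℂ := fun p =>
    Z + ofEntries (fun ij => (p.1 ij : ℂ)) + (p.2 * Complex.I : ℂ) • V.map Complex.ofReal
  have hΦ : ∀ p : (SymIndex m → ℝ) × ℝ, 0 ≤ p.2 → Φ p ∈ upperHalfSpace m := by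
    intro p hp
    refine line_mem ⟨hZ.1.add (ofEntries_isSymm _), ?_⟩ hV (by simpa using hp)
    have : (Z + ofEntries fun ij => (p.1 ij : ℂ)).map Complex.im = Z.map Complex.im := by
      ext i j
      simp [ofEntries_apply]
    rw [this]
    exact hZ.2
  have hcont : Continuous fun p : (SymIndex m → ℝ) × ℝ => (Φ p : Fin m → Fin m → ℂ) := by
    refine continuous_pi fun i => continuous_pi fun j => ?_
    change Continuous fun p : (SymIndex m → ℝ) × ℝ =>
      Z i j + (p.1 ⟨(min i j, max i j), min_le_max⟩ : ℂ) + p.2 * Complex.I * (V i j : ℂ)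
    fun_prop
  have hFd : DifferentiableOn ℂ (E := Fin m → Fin m → ℂ) F
    (upperHalfSpace m : Set (Fin m → Fin m → ℂ)) := hF
  have hFc := hFd.continuousOn
  obtain ⟨C, hC⟩ := (isCompact_Icc.prod isCompact_Icc : IsCompact
    (Set.Icc (0 : SymIndex m → ℝ) (fun _ => (N : ℝ)) ×ˢ Set.Icc 0 y)).exists_bound_of_continuousOn
    (f := fun p => F (Φ p)) (hFc.comp hcont.continuousOn fun p hp => hΦ p hp.2.1)
  refine ⟨C, fun w hw hwy => ?_⟩
  have hN' : (0 : ℝ) < N := by exact_mod_cast hN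
  -- Translation by `N B` moves the real part of `wV` into the compact cube `[0, N]`.
  let B : Matrix (Fin m) (Fin m) ℤ := Matrix.of fun i j => ⌊w.re * V i j / N⌋
  have hVs := isSymm_of_posDef hV
  have hB : B.IsSymm := by
    ext i j
    simp [B, hVs.apply i j]
  let v : SymIndex m → ℝ := fun ij => w.re * V ij.1.1 ij.1.2 - N * B ij.1.1 ij.1.2
  have hv : v ∈ Set.Icc (0 : SymIndex m → ℝ) (fun _ => (N : ℝ)) := by
    have h1 : ∀ ij : SymIndex m, v ij = N * Int.fract (w.re * V ij.1.1 ij.1.2 / N) := by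
      intro ij
      simp only [v, B, of_apply, Int.fract]
      field_simp
    refine ⟨fun ij => ?_, fun ij => ?_⟩
    · rw [h1]
      exact mul_nonneg hN'.le (Int.fract_nonneg _)
    · rw [h1]
      exact mul_le_of_le_one_right hN'.le (Int.fract_lt_one _).le
  have h2 : Z + w • V.map Complex.ofReal =
      Φ (v, w.im) + (N : ℂ) • B.map (Int.cast : ℤ → ℂ) := by
    have h3 : ofEntries (fun ij => (v ij : ℂ)) =
        (w.re : ℂ) • V.map Complex.ofReal - (N : ℂ) • B.map (Int.cast : ℤ → ℂ) := by
      have : (fun ij => (v ij : ℂ)) = entries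
          ((w.re : ℂ) • V.map Complex.ofReal - (N : ℂ) • B.map (Int.cast : ℤ → ℂ)) := by
        funext ij
        simp [v, entries]
      rw [this, ofEntries_entries]
      exact ((hVs.map _).smul _).sub ((hB.map _).smul _)
    change _ = Z + ofEntries (fun ij => (v ij : ℂ)) + (w.im * Complex.I : ℂ) •
      V.map Complex.ofReal + _
    rw [h3]
    nth_rewrite 1 [← Complex.re_add_im w]
    rw [add_smul]
    abel
  rw [h2, hper ⟨_, hΦ (v, w.im) hw⟩ B hB]
  exact hC (v, w.im) ⟨hv, hw, hwy⟩

/-- The entries of `(2π(Y + yV))⁻¹` tend to zero as `y → ∞`. -/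
theorem tendsto_inv_line {Y V : Matrix (Fin m) (Fin m) ℝ} (hV : V.PosDef) :
    Filter.Tendsto (fun y : ℝ => symEntries ((2 * Real.pi) • (Y + y • V))⁻¹) Filter.atTop (𝓝 0) := by
  have hpi : (2 * Real.pi) ≠ 0 := by positivity
  have h1 : ∀ y : ℝ, 0 < y → ((2 * Real.pi) • (Y + y • V))⁻¹ =
      (2 * Real.pi * y)⁻¹ • ((y⁻¹ • Y + V).det⁻¹ • (y⁻¹ • Y + V).adjugate) := by
    intro y hy
    have h2 : (2 * Real.pi) • (Y + y • V) = (2 * Real.pi * y) • (y⁻¹ • Y + V) := by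
      rw [smul_add, smul_add, smul_smul, smul_smul, mul_assoc (2 * Real.pi) y,
        mul_inv_cancel₀ hy.ne', mul_one]
    rw [h2]
    by_cases hd : (y⁻¹ • Y + V).det = 0
    · have h3 : ¬ IsUnit ((2 * Real.pi * y) • (y⁻¹ • Y + V)).det := by
        rw [det_smul, hd, mul_zero]
        exact not_isUnit_zero
      rw [Matrix.nonsing_inv_apply_not_isUnit _ h3, hd, _root_.inv_zero, zero_smul, smul_zero]
    · refine Matrix.inv_eq_left_inv ?_
      rw [Matrix.smul_mul, Matrix.mul_smul, Matrix.smul_mul, adjugate_mul, smul_smul, smul_smul,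
        smul_smul]
      have hy' := hy.ne'
      have : (2 * Real.pi * y)⁻¹ * (2 * Real.pi * y) * ((y⁻¹ • Y + V).det⁻¹ *
          (y⁻¹ • Y + V).det) = 1 := by
        rw [inv_mul_cancel₀ (mul_ne_zero hpi hy'), inv_mul_cancel₀ hd, one_mul]
      rw [← mul_assoc] at this
      rw [this, one_smul]
  have hs : ContinuousAt (fun s : ℝ => (s • Y + V).det⁻¹ • (s • Y + V).adjugate) 0 := by
    have hc : Continuous fun s : ℝ => s • Y + V := by fun_prop
    refine ContinuousAt.smul (ContinuousAt.inv₀ hc.matrix_det.continuousAt ?_)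
      hc.matrix_adjugate.continuousAt
    rw [zero_smul, zero_add]
    exact hV.det_pos.ne'
  have h3 : Filter.Tendsto (fun y : ℝ => (2 * Real.pi * y)⁻¹ •
      ((y⁻¹ • Y + V).det⁻¹ • (y⁻¹ • Y + V).adjugate)) Filter.atTop (𝓝 0) := by
    have h4 := hs.tendsto.comp tendsto_inv_atTop_zero
    have h5 : Filter.Tendsto (fun y : ℝ => (2 * Real.pi * y)⁻¹) Filter.atTop (𝓝 0) :=
      tendsto_inv_atTop_zero.comp (Filter.tendsto_id.const_mul_atTop (by positivity))
    simpa using h5.smul h4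
  have h6 : Continuous (symEntries : Matrix (Fin m) (Fin m) ℝ → SymIndex m → ℂ) := by
    refine continuous_pi fun ij => ?_
    exact Complex.continuous_ofReal.comp (continuous_id.matrix_elem _ _)
  have h7 : symEntries (0 : Matrix (Fin m) (Fin m) ℝ) = 0 := by
    funext ij; simp [symEntries]
  have h8 := (h6.tendsto 0).comp h3
  rw [h7] at h8
  refine h8.congr' ?_
  filter_upwards [Filter.eventually_gt_atTop 0] with y hy
  rw [h1 y hy]
  rfl

/-- In the Fourier expansion of a holomorphic periodic function the polynomials `P_S` take a constant
value. Indeed the mean value that isolates `S` along a line `Z + wV` does not change when the line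
is moved into the upper half plane, and there `(Im Z)⁻¹` tends to zero. -/
theorem eval_eq_coeff_zero (hF : DifferentiableOn ℂ F (upperHalfSpace m)) (hN : 0 < N)
    (hper : ∀ z : upperHalfSpace m, ∀ B : Matrix (Fin m) (Fin m) ℤ, B.IsSymm →
      F (z.1 + (N : ℂ) • B.map (Int.cast : ℤ → ℂ)) = F z.1)
    {P : FourierIndex m → MvPolynomial (SymIndex m) ℂ} (hP : HasFourierExpansion F P)
    (S : FourierIndex m) (Z : upperHalfSpace m) :
    MvPolynomial.eval (symEntries ((2 * Real.pi) • Z.1.map Complex.im)⁻¹) (P S) =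
      (P S).coeff 0 := by
  obtain ⟨V, hV, hinj⟩ := exists_separating m
  have : Countable (FourierIndex m) :=
    (Subtype.val_injective (p := fun S : Matrix (Fin m) (Fin m) ℚ => S.IsSymm ∧
      (S.map (Rat.cast : ℚ → ℝ)).PosSemidef)).countable (β := Fin m → Fin m → ℚ)
  set l : FourierIndex m → ℝ := fun S => (S.1.map (Rat.cast : ℚ → ℝ) * V).trace with hl
  set L : ℂ → Matrix (Fin m) (Fin m) ℂ := fun w => Z.1 + w • V.map Complex.ofReal with hL
  set e : ℝ → FourierIndex m → ℂ := fun y S => MvPolynomial.eval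
    (symEntries ((2 * Real.pi) • (Z.1.map Complex.im + y • V))⁻¹) (P S) with he
  have hmean : ∀ y : ℝ, 0 ≤ y → Filter.Tendsto (fun T : ℝ => (T : ℂ)⁻¹ * ∫ x in (0 : ℝ)..T,
      F (L (x + y * Complex.I)) * Complex.exp (-(2 * Real.pi * Complex.I * l S * x)))
      Filter.atTop (𝓝 (e y S * expTr S (L (y * Complex.I)))) := by
    intro y hy
    have hx : ∀ x : ℝ, HasSum (fun S => e y S * expTr S (L (y * Complex.I)) *
        Complex.exp (2 * Real.pi * Complex.I * l S * x)) (F (L (x + y * Complex.I))) := by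
      intro x
      have h1 := hP _ (line_mem Z.2 hV (w := x + y * Complex.I) (by simpa using hy))
      rw [map_im_line] at h1
      have h2 : (x + y * Complex.I : ℂ).im = y := by simp
      rw [h2] at h1
      refine h1.congr_fun fun S => ?_
      rw [mul_assoc, ← expTr_smul_ofReal, ← expTr_add]
      change _ = e y S * expTr S (Z.1 + (x + y * Complex.I : ℂ) • V.map Complex.ofReal)
      rw [add_smul, hL]
      simp only [add_assoc]
      rw [add_comm ((y * Complex.I : ℂ) • V.map Complex.ofReal)]
    have h0 := (hx 0).summable.norm
    simp only [Complex.ofReal_zero, mul_zero, Complex.exp_zero, mul_one] at h0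
    exact tendsto_mean hinj h0 hx S
  have hconst : ∀ y : ℝ, 0 ≤ y → e 0 S = e y S := by
    intro y hy
    obtain ⟨C, hC⟩ := exists_bound_line hF hN hper Z.2 hV y
    have hlim0 := hmean 0 le_rfl
    have hlimy := (hmean y hy).mul_const (Complex.exp (2 * Real.pi * l S * y))
    simp only [Complex.ofReal_zero, zero_mul, add_zero] at hlim0
    have hE : ∀ w : ℂ, ‖Complex.exp (-(2 * Real.pi * Complex.I * l S * w))‖ =
        Real.exp (2 * Real.pi * l S * w.im) := by
      intro w
      rw [Complex.norm_exp]
      congr 1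
      simp [mul_assoc]
    have key := mean_eq_of_bounded (h := fun w => F (L w) *
        Complex.exp (-(2 * Real.pi * Complex.I * l S * w))) (C := C *
          Real.exp (2 * Real.pi * |l S| * y)) hy
        ((differentiableOn_line hF Z.2 hV).mul (by fun_prop)) (fun w hw hwy => by
          rw [norm_mul, hE]
          have h3 : Real.exp (2 * Real.pi * l S * w.im) ≤
              Real.exp (2 * Real.pi * |l S| * y) := by
            rw [Real.exp_le_exp]
            have h4 : l S * w.im ≤ |l S| * y :=
              (mul_le_mul_of_nonneg_right (le_abs_self _) hw).trans
                (mul_le_mul_of_nonneg_left hwy (abs_nonneg _))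
            nlinarith [Real.pi_pos]
          exact mul_le_mul (hC w hw hwy) h3 (Real.exp_pos _).le
            ((norm_nonneg _).trans (hC w hw hwy))) hlim0
        (hlimy.congr fun T => by
          rw [mul_assoc, ← intervalIntegral.integral_mul_const]
          congr 1
          refine intervalIntegral.integral_congr fun x _ => ?_
          rw [mul_assoc, ← Complex.exp_add]
          congr 2
          linear_combination (2 * Real.pi * l S * y : ℂ) * Complex.I_sq)
    have h5 : expTr S (L (y * Complex.I)) * Complex.exp (2 * Real.pi * l S * y) =
        expTr S (L 0) := by
      simp only [hL]
      rw [expTr_add, expTr_add, expTr_smul_ofReal, expTr_smul_ofReal, mul_assoc, ← Complex.exp_add]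
      congr 2
      linear_combination (2 * Real.pi * l S * y : ℂ) * Complex.I_sq
    rw [mul_assoc, h5] at key
    exact mul_right_cancel₀ (expTr_ne_zero S _) key
  have htend : Filter.Tendsto (fun y : ℝ => e y S) Filter.atTop
      (𝓝 (MvPolynomial.eval 0 (P S))) :=
    ((MvPolynomial.continuous_eval (P S)).tendsto 0).comp (tendsto_inv_line hV)
  have h6 := tendsto_nhds_unique htend (tendsto_const_nhds.congr'
    (Filter.eventually_atTop.2 ⟨0, fun y hy => hconst y hy⟩))
  have h7 : e 0 S =
      MvPolynomial.eval (symEntries ((2 * Real.pi) • Z.1.map Complex.im)⁻¹) (P S) := by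
    simp only [he, zero_smul, add_zero]
  rw [← h7, ← h6, ← MvPolynomial.constantCoeff_eq, MvPolynomial.eval_zero]

/-- The Fourier expansion of a holomorphic function of period `N` has constant coefficients, and its
frequencies have entries in `(2N)⁻¹ ℤ`. -/
theorem fourier_of_periodic (hF : DifferentiableOn ℂ F (upperHalfSpace m)) (hN : 0 < N)
    (hper : ∀ z : upperHalfSpace m, ∀ B : Matrix (Fin m) (Fin m) ℤ, B.IsSymm →
      F (z.1 + (N : ℂ) • B.map (Int.cast : ℤ → ℂ)) = F z.1)
    {P : FourierIndex m → MvPolynomial (SymIndex m) ℂ} (hP : HasFourierExpansion F P) :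
    (∀ z : upperHalfSpace m, HasSum (fun S => (P S).coeff 0 * expTr S z.1) (F z.1)) ∧
      ∀ S, (P S).coeff 0 ≠ 0 → ∀ i j, ∃ n : ℤ, 2 * N * S.1 i j = n := by
  have h1 : ∀ z : upperHalfSpace m, HasSum (fun S => (P S).coeff 0 * expTr S z.1) (F z.1) :=
    fun z => (hP z.1 z.2).congr_fun fun S => by
      rw [← eval_eq_coeff_zero hF hN hper hP S z]; rfl
  refine ⟨h1, fun S hS i j => ?_⟩
  -- For this `B`, also if `i = j`, one has `tr(SB) = 2 S_{ij}`.
  set B : Matrix (Fin m) (Fin m) ℤ := Matrix.single i j 1 + Matrix.single j i 1 with hB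
  have hBs : B.IsSymm := by
    rw [Matrix.IsSymm, hB, transpose_add, transpose_single, transpose_single, add_comm]
  have hmem : ∀ z : upperHalfSpace m,
      z.1 + (N : ℂ) • B.map (Int.cast : ℤ → ℂ) ∈ upperHalfSpace m := by
    intro z
    refine ⟨z.2.1.add ((hBs.map _).smul _), ?_⟩
    have : (z.1 + (N : ℂ) • B.map (Int.cast : ℤ → ℂ)).map Complex.im = z.1.map Complex.im := by
      ext i j
      simp
    rw [this]
    exact z.2.2
  have h2 : ∀ z : upperHalfSpace m, HasSum (fun S => ((P S).coeff 0 *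
      expTr S ((N : ℂ) • B.map (Int.cast : ℤ → ℂ))) * expTr S z.1) (F z.1) := by
    intro z
    rw [← hper z B hBs]
    refine (h1 ⟨_, hmem z⟩).congr_fun fun S => ?_
    rw [expTr_add]
    ring
  have h3 := congr_fun (fourier_unique h1 h2) S
  have h4 : expTr S ((N : ℂ) • B.map (Int.cast : ℤ → ℂ)) = 1 :=
    (mul_left_cancel₀ hS ((mul_one _).trans h3)).symm
  rw [expTr, Complex.exp_eq_one_iff] at h4
  obtain ⟨n, hn⟩ := h4
  refine ⟨n, ?_⟩
  have h5 : (S.1.map (Rat.cast : ℚ → ℂ) * (N : ℂ) • B.map (Int.cast : ℤ → ℂ)).trace =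
      2 * N * S.1 i j := by
    have : B.map (Int.cast : ℤ → ℂ) = Matrix.single i j 1 + Matrix.single j i 1 := by
      ext a b
      simp [hB, Matrix.single_apply]
    rw [this, Matrix.mul_smul, trace_smul, Matrix.mul_add, trace_add, Matrix.trace_mul_single,
      Matrix.trace_mul_single]
    simp only [map_apply, MulOpposite.op_one, one_smul, smul_eq_mul]
    rw [S.2.1.apply i j]
    ring
  rw [h5, mul_comm] at hn
  have h6 := mul_right_cancel₀ Complex.two_pi_I_ne_zero hn
  exact_mod_cast h6

end Periodic

end

/-! ### The ring of `p`-integral algebraic numbers -/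

theorem mem_pIntegers {p : ℕ} (x : algebraicClosure ℚ ℂ)
    (h : ∀ A : ValuationSubring (algebraicClosure ℚ ℂ),
      (p : algebraicClosure ℚ ℂ) ∈ A.nonunits → x ∈ A) : (x : ℂ) ∈ pIntegers p := by
  exact ⟨x, Subring.mem_iInf.2 fun A => Subring.mem_iInf.2 fun hA => h A hA, rfl⟩

/-- A valuation ring contains `i` or `i⁻¹ = -i`. -/
theorem I_mem_pIntegers (p : ℕ) : Complex.I ∈ pIntegers p := by
  have halg : Complex.I ∈ algebraicClosure ℚ ℂ := by
    rw [mem_algebraicClosure_iff']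
    refine IsIntegral.of_pow (n := 2) two_pos ?_
    rw [Complex.I_sq]
    exact isIntegral_one.neg
  refine mem_pIntegers ⟨_, halg⟩ fun A _ => ?_
  set y : algebraicClosure ℚ ℂ := ⟨_, halg⟩
  have hy : y⁻¹ = -y := Subtype.ext (by
    change (Complex.I)⁻¹ = -Complex.I
    exact Complex.inv_I)
  rcases A.mem_or_inv_mem y with h | h
  · exact h
  · rw [hy] at h
    exact neg_neg y ▸ A.neg_mem _ h

theorem inv_natCast_mem_pIntegers {p n : ℕ} (hp : p.Prime) (hn : ¬ p ∣ n) :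
    (n : ℂ)⁻¹ ∈ pIntegers p := by
  have key : (((n : algebraicClosure ℚ ℂ)⁻¹ : algebraicClosure ℚ ℂ) : ℂ) ∈ pIntegers p := by
    refine mem_pIntegers _ fun A hA => ?_
    have hA' := (ValuationSubring.mem_nonunits_iff A).1 hA
    have hint : ∀ k : ℤ, A.valuation (k : algebraicClosure ℚ ℂ) ≤ 1 := fun k =>
      (A.valuation_le_one_iff _).2 (intCast_mem A k)
    have hcop : IsCoprime (n : ℤ) (p : ℤ) :=
      Nat.isCoprime_iff_coprime.2 ((Nat.Prime.coprime_iff_not_dvd hp).2 hn).symm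
    obtain ⟨a, b, hab⟩ := hcop
    have h1 : (a : algebraicClosure ℚ ℂ) * n + b * p = 1 := by
      have h := congrArg (Int.cast : ℤ → algebraicClosure ℚ ℂ) hab
      push_cast at h
      exact h
    have h2 : A.valuation (n : algebraicClosure ℚ ℂ) = 1 := by
      refine le_antisymm (by simp) (not_lt.1 fun hlt => ?_)
      have h3 : A.valuation ((a : algebraicClosure ℚ ℂ) * n + b * p) < 1 := by
        refine (A.valuation.map_add _ _).trans_lt (max_lt ?_ ?_)
        · rw [map_mul]
          exact (mul_le_of_le_one_left' (hint a)).trans_lt hlt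
        · rw [map_mul]
          exact (mul_le_of_le_one_left' (hint b)).trans_lt hA'
      rw [h1, map_one] at h3
      exact lt_irrefl _ h3
    rw [← A.valuation_le_one_iff, map_inv₀, h2, inv_one]
  exact_mod_cast key

/-! ### Modular forms for the principal congruence subgroup -/

/-- Forms for the principal congruence subgroup have period `N`. -/
theorem apply_add_of_slash {N k : ℕ} {F : Matrix (Fin m) (Fin m) ℂ → ℂ}
    (hF : ∀ γ ∈ principalCongruenceSubgroup m N, Set.EqOn (slash k F γ) F (upperHalfSpace m))
    (z : upperHalfSpace m) (B : Matrix (Fin m) (Fin m) ℤ) (hB : B.IsSymm) :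
    F (z.1 + (N : ℂ) • B.map (Int.cast : ℤ → ℂ)) = F z.1 := by
  obtain ⟨M, hM⟩ : ∃ M, M = (N : ℤ) • B := ⟨_, rfl⟩
  have hMa : ∀ i j, M i j = N * B i j := fun i j => by rw [hM]; rfl
  have hMs : M.IsSymm := hM ▸ hB.smul _
  have hmem : fromBlocks 1 M 0 1 ∈ symplecticGroup (Fin m) ℤ := by
    rw [SymplecticGroup.fromBlocks_mem_iff]
    simp [hMs.eq]
  have hΓ : (⟨_, hmem⟩ : symplecticGroup (Fin m) ℤ) ∈ principalCongruenceSubgroup m N := by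
    refine MonoidHom.mem_ker.2 ?_
    change (fromBlocks 1 M 0 1).map (Int.castRingHom (ZMod N)) = 1
    rw [fromBlocks_map, Matrix.map_one _ (map_zero _) (map_one _),
      Matrix.map_zero _ (map_zero _), ← fromBlocks_one]
    congr 1
    ext i j
    simp [hMa]
  rw [← hF _ hΓ z.2, slash]
  have h1 : denom ⟨fromBlocks 1 M 0 1, hmem⟩ z.1 = 1 := by
    simp [denom]
  have h2 : num ⟨fromBlocks 1 M 0 1, hmem⟩ z.1 =
      z.1 + (N : ℂ) • B.map (Int.cast : ℤ → ℂ) := by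
    simp only [num, toBlocks_fromBlocks₁₁, toBlocks_fromBlocks₁₂]
    rw [Matrix.map_one _ Int.cast_zero Int.cast_one, one_mul]
    congr 1
    ext i j
    simp [hMa]
  rw [h1, h2, det_one, one_pow, inv_one, one_mul, inv_one, mul_one]

theorem slashSmooth_smul {g : Matrix (Fin m ⊕ Fin m) (Fin m ⊕ Fin m) ℝ}
    (hg : g ∈ symplecticGroup (Fin m) ℝ) (k : ℕ) (c : ℂ) (f : smoothAlg m) :
    slashSmooth hg k (c • f) = c • slashSmooth hg k f := by
  rw [slashSmooth, slashSmooth, map_smul, mul_smul_comm]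

/-- A modular form over the `p`-integers has a Fourier series over them, with constant coefficients.
Its frequencies are `p`-integral because they lie in `(2N)⁻¹ ℤ`. -/
theorem isFourierSeries_of_modularFormsOver {N k p : ℕ} (hN : 0 < N) (hp : p.Prime)
    (hpN : ¬ p ∣ 2 * N) {F : Matrix (Fin m) (Fin m) ℂ → ℂ}
    (hF : F ∈ modularFormsOver k (principalCongruenceSubgroup m N) (pIntegers p)) :
    ∃ f : smoothAlg m, (∀ z : upperHalfSpace m, F z.1 = f.1 z) ∧
      IsFourierSeries (pIntegers p) f := by
  obtain ⟨⟨-, P, hP, hPR⟩, hd, hinv, -⟩ := hF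
  obtain ⟨h1, h2⟩ := fourier_of_periodic hd hN (apply_add_of_slash hinv) hP
  obtain ⟨f, hf⟩ := exists_smooth_of_hasSum h1
  refine ⟨f, hf, fun S => (P S).coeff 0, fun S => hPR S 0, fun S hS i j => ?_,
    fun z => hf z ▸ h1 z⟩
  obtain ⟨n, hn⟩ := h2 S hS i j
  have h3 : ((S.1 i j : ℚ) : ℂ) = n * ((2 * N : ℕ) : ℂ)⁻¹ := by
    have h4 : (2 * N : ℚ) ≠ 0 := by positivity
    have h5 : S.1 i j = n * ((2 * N : ℕ) : ℚ)⁻¹ := by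
      push_cast
      rw [← hn]
      field_simp
    rw [h5]
    push_cast
    rfl
  rw [h3]
  exact (pIntegers p).mul_mem (intCast_mem _ n) (inv_natCast_mem_pIntegers hp hpN)

end Siegel

end

theorem proposition5p1 (m k N r : ℕ) (hm : 0 < m) (hk : 0 < k) (hN : 0 < N) (hr : 0 < r)
    (p : ℕ) (hp : p.Prime) (hpN : ¬ p ∣ 2 * N)
    (F : Matrix (Fin m) (Fin m) ℂ → ℂ)
    (hF : F ∈ Siegel.modularFormsOver k (Siegel.principalCongruenceSubgroup m N)
      (Siegel.pIntegers p)) :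
    (fun Z => ((Real.pi : ℂ) ^ (m * r))⁻¹ * Siegel.iteratedMaass k r F Z) ∈
      Siegel.nearlyHolomorphicFormsOver (k + 2 * r) (Siegel.principalCongruenceSubgroup m N)
        (Siegel.pIntegers p) := by
  open Siegel in
  obtain ⟨f, hf, hfS⟩ := isFourierSeries_of_modularFormsOver hN hp hpN hF
  have hhalf : (1 / 2 : ℂ) ∈ pIntegers p := by
    have := inv_natCast_mem_pIntegers hp (fun h => hpN (h.mul_right N))
    rw [one_div]
    exact_mod_cast this
  set c : ℂ := ((Real.pi : ℂ) ^ (m * r))⁻¹ with hc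
  set G : Matrix (Fin m) (Fin m) ℂ → ℂ := fun Z => c * iteratedMaass k r F Z with hGdef
  have hG : ∀ z : upperHalfSpace m, G z.1 = (c • maassIter k r f).1 z := by
    intro z
    rw [hGdef]
    simp only
    rw [iteratedMaass_eq hf]
    rfl
  have hslash : ∀ (γ : Matrix.symplecticGroup (Fin m) ℤ) (z : upperHalfSpace m),
      slash (k + 2 * r) G γ z.1 =
        (c • maassIter k r (slashSmooth (toReal_mem γ) k f)).1 z := by
    intro γ z
    rw [slash_eq hG, slashSmooth_smul, maassIter_slashSmooth]
  have hmem := maassIter_mem_nearlyFourier (I_mem_pIntegers p) hhalf k r hfS.mem_nearlyFourier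
  obtain ⟨P, hP, hPR⟩ := exists_expansion_of_mem_nearlyFourier hmem
  refine ⟨⟨isNearlyHolomorphic_of_mem_nearlyFourier hmem hG, fun γ hγ Z hZ => ?_,
    fun h1 γ => ?_⟩, P, fun Z hZ => ?_, hPR⟩
  · have hinv : slashSmooth (toReal_mem γ) k f = f := evalAt_ext fun z => by
      rw [evalAt_apply, evalAt_apply, ← slash_eq hf, ← hf]
      exact hF.2.2.1 γ hγ z.2
    rw [hslash γ ⟨Z, hZ⟩, hinv, hG ⟨Z, hZ⟩]
  -- No integrality is asked for at the other cusps, so the ring is all of `ℂ` there.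
  · obtain ⟨a, ha⟩ := hF.2.2.2 h1 γ
    have hS : IsFourierSeries ⊤ (slashSmooth (toReal_mem γ) k f) := by
      refine ⟨a, fun _ => trivial, fun _ _ _ _ => trivial, fun z => ?_⟩
      have h2 := ha z.1 z.2
      rw [slash_eq hf] at h2
      exact h2.congr_fun fun S => by rw [MvPolynomial.eval_C]; rfl
    obtain ⟨Q, hQ, -⟩ := exists_expansion_of_mem_nearlyFourier
      (maassIter_mem_nearlyFourier (R := ⊤) trivial trivial k r hS.mem_nearlyFourier)
    exact ⟨Q, fun Z hZ => hslash γ ⟨Z, hZ⟩ ▸ hQ ⟨Z, hZ⟩⟩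
  · exact hG ⟨Z, hZ⟩ ▸ hP ⟨Z, hZ⟩
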